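/- Let $\rho:\mathfrak g\to\mathrm{gl}(V)$ be a finite-dimensional representation of a finite-dimensional complex Lie algebra. For $x\in V$ let $R_x:\mathfrak g\to V$, $R_x(\xi)=\rho(\xi)x$, and let $r=\max_{x\in V}\mathrm{rk}\,R_x$. A point $a\in V$ is regular if $\dim\mathrm{Ker}\,R_a\le\dim\mathrm{Ker}\,R_x$ for all $x\in V$. By Kronecker's theorem, a pencil $A+\lambda B$ of linear maps $U\to V$ between finite-dimensional complex vector spaces is, in suitable bases of $U$ and $V$, block-diagonal with Jordan blocks (with eigenvalues in $\mathbb C\cup\{\infty\}$), horizontal Kronecker blocks of size $\varepsilon\times(\varepsilon+1)$ and vertical Kronecker blocks of size $(\eta+1)\times\eta$ ($\varepsilon,\eta\ge 0$), and the blocks are unique up to order. The total Kronecker $h$-index $\mathsf k_{\mathrm{hor}}$ of the pencil is the total number of columns in its horizontal Kronecker blocks, and the total Kronecker $v$-index $\mathsf k_{\mathrm{vert}}$ is the total number of rows in its vertical Kronecker blocks. The characteristic polynomial of the pencil is the greatest common divisor in $\mathbb C[\lambda,\mu]$ of all minors of $\mu A+\lambda B$ of size $\max_{\lambda\in\mathbb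 C}\mathrm{rk}(A+\lambda B)$. For $x,a\in V$ write $\mathsf k_{\mathrm{hor}}(x,a)$, $\mathsf k_{\mathrm{vert}}(x,a)$ and $D_r(x,a)$ for the total Kronecker indices and the characteristic polynomial of the pencil $R_{x+\lambda a}=R_x+\lambda R_a$. The algebraic type of a pencil consists of the number of distinct eigenvalues of its Jordan blocks (counting $\infty$), the number and sizes of the Jordan blocks for each eigenvalue, and the sizes of its Kronecker blocks. The algebraic type of $R_{x+\lambda a}$ is constant on a non-empty Zariski open set of pairs $(x,a)\in V\times V$; the pairs in such a set are called generic, and $\mathsf k_{\mathrm{hor}}(\rho)$, $\mathsf k_{\mathrm{vert}}(\rho)$ denote the values of $\mathsf k_{\mathrm{hor}}(x,a)$, $\mathsf k_{\mathrm{vert}}(x,a)$ at generic pairs. Let $p_1,\dots,p_N\in\mathbb C[V]$ be the $r\times r$ minors of the matrix of $R_x$, regarded as polynomials in $x$, that do not vanish identically. Let the fundamental semi-invariant $\mathsf p_\rho$ be their greatest common divisor, write $p_i=\mathsf p_\rho h_i$, and put $\mathsf{Sing}_1=\{x\in V: h_1(x)=\dots=h_N(x)=0\}$. **Proposition.** Let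 $a\in V$ be regular, and let $x\in V$ be such that $x+\lambda a\notin\mathsf{Sing}_1$ for all $\lambda\in\mathbb C$. Then $$\mathsf k_{\mathrm{hor}}(x,a)=\mathsf k_{\mathrm{hor}}(\rho),\qquad \mathsf k_{\mathrm{vert}}(x,a)=\mathsf k_{\mathrm{vert}}(\rho),\qquad \deg D_r(x,a)=\deg\mathsf p_\rho .$$ -/

import Mathlib

open scoped OnePoint

namespace JK

noncomputable section

/-! ### Kronecker canonical form of a pencil of linear maps -/

/-- The blocks of the Kronecker canonical form of a pencil `A + λ B` of complex matrices.
* `jordan e n`: Jordan block of size `n + 1` with eigenvalue `e`, where `e` is a complex number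
  or `∞`;
* `hor ε`: horizontal Kronecker block of size `ε × (ε + 1)`;
* `vert η`: vertical Kronecker block of size `(η + 1) × η`.

The zero block of size `g × h` is the sum of `g` blocks `vert 0` and `h` blocks `hor 0`. -/
inductive Block : Type
  | jordan (e : OnePoint ℂ) (n : ℕ) : Block
  | hor (ε : ℕ) : Block
  | vert (η : ℕ) : Block

namespace Block

/-- Number of rows. -/
def rows : Block → ℕ
  | jordan _ n => n + 1
  | hor ε => ε
  | vert η => η + 1

/-- Number of columns. -/
def cols : Block → ℕ
  | jordan _ n => n + 1
  | hor ε => ε + 1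
  | vert η => η

/-- The constant coefficient `A` of the block `A + λ B`. -/
def matA : (b : Block) → Matrix (Fin b.rows) (Fin b.cols) ℂ
  | jordan (OnePoint.some c) _ => Matrix.of fun i j =>
      if i.val = j.val then c else if i.val + 1 = j.val then 1 else 0
  | jordan ∞ _ => Matrix.of fun i j => if i.val = j.val then 1 else 0
  | hor _ => Matrix.of fun i j => if i.val = j.val then 1 else 0
  | vert _ => Matrix.of fun i j => if i.val = j.val then 1 else 0

/-- The coefficient `B` of `λ` in the block `A + λ B`. -/
def matB : (b : Block) → Matrix (Fin b.rows) (Fin b.cols) ℂ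
  | jordan (OnePoint.some _) _ => Matrix.of fun i j => if i.val = j.val then 1 else 0
  | jordan ∞ _ => Matrix.of fun i j => if i.val + 1 = j.val then 1 else 0
  | hor _ => Matrix.of fun i j => if i.val + 1 = j.val then 1 else 0
  | vert _ => Matrix.of fun i j => if i.val = j.val + 1 then 1 else 0

/-- The number of columns of a horizontal Kronecker block; other blocks count as `0`. -/
def horCols : Block → ℕ
  | hor ε => ε + 1
  | _ => 0

/-- The number of rows of a vertical Kronecker block; other blocks count as `0`. -/
def vertRows : Block → ℕ
  | vert η => η + 1
  | _ => 0

/-- Rename the eigenvalue of a Jordan block, leaving the Kronecker blocks unchanged. -/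
def renameEigenvalue (σ : Equiv.Perm (OnePoint ℂ)) : Block → Block
  | jordan e n => jordan (σ e) n
  | hor ε => hor ε
  | vert η => vert η

end Block

/-- Two lists of blocks describe the same algebraic type: same minimal row and column indices, same
number of distinct eigenvalues, and the same numbers and sizes of the Jordan blocks attached to
corresponding eigenvalues (the eigenvalues themselves are not part of the type). -/
def SameType (S T : List Block) : Prop :=
  ∃ σ : Equiv.Perm (OnePoint ℂ), (S.map (Block.renameEigenvalue σ)).Perm T

section Pencil

variable {U V : Type*} [AddCommGroup U] [Module ℂ U] [AddCommGroup V] [Module ℂ V]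

/-- In suitable bases of `U` and `V` the pencil `A + λ B` is block-diagonal with blocks `S`. -/
def IsCanonicalForm (A B : U →ₗ[ℂ] V) (S : List Block) : Prop :=
  ∃ (u : Module.Basis (Σ i : Fin S.length, Fin (S.get i).cols) ℂ U)
    (v : Module.Basis (Σ i : Fin S.length, Fin (S.get i).rows) ℂ V),
    LinearMap.toMatrix u v A = Matrix.blockDiagonal' (fun i => (S.get i).matA) ∧
    LinearMap.toMatrix u v B = Matrix.blockDiagonal' (fun i => (S.get i).matB)

/-- The total Kronecker `h`-index: the total number of columns in the horizontal blocks of the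
canonical form. (The canonical form exists and is unique up to order, so the set is a
singleton.) -/
def kHor (A B : U →ₗ[ℂ] V) : ℕ :=
  sInf {k | ∃ S, IsCanonicalForm A B S ∧ (S.map Block.horCols).sum = k}

/-- The total Kronecker `v`-index: the total number of rows in the vertical blocks of the
canonical form. -/
def kVert (A B : U →ₗ[ℂ] V) : ℕ :=
  sInf {k | ∃ S, IsCanonicalForm A B S ∧ (S.map Block.vertRows).sum = k}

/-- The rank of the pencil: the maximum of `rk (A + λ B)` over all complex `λ`. -/
def pencilRank (A B : U →ₗ[ℂ] V) : ℕ :=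
  ⨆ t : ℂ, Module.finrank ℂ (LinearMap.range (A + t • B))

end Pencil

/-- The `r × r` minor of `M` with rows `s.1` and columns `s.2`. -/
def minor {R : Type*} [CommRing R] {m n : ℕ} (M : Matrix (Fin m) (Fin n) R) (r : ℕ)
    (s : (Fin r ↪ Fin m) × (Fin r ↪ Fin n)) : R :=
  (M.submatrix s.1 s.2).det

/-- The greatest common divisor of all `r × r` minors of a matrix of complex polynomials (defined
up to a nonzero constant factor). -/
def minorGcd {σ : Type*} {m n : ℕ} (M : Matrix (Fin m) (Fin n) (MvPolynomial σ ℂ)) (r : ℕ) :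
    MvPolynomial σ ℂ :=
  letI : NormalizedGCDMonoid (MvPolynomial σ ℂ) := Classical.arbitrary _
  Finset.univ.gcd (minor M r)

section CharPoly

variable {U V : Type*} [AddCommGroup U] [Module ℂ U] [FiniteDimensional ℂ U]
  [AddCommGroup V] [Module ℂ V] [FiniteDimensional ℂ V]

/-- The matrix of a linear map in fixed bases. -/
def mat (A : U →ₗ[ℂ] V) : Matrix (Fin (Module.finrank ℂ V)) (Fin (Module.finrank ℂ U)) ℂ :=
  LinearMap.toMatrix (Module.finBasis ℂ U) (Module.finBasis ℂ V) A

/-- The matrix `μ A + λ B`, where `λ` is the variable `X 0` and `μ` is the variable `X 1`. -/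
def pencilMatrix (A B : U →ₗ[ℂ] V) :
    Matrix (Fin (Module.finrank ℂ V)) (Fin (Module.finrank ℂ U)) (MvPolynomial (Fin 2) ℂ) :=
  Matrix.of fun i j => MvPolynomial.X 1 * MvPolynomial.C (mat A i j) +
    MvPolynomial.X 0 * MvPolynomial.C (mat B i j)

/-- The characteristic polynomial `D_r(λ, μ)` of the pencil, `r` being the rank of the pencil. -/
def charPoly (A B : U →ₗ[ℂ] V) : MvPolynomial (Fin 2) ℂ :=
  minorGcd (pencilMatrix A B) (pencilRank A B)

end CharPoly

/-- Zariski open subsets of a finite-dimensional complex vector space. -/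
def IsZariskiOpen {E : Type*} [AddCommGroup E] [Module ℂ E] [FiniteDimensional ℂ E]
    (W : Set E) : Prop :=
  ∃ P : Set (MvPolynomial (Fin (Module.finrank ℂ E)) ℂ),
    W = {e | ∃ p ∈ P, MvPolynomial.eval ((Module.finBasis ℂ E).equivFun e) p ≠ 0}

/-! ### Representations of Lie algebras -/

section Rep

variable {𝔤 V : Type*} [LieRing 𝔤] [LieAlgebra ℂ 𝔤] [AddCommGroup V] [Module ℂ V]
  [LieRingModule 𝔤 V] [LieModule ℂ 𝔤 V]

variable (𝔤) in
/-- The operator `R_x : 𝔤 → V`, `R_x ξ = ρ(ξ) x`, where the representation `ρ` is the action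
`ρ(ξ) x = ⁅ξ, x⁆` of `𝔤` on the module `V`. -/
def R (x : V) : 𝔤 →ₗ[ℂ] V where
  toFun ξ := ⁅ξ, x⁆
  map_add' ξ η := add_lie ξ η x
  map_smul' c ξ := smul_lie c ξ x

variable (𝔤) in
/-- A point is regular if its stabiliser has the minimal dimension. -/
def IsRegular (a : V) : Prop :=
  ∀ x : V, Module.finrank ℂ (LinearMap.ker (R 𝔤 a)) ≤ Module.finrank ℂ (LinearMap.ker (R 𝔤 x))

variable (𝔤 V) in
/-- The dimension of a regular orbit: the maximum of `rk R_x` over `x ∈ V`. -/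
def dimOrbReg : ℕ :=
  ⨆ x : V, Module.finrank ℂ (LinearMap.range (R 𝔤 x))

variable [FiniteDimensional ℂ V]

variable (𝔤) in
/-- The pair `(x, a)` is generic: it lies in a Zariski open subset of `V × V` on which the
algebraic type of the pencil `R_x + λ R_a` is constant. -/
def IsGenericPair (x a : V) : Prop :=
  ∃ W : Set (V × V), IsZariskiOpen W ∧ (x, a) ∈ W ∧
    ∃ S₀ : List Block, ∀ p ∈ W, ∃ S, IsCanonicalForm (R 𝔤 p.1) (R 𝔤 p.2) S ∧ SameType S S₀

variable (𝔤 V) in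
/-- The total Kronecker `h`-index of the representation: the value of `kHor` at generic pairs.
(Generic pairs exist and all have the same type, so the set is a singleton.) -/
def kHorRep : ℕ :=
  sInf {k | ∃ x a : V, IsGenericPair 𝔤 x a ∧ kHor (R 𝔤 x) (R 𝔤 a) = k}

variable (𝔤 V) in
/-- The total Kronecker `v`-index of the representation: the value of `kVert` at generic pairs. -/
def kVertRep : ℕ :=
  sInf {k | ∃ x a : V, IsGenericPair 𝔤 x a ∧ kVert (R 𝔤 x) (R 𝔤 a) = k}

variable [FiniteDimensional ℂ 𝔤]

variable (𝔤 V) in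
/-- The matrix of `R_x`, whose entries are linear forms in the coordinates of `x`. -/
def genericMatrix :
    Matrix (Fin (Module.finrank ℂ V)) (Fin (Module.finrank ℂ 𝔤))
      (MvPolynomial (Fin (Module.finrank ℂ V)) ℂ) :=
  Matrix.of fun i j => ∑ k, MvPolynomial.C (mat (R 𝔤 (Module.finBasis ℂ V k)) i j) *
    MvPolynomial.X k

variable (𝔤 V) in
/-- The fundamental semi-invariant `p_ρ`: the greatest common divisor of the minors of `R_x` of
size `dimOrbReg 𝔤 V`. -/
def fundSemiInvariant : MvPolynomial (Fin (Module.finrank ℂ V)) ℂ :=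
  minorGcd (genericMatrix 𝔤 V) (dimOrbReg 𝔤 V)

variable (𝔤 V) in
/-- The set `Sing₁` of common zeros of the quotients `h_i = p_i / p_ρ`, where `p_i` runs through
the minors of `R_x` of size `dimOrbReg 𝔤 V` that do not vanish identically. -/
def Sing₁ : Set V :=
  {x | ∀ s, minor (genericMatrix 𝔤 V) (dimOrbReg 𝔤 V) s ≠ 0 →
    ∀ h, minor (genericMatrix 𝔤 V) (dimOrbReg 𝔤 V) s = fundSemiInvariant 𝔤 V * h →
      MvPolynomial.eval ((Module.finBasis ℂ V).equivFun x) h = 0}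

end Rep

end

end JK

/-! Every Kronecker block satisfies: rows + columns = rank + its contribution to exactly one of the
Jordan size, `k_hor` and `k_vert`. Hence, for a pencil of rank `r` of maps from `𝔤` to `V`, Jordan
size + `k_hor` + `k_vert` = `dim 𝔤 + dim V - r`. A regular direction `a` forces the rank of the
pencil to be the maximal one, so this total is the same for `(x, a)` as for a generic pair. It then
suffices to show that none of the three summands at `(x, a)` exceeds the generic one.

For the Kronecker indices this is semicontinuity of rank. Let `A + λ B` act on polynomial vectors of
degree at most `k`; the matrix of this action has rank `(k + 2) r + k_hor - dim 𝔤` once `k` is large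
(`IsKCF.rank_toeplitz`), and a rank can only go up at a generic point. Transposing treats `k_vert`.

For the Jordan part, the gcd of the maximal minors of the pencil is the product of the determinants
of its Jordan blocks (`IsKCF.prod_lin_dvd`, `IsKCF.dvd_prod_lin`), so the Jordan size is `deg D_r`.
The restriction of `p_ρ` to the homogenised line divides `D_r`, and restricting keeps its degree
because some minor does not vanish at `a`. Thus `deg D_r ≥ deg p_ρ` for every regular direction, in
particular for a suitable generic pair. If the line avoids `Sing₁`, equality holds
(`IsKCF.sum_jordanSize_eq`): an irreducible factor of the quotient would divide a linear factor of
`D_r`, hence vanish at a point of the line or at its point at infinity `a`, and it would divide the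
restrictions of all `h_i`. The first is excluded by hypothesis, the second by regularity. The
comparison is completed in `indices_eq_of_generic`.

Since the indices are defined through canonical forms, Kronecker's existence theorem is needed
(`hasKCF`); of uniqueness only the totals matter, and these are determined by ranks. Generic pairs
exist because a canonical form over the algebraic closure of the field of rational functions on `V ×
V` specialises at all points outside a hypersurface (`exists_generic_isKCF`). -/

namespace Kronecker

open Matrix

/-! ### Strict equivalence of matrix pencils -/

section MEquiv

variable {R : Type*} [CommRing R]

/-- Strict equivalence of matrix pencils. -/
def MEquiv {m n m' n' : Type*} [Fintype m] [Fintype n] [Fintype m'] [Fintype n']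
    [DecidableEq m] [DecidableEq n] [DecidableEq m'] [DecidableEq n']
    (A B : Matrix m n R) (A' B' : Matrix m' n' R) : Prop :=
  ∃ (P : Matrix m' m R) (P' : Matrix m m' R) (Q : Matrix n n' R) (Q' : Matrix n' n R),
    P * P' = 1 ∧ P' * P = 1 ∧ Q * Q' = 1 ∧ Q' * Q = 1 ∧ P * A * Q = A' ∧ P * B * Q = B'

variable {m n m' n' m'' n'' : Type*} [Fintype m] [Fintype n] [Fintype m'] [Fintype n']
  [Fintype m''] [Fintype n'']
  [DecidableEq m] [DecidableEq n] [DecidableEq m'] [DecidableEq n']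
  [DecidableEq m''] [DecidableEq n'']

theorem MEquiv.refl (A B : Matrix m n R) : MEquiv A B A B :=
  ⟨1, 1, 1, 1, by simp⟩

theorem MEquiv.symm {A B : Matrix m n R} {A' B' : Matrix m' n' R} (h : MEquiv A B A' B') :
    MEquiv A' B' A B := by
  obtain ⟨P, P', Q, Q', h1, h2, h3, h4, rfl, rfl⟩ := h
  have key : ∀ C : Matrix m n R, P' * (P * C * Q) * Q' = C := fun C => by
    calc P' * (P * C * Q) * Q' = (P' * P) * C * (Q * Q') := by simp only [Matrix.mul_assoc]
      _ = C := by rw [h2, h3]; simp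
  exact ⟨P', P, Q', Q, h2, h1, h4, h3, key A, key B⟩

theorem MEquiv.trans {A B : Matrix m n R} {A' B' : Matrix m' n' R} {A'' B'' : Matrix m'' n'' R}
    (h : MEquiv A B A' B') (h' : MEquiv A' B' A'' B'') : MEquiv A B A'' B'' := by
  obtain ⟨P, P', Q, Q', h1, h2, h3, h4, rfl, rfl⟩ := h
  obtain ⟨S, S', T, T', k1, k2, k3, k4, rfl, rfl⟩ := h'
  refine ⟨S * P, P' * S', Q * T, T' * Q', ?_, ?_, ?_, ?_, ?_, ?_⟩
  · calc S * P * (P' * S') = S * (P * P') * S' := by simp only [Matrix.mul_assoc]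
      _ = 1 := by rw [h1, Matrix.mul_one, k1]
  · calc P' * S' * (S * P) = P' * (S' * S) * P := by simp only [Matrix.mul_assoc]
      _ = 1 := by rw [k2, Matrix.mul_one, h2]
  · calc Q * T * (T' * Q') = Q * (T * T') * Q' := by simp only [Matrix.mul_assoc]
      _ = 1 := by rw [k3, Matrix.mul_one, h3]
  · calc T' * Q' * (Q * T) = T' * (Q' * Q) * T := by simp only [Matrix.mul_assoc]
      _ = 1 := by rw [h4, Matrix.mul_one, k4]
  · simp only [Matrix.mul_assoc]
  · simp only [Matrix.mul_assoc]

theorem MEquiv.transpose {A B : Matrix m n R} {A' B' : Matrix m' n' R} (h : MEquiv A B A' B') :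
    MEquiv Aᵀ Bᵀ A'ᵀ B'ᵀ := by
  obtain ⟨P, P', Q, Q', h1, h2, h3, h4, rfl, rfl⟩ := h
  refine ⟨Qᵀ, Q'ᵀ, Pᵀ, P'ᵀ, ?_, ?_, ?_, ?_, ?_, ?_⟩
  · rw [← Matrix.transpose_mul, h4, Matrix.transpose_one]
  · rw [← Matrix.transpose_mul, h3, Matrix.transpose_one]
  · rw [← Matrix.transpose_mul, h2, Matrix.transpose_one]
  · rw [← Matrix.transpose_mul, h1, Matrix.transpose_one]
  · simp only [Matrix.transpose_mul, Matrix.mul_assoc]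
  · simp only [Matrix.transpose_mul, Matrix.mul_assoc]

theorem MEquiv.map {S : Type*} [CommRing S] (f : R →+* S)
    {A B : Matrix m n R} {A' B' : Matrix m' n' R} (h : MEquiv A B A' B') :
    MEquiv (A.map f) (B.map f) (A'.map f) (B'.map f) := by
  obtain ⟨P, P', Q, Q', h1, h2, h3, h4, rfl, rfl⟩ := h
  refine ⟨P.map f, P'.map f, Q.map f, Q'.map f, ?_, ?_, ?_, ?_, ?_, ?_⟩
  · rw [← Matrix.map_mul, h1, Matrix.map_one f (map_zero f) (map_one f)]
  · rw [← Matrix.map_mul, h2, Matrix.map_one f (map_zero f) (map_one f)]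
  · rw [← Matrix.map_mul, h3, Matrix.map_one f (map_zero f) (map_one f)]
  · rw [← Matrix.map_mul, h4, Matrix.map_one f (map_zero f) (map_one f)]
  · simp only [Matrix.map_mul]
  · simp only [Matrix.map_mul]

theorem MEquiv.swap {A B : Matrix m n R} {A' B' : Matrix m' n' R} (h : MEquiv A B A' B') :
    MEquiv B A B' A' := by
  obtain ⟨P, P', Q, Q', h1, h2, h3, h4, h5, h6⟩ := h
  exact ⟨P, P', Q, Q', h1, h2, h3, h4, h6, h5⟩

theorem MEquiv.add_smul {A B : Matrix m n R} {A' B' : Matrix m' n' R} (c : R)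
    (h : MEquiv A B A' B') : MEquiv (A + c • B) B (A' + c • B') B' := by
  obtain ⟨P, P', Q, Q', h1, h2, h3, h4, rfl, rfl⟩ := h
  exact ⟨P, P', Q, Q', h1, h2, h3, h4, by simp [Matrix.mul_add, Matrix.add_mul], rfl⟩

theorem MEquiv.of_reindex (e : m' ≃ m) (f : n' ≃ n) {A B : Matrix m n R} {A' B' : Matrix m' n' R}
    (hA : ∀ i j, A (e i) (f j) = A' i j) (hB : ∀ i j, B (e i) (f j) = B' i j) :
    MEquiv A B A' B' := by
  have hP : ∀ C : Matrix m n R, (1 : Matrix m m R).submatrix e id * C *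
      (1 : Matrix n n R).submatrix id f = C.submatrix e f := by
    intro C
    ext i j
    simp [Matrix.mul_apply, Matrix.one_apply]
  refine ⟨(1 : Matrix m m R).submatrix e id, (1 : Matrix m m R).submatrix id e,
    (1 : Matrix n n R).submatrix id f, (1 : Matrix n n R).submatrix f id, ?_, ?_, ?_, ?_, ?_, ?_⟩
  · ext i j; simp [Matrix.mul_apply, Matrix.one_apply]
  · rw [Matrix.submatrix_mul_equiv]; simp
  · rw [Matrix.submatrix_mul_equiv]; simp
  · ext i j; simp [Matrix.mul_apply, Matrix.one_apply]
  · rw [hP]; ext i j; exact hA i j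
  · rw [hP]; ext i j; exact hB i j

theorem MEquiv.blockDiagonal' {ι : Type*} [Fintype ι] [DecidableEq ι] {r c r' c' : ι → Type*}
    [∀ i, Fintype (r i)] [∀ i, Fintype (c i)] [∀ i, Fintype (r' i)] [∀ i, Fintype (c' i)]
    [∀ i, DecidableEq (r i)] [∀ i, DecidableEq (c i)]
    [∀ i, DecidableEq (r' i)] [∀ i, DecidableEq (c' i)]
    {A B : ∀ i, Matrix (r i) (c i) R} {A' B' : ∀ i, Matrix (r' i) (c' i) R}
    (h : ∀ i, MEquiv (A i) (B i) (A' i) (B' i)) :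
    MEquiv (blockDiagonal' A) (blockDiagonal' B) (blockDiagonal' A') (blockDiagonal' B') := by
  choose P P' Q Q' h1 h2 h3 h4 h5 h6 using h
  refine ⟨Matrix.blockDiagonal' P, Matrix.blockDiagonal' P', Matrix.blockDiagonal' Q,
    Matrix.blockDiagonal' Q', ?_, ?_, ?_, ?_, ?_, ?_⟩
  · rw [← blockDiagonal'_mul, ← blockDiagonal'_one]; congr 1; ext1 i; exact h1 i
  · rw [← blockDiagonal'_mul, ← blockDiagonal'_one]; congr 1; ext1 i; exact h2 i
  · rw [← blockDiagonal'_mul, ← blockDiagonal'_one]; congr 1; ext1 i; exact h3 i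
  · rw [← blockDiagonal'_mul, ← blockDiagonal'_one]; congr 1; ext1 i; exact h4 i
  · rw [← blockDiagonal'_mul, ← blockDiagonal'_mul]; congr 1; ext1 i; exact h5 i
  · rw [← blockDiagonal'_mul, ← blockDiagonal'_mul]; congr 1; ext1 i; exact h6 i

theorem MEquiv.fromBlocks {p q p' q' : Type*} [Fintype p] [Fintype q] [Fintype p'] [Fintype q']
    [DecidableEq p] [DecidableEq q] [DecidableEq p'] [DecidableEq q']
    {A B : Matrix m n R} {A' B' : Matrix m' n' R} {C D : Matrix p q R} {C' D' : Matrix p' q' R}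
    (h : MEquiv A B A' B') (k : MEquiv C D C' D') :
    MEquiv (fromBlocks A 0 0 C) (fromBlocks B 0 0 D) (fromBlocks A' 0 0 C')
      (fromBlocks B' 0 0 D') := by
  obtain ⟨P, P', Q, Q', h1, h2, h3, h4, rfl, rfl⟩ := h
  obtain ⟨S, S', T, T', k1, k2, k3, k4, rfl, rfl⟩ := k
  refine ⟨Matrix.fromBlocks P 0 0 S, Matrix.fromBlocks P' 0 0 S', Matrix.fromBlocks Q 0 0 T,
    Matrix.fromBlocks Q' 0 0 T', ?_, ?_, ?_, ?_, ?_, ?_⟩ <;>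
  simp [fromBlocks_multiply, *]

end MEquiv

/-! ### Kronecker blocks and canonical forms over a commutative ring -/

/-- Blocks of the Kronecker canonical form over a commutative ring. -/
inductive PBlock (R : Type*) : Type _
  | jfin (c : R) (n : ℕ) : PBlock R
  | jinf (n : ℕ) : PBlock R
  | hor (ε : ℕ) : PBlock R
  | vert (η : ℕ) : PBlock R

namespace PBlock

variable {R : Type*}

/-- Number of rows. -/
def rows : PBlock R → ℕ
  | jfin _ n => n + 1
  | jinf n => n + 1
  | hor ε => ε
  | vert η => η + 1

/-- Number of columns. -/
def cols : PBlock R → ℕ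
  | jfin _ n => n + 1
  | jinf n => n + 1
  | hor ε => ε + 1
  | vert η => η

/-- The block of the transposed pencil. -/
def tr : PBlock R → PBlock R
  | jfin c n => jfin c n
  | jinf n => jinf n
  | hor ε => vert ε
  | vert η => hor η

/-- Apply a map to the eigenvalue. -/
def map {S : Type*} (f : R → S) : PBlock R → PBlock S
  | jfin c n => jfin (f c) n
  | jinf n => jinf n
  | hor ε => hor ε
  | vert η => vert η

theorem rows_map {S : Type*} (f : R → S) (b : PBlock R) : (b.map f).rows = b.rows := by
  cases b <;> rfl

theorem cols_map {S : Type*} (f : R → S) (b : PBlock R) : (b.map f).cols = b.cols := by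
  cases b <;> rfl

variable [CommRing R]

/-- The entries of the constant coefficient of the block. -/
def entA : PBlock R → ℕ → ℕ → R
  | jfin c _, i, j => if i = j then c else if i + 1 = j then 1 else 0
  | _, i, j => if i = j then 1 else 0

/-- The entries of the linear coefficient of the block. -/
def entB : PBlock R → ℕ → ℕ → R
  | jfin _ _, i, j => if i = j then 1 else 0
  | vert _, i, j => if i = j + 1 then 1 else 0
  | _, i, j => if i + 1 = j then 1 else 0

/-- The constant coefficient of the block. -/
def matA (b : PBlock R) : Matrix (Fin b.rows) (Fin b.cols) R :=
  Matrix.of fun i j => b.entA i.val j.val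

/-- The linear coefficient of the block. -/
def matB (b : PBlock R) : Matrix (Fin b.rows) (Fin b.cols) R :=
  Matrix.of fun i j => b.entB i.val j.val

theorem entA_map {S : Type*} [CommRing S] (f : R →+* S) (b : PBlock R) (i j : ℕ) :
    (b.map f).entA i j = f (b.entA i j) := by
  cases b <;> simp only [map, entA] <;> split_ifs <;> simp

theorem entB_map {S : Type*} [CommRing S] (f : R →+* S) (b : PBlock R) (i j : ℕ) :
    (b.map f).entB i j = f (b.entB i j) := by
  cases b <;> simp only [map, entB] <;> split_ifs <;> simp

/-- Reversing the order of rows and columns turns a transposed Jordan block back into itself; the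
two kinds of Kronecker blocks are literal transposes of each other. -/
theorem mequiv_transpose (b : PBlock R) :
    MEquiv b.matAᵀ b.matBᵀ b.tr.matA b.tr.matB := by
  have key : ∀ (e : Fin b.tr.rows ≃ Fin b.cols) (f : Fin b.tr.cols ≃ Fin b.rows),
      (∀ i j, b.entA (f j).val (e i).val = b.tr.entA i.val j.val) →
      (∀ i j, b.entB (f j).val (e i).val = b.tr.entB i.val j.val) →
      MEquiv b.matAᵀ b.matBᵀ b.tr.matA b.tr.matB := fun e f h1 h2 => MEquiv.of_reindex e f h1 h2
  have rev : ∀ (n : ℕ) (i j : Fin (n + 1)),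
      (j.rev.val = i.rev.val ↔ i.val = j.val) ∧ (j.rev.val + 1 = i.rev.val ↔ i.val + 1 = j.val) := by
    intro n i j
    simp only [Fin.val_rev]
    omega
  cases b with
  | jfin c n =>
    refine key (Fin.revPerm (n := n + 1)) (Fin.revPerm (n := n + 1)) ?_ ?_ <;>
    intro (i : Fin (n + 1)) (j : Fin (n + 1))
    · change (if j.rev.val = i.rev.val then c else if j.rev.val + 1 = i.rev.val then 1 else 0) =
        (if i.val = j.val then c else if i.val + 1 = j.val then 1 else 0)
      simp only [rev]
    · change (if j.rev.val = i.rev.val then (1 : R) else 0) = (if i.val = j.val then 1 else 0)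
      simp only [rev]
  | jinf n =>
    refine key (Fin.revPerm (n := n + 1)) (Fin.revPerm (n := n + 1)) ?_ ?_ <;>
    intro (i : Fin (n + 1)) (j : Fin (n + 1))
    · change (if j.rev.val = i.rev.val then (1 : R) else 0) = (if i.val = j.val then 1 else 0)
      simp only [rev]
    · change (if j.rev.val + 1 = i.rev.val then (1 : R) else 0) =
        (if i.val + 1 = j.val then 1 else 0)
      simp only [rev]
  | hor ε =>
    refine key (Equiv.refl (Fin (ε + 1))) (Equiv.refl (Fin ε)) ?_ ?_ <;> intro i j
    · change (if j.val = i.val then (1 : R) else 0) = if i.val = j.val then 1 else 0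
      simp only [eq_comm]
    · change (if j.val + 1 = i.val then (1 : R) else 0) = if i.val = j.val + 1 then 1 else 0
      simp only [eq_comm]
  | vert η =>
    refine key (Equiv.refl (Fin η)) (Equiv.refl (Fin (η + 1))) ?_ ?_ <;> intro i j
    · change (if j.val = i.val then (1 : R) else 0) = if i.val = j.val then 1 else 0
      simp only [eq_comm]
    · change (if j.val = i.val + 1 then (1 : R) else 0) = if i.val + 1 = j.val then 1 else 0
      simp only [eq_comm]

end PBlock

section Canonical

variable {R : Type*} [CommRing R]
variable {m n m' n' : Type*} [Fintype m] [Fintype n] [Fintype m'] [Fintype n']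
  [DecidableEq m] [DecidableEq n] [DecidableEq m'] [DecidableEq n']

/-- The pencil is strictly equivalent to the block diagonal pencil with blocks `b i`. -/
def IsKCF {ι : Type*} [Fintype ι] [DecidableEq ι] (b : ι → PBlock R) (A B : Matrix m n R) : Prop :=
  MEquiv A B (blockDiagonal' fun i => (b i).matA) (blockDiagonal' fun i => (b i).matB)

/-- The pencil has a Kronecker canonical form. -/
def HasKCF (A B : Matrix m n R) : Prop :=
  ∃ (ι : Type) (_ : Fintype ι) (_ : DecidableEq ι) (b : ι → PBlock R), IsKCF b A B

theorem HasKCF.congr {A B : Matrix m n R} {A' B' : Matrix m' n' R} (h : MEquiv A B A' B')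
    (k : HasKCF A' B') : HasKCF A B := by
  obtain ⟨ι, _, _, b, hb⟩ := k
  exact ⟨ι, _, _, b, h.trans hb⟩

theorem IsKCF.transpose {ι : Type*} [Fintype ι] [DecidableEq ι] {b : ι → PBlock R}
    {A B : Matrix m n R} (h : IsKCF b A B) : IsKCF (fun i => (b i).tr) Aᵀ Bᵀ := by
  have h1 := MEquiv.transpose h
  rw [blockDiagonal'_transpose, blockDiagonal'_transpose] at h1
  exact h1.trans (MEquiv.blockDiagonal' fun i => (b i).mequiv_transpose)

theorem HasKCF.of_transpose {A B : Matrix m n R} (h : HasKCF Aᵀ Bᵀ) : HasKCF A B := by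
  obtain ⟨ι, _, _, b, hb⟩ := h
  exact ⟨ι, _, _, _, hb.transpose⟩

theorem HasKCF.blockDiagonal' {ι : Type} [Fintype ι] [DecidableEq ι] {r c : ι → Type}
    [∀ i, Fintype (r i)] [∀ i, Fintype (c i)] [∀ i, DecidableEq (r i)] [∀ i, DecidableEq (c i)]
    {A B : ∀ i, Matrix (r i) (c i) R} (b : ι → PBlock R)
    (h : ∀ i, MEquiv (A i) (B i) (b i).matA (b i).matB) :
    HasKCF (Matrix.blockDiagonal' A) (Matrix.blockDiagonal' B) :=
  ⟨ι, _, _, b, MEquiv.blockDiagonal' h⟩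

theorem mequiv_fromBlocks_sum {ι κ : Type*} [Fintype ι] [DecidableEq ι] [Fintype κ]
    [DecidableEq κ] {r c : ι ⊕ κ → Type*} [∀ i, Fintype (r i)] [∀ i, Fintype (c i)]
    [∀ i, DecidableEq (r i)] [∀ i, DecidableEq (c i)] (M N : ∀ s, Matrix (r s) (c s) R) :
    MEquiv
      (Matrix.fromBlocks (Matrix.blockDiagonal' fun i => M (Sum.inl i)) 0 0
        (Matrix.blockDiagonal' fun i => M (Sum.inr i)))
      (Matrix.fromBlocks (Matrix.blockDiagonal' fun i => N (Sum.inl i)) 0 0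
        (Matrix.blockDiagonal' fun i => N (Sum.inr i)))
      (Matrix.blockDiagonal' M) (Matrix.blockDiagonal' N) := by
  refine MEquiv.of_reindex (Equiv.sumSigmaDistrib r) (Equiv.sumSigmaDistrib c) ?_ ?_
  all_goals
    rintro ⟨i | i, x⟩ ⟨j | j, y⟩
    · by_cases h : i = j
      · subst h; simp [blockDiagonal'_apply_eq]
      · simp [blockDiagonal'_apply_ne _ _ _ h,
          blockDiagonal'_apply_ne _ _ _ (Sum.inl_injective.ne h)]
    · rw [blockDiagonal'_apply_ne _ _ _ (by simp)]; rfl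
    · rw [blockDiagonal'_apply_ne _ _ _ (by simp)]; rfl
    · by_cases h : i = j
      · subst h; simp [blockDiagonal'_apply_eq]
      · simp [blockDiagonal'_apply_ne _ _ _ h,
          blockDiagonal'_apply_ne _ _ _ (Sum.inr_injective.ne h)]

theorem HasKCF.fromBlocks {p q : Type*} [Fintype p] [Fintype q] [DecidableEq p] [DecidableEq q]
    {A B : Matrix m n R} {C D : Matrix p q R} (h : HasKCF A B) (k : HasKCF C D) :
    HasKCF (fromBlocks A 0 0 C) (fromBlocks B 0 0 D) := by
  obtain ⟨ι, _, _, b, hb⟩ := h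
  obtain ⟨κ, _, _, c, hc⟩ := k
  exact ⟨ι ⊕ κ, inferInstance, inferInstance, Sum.elim b c, (MEquiv.fromBlocks hb hc).trans
    (mequiv_fromBlocks_sum (fun s => (Sum.elim b c s).matA) (fun s => (Sum.elim b c s).matB))⟩

/-- Block matrices of block diagonal matrices are block diagonal matrices of block matrices. -/
theorem mequiv_fromBlocks_blockDiagonal' {ι : Type*} [Fintype ι] [DecidableEq ι]
    {r c r' c' : ι → Type*}
    [∀ i, Fintype (r i)] [∀ i, Fintype (c i)] [∀ i, Fintype (r' i)] [∀ i, Fintype (c' i)]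
    [∀ i, DecidableEq (r i)] [∀ i, DecidableEq (c i)]
    [∀ i, DecidableEq (r' i)] [∀ i, DecidableEq (c' i)]
    (A₁ A₂ : ∀ i, Matrix (r i) (c i) R) (B₁ B₂ : ∀ i, Matrix (r i) (c' i) R)
    (C₁ C₂ : ∀ i, Matrix (r' i) (c i) R) (D₁ D₂ : ∀ i, Matrix (r' i) (c' i) R) :
    MEquiv
      (Matrix.fromBlocks (Matrix.blockDiagonal' A₁) (Matrix.blockDiagonal' B₁)
        (Matrix.blockDiagonal' C₁) (Matrix.blockDiagonal' D₁))
      (Matrix.fromBlocks (Matrix.blockDiagonal' A₂) (Matrix.blockDiagonal' B₂)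
        (Matrix.blockDiagonal' C₂) (Matrix.blockDiagonal' D₂))
      (Matrix.blockDiagonal' fun i => Matrix.fromBlocks (A₁ i) (B₁ i) (C₁ i) (D₁ i))
      (Matrix.blockDiagonal' fun i => Matrix.fromBlocks (A₂ i) (B₂ i) (C₂ i) (D₂ i)) := by
  refine MEquiv.of_reindex (Equiv.sigmaSumDistrib r r') (Equiv.sigmaSumDistrib c c') ?_ ?_
  all_goals
    rintro ⟨i, x⟩ ⟨j, y⟩
    by_cases h : i = j
    · subst h
      rcases x with x | x <;> rcases y with y | y <;> simp [blockDiagonal'_apply_eq]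
    · rw [blockDiagonal'_apply_ne _ _ _ h]
      rcases x with x | x <;> rcases y with y | y <;> simp [blockDiagonal'_apply_ne _ _ _ h]

end Canonical

end Kronecker

namespace Kronecker

open Matrix

/-! ### Coordinate descriptions of pairs of linear maps -/

section Represents

variable {K : Type*} [Field K]
variable {U V : Type*} [AddCommGroup U] [Module K U] [AddCommGroup V] [Module K V]
variable {m n m' n' : Type*} [Fintype m] [Fintype n] [Fintype m'] [Fintype n']
  [DecidableEq m] [DecidableEq n] [DecidableEq m'] [DecidableEq n']

/-- In suitable coordinates the linear maps `A` and `B` are given by the matrices `M` and `N`. -/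
def Represents (A B : U →ₗ[K] V) (M N : Matrix m n K) : Prop :=
  ∃ (Φ : (n → K) ≃ₗ[K] U) (Ψ : (m → K) ≃ₗ[K] V),
    ∀ c, A (Φ c) = Ψ (M *ᵥ c) ∧ B (Φ c) = Ψ (N *ᵥ c)

theorem Represents.of_bases (u : Module.Basis n K U) (v : Module.Basis m K V) (A B : U →ₗ[K] V) :
    Represents A B (LinearMap.toMatrix u v A) (LinearMap.toMatrix u v B) := by
  have key : ∀ (C : U →ₗ[K] V) (c : n → K),
      C (u.equivFun.symm c) = v.equivFun.symm (LinearMap.toMatrix u v C *ᵥ c) := by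
    intro C c
    rw [LinearEquiv.eq_symm_apply]
    conv_rhs => rw [← u.equivFun.apply_symm_apply c]
    exact (LinearMap.toMatrix_mulVec_repr u v C _).symm
  exact ⟨u.equivFun.symm, v.equivFun.symm, fun c => ⟨key A c, key B c⟩⟩

theorem Represents.mequiv {A B : U →ₗ[K] V} {M N : Matrix m n K} {M' N' : Matrix m' n' K}
    (h : Represents A B M N) (h' : Represents A B M' N') : MEquiv M N M' N' := by
  obtain ⟨Φ, Ψ, h⟩ := h
  obtain ⟨Φ', Ψ', h'⟩ := h'
  refine ⟨LinearMap.toMatrix' (Ψ.trans Ψ'.symm).toLinearMap,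
    LinearMap.toMatrix' (Ψ'.trans Ψ.symm).toLinearMap,
    LinearMap.toMatrix' (Φ'.trans Φ.symm).toLinearMap,
    LinearMap.toMatrix' (Φ.trans Φ'.symm).toLinearMap, ?_, ?_, ?_, ?_, ?_, ?_⟩
  · rw [← LinearMap.toMatrix'_comp, ← LinearMap.toMatrix'_id]; congr 1; ext; simp
  · rw [← LinearMap.toMatrix'_comp, ← LinearMap.toMatrix'_id]; congr 1; ext; simp
  · rw [← LinearMap.toMatrix'_comp, ← LinearMap.toMatrix'_id]; congr 1; ext; simp
  · rw [← LinearMap.toMatrix'_comp, ← LinearMap.toMatrix'_id]; congr 1; ext; simp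
  · apply Matrix.toLin'.injective
    apply LinearMap.ext
    intro c
    simp only [Matrix.toLin'_mul, Matrix.toLin'_toMatrix', LinearMap.comp_apply,
      Matrix.toLin'_apply, LinearEquiv.coe_coe, LinearEquiv.trans_apply]
    rw [← (h _).1, LinearEquiv.apply_symm_apply, (h' _).1, LinearEquiv.symm_apply_apply]
  · apply Matrix.toLin'.injective
    apply LinearMap.ext
    intro c
    simp only [Matrix.toLin'_mul, Matrix.toLin'_toMatrix', LinearMap.comp_apply,
      Matrix.toLin'_apply, LinearEquiv.coe_coe, LinearEquiv.trans_apply]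
    rw [← (h _).2, LinearEquiv.apply_symm_apply, (h' _).2, LinearEquiv.symm_apply_apply]

theorem Represents.congr {A B : U →ₗ[K] V} {M N : Matrix m n K} {M' N' : Matrix m' n' K}
    (h : Represents A B M N) (h' : MEquiv M N M' N') : Represents A B M' N' := by
  obtain ⟨Φ, Ψ, h⟩ := h
  obtain ⟨P, P', Q, Q', h1, h2, h3, h4, rfl, rfl⟩ := h'
  refine ⟨(Matrix.toLin'OfInv h4 h3).trans Φ, (Matrix.toLin'OfInv h1 h2).trans Ψ, fun c => ?_⟩
  have key : ∀ C : Matrix m n K, P' *ᵥ ((P * C * Q) *ᵥ c) = C *ᵥ (Q *ᵥ c) := fun C => by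
    rw [Matrix.mulVec_mulVec, Matrix.mulVec_mulVec, ← Matrix.mul_assoc, ← Matrix.mul_assoc, h2,
      Matrix.one_mul]
  simp [Matrix.toLin'OfInv, key, (h _).1, (h _).2]

end Represents

/-! ### Reduction of a pencil to the range of one of its maps -/

section Reduction

variable {K : Type*} [Field K]
variable {U V : Type*} [AddCommGroup U] [Module K U] [AddCommGroup V] [Module K V]

theorem exists_coordinates_range [FiniteDimensional K U] (S : Submodule K U) :
    ∃ (k : ℕ) (ζ : (Fin k → K) →ₗ[K] U), Function.Injective ζ ∧ LinearMap.range ζ = S := by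
  refine ⟨Module.finrank K S, S.subtype ∘ₗ (Module.finBasis K S).equivFun.symm.toLinearMap, ?_, ?_⟩
  · exact S.injective_subtype.comp (LinearEquiv.injective _)
  · rw [LinearMap.range_comp, LinearEquiv.range, Submodule.map_top, Submodule.range_subtype]

/-- The restriction of the pencil `D, G` to the preimage under `D` of the range of `G` and to the
range of `G` is given by the matrices `D₁` and `G₁`. -/
def Restriction {I J : Type*} [Fintype I] (D G : U →ₗ[K] V) (D₁ G₁ : Matrix J I K) : Prop :=
  ∃ (φ : (I → K) →ₗ[K] U) (ψ : (J → K) →ₗ[K] V), Function.Injective φ ∧ Function.Injective ψ ∧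
    LinearMap.range φ = (LinearMap.range G).comap D ∧ LinearMap.range ψ = LinearMap.range G ∧
    (∀ c, D (φ c) = ψ (D₁ *ᵥ c)) ∧ (∀ c, G (φ c) = ψ (G₁ *ᵥ c))

theorem Restriction.congr {I J I' J' : Type*} [Fintype I] [Fintype J] [Fintype I'] [Fintype J']
    [DecidableEq I] [DecidableEq J] [DecidableEq I'] [DecidableEq J'] {D G : U →ₗ[K] V}
    {D₁ G₁ : Matrix J I K} {D₂ G₂ : Matrix J' I' K}
    (h : Restriction D G D₁ G₁) (h' : MEquiv D₁ G₁ D₂ G₂) : Restriction D G D₂ G₂ := by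
  obtain ⟨φ, ψ, iφ, iψ, rφ, rψ, hD, hG⟩ := h
  obtain ⟨P, P', Q, Q', h1, h2, h3, h4, rfl, rfl⟩ := h'
  have key : ∀ C : Matrix J I K, ∀ c, P' *ᵥ ((P * C * Q) *ᵥ c) = C *ᵥ (Q *ᵥ c) := fun C c => by
    rw [Matrix.mulVec_mulVec, Matrix.mulVec_mulVec, ← Matrix.mul_assoc, ← Matrix.mul_assoc, h2,
      Matrix.one_mul]
  refine ⟨φ ∘ₗ (Matrix.toLin'OfInv h4 h3).toLinearMap, ψ ∘ₗ (Matrix.toLin'OfInv h1 h2).toLinearMap,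
    iφ.comp (LinearEquiv.injective _), iψ.comp (LinearEquiv.injective _), ?_, ?_, ?_, ?_⟩
  · rw [LinearMap.range_comp, LinearEquiv.range, Submodule.map_top, rφ]
  · rw [LinearMap.range_comp, LinearEquiv.range, Submodule.map_top, rψ]
  · intro c; simp [Matrix.toLin'OfInv, key, hD]
  · intro c; simp [Matrix.toLin'OfInv, key, hG]

variable [FiniteDimensional K U] [FiniteDimensional K V]

/-- Both maps send `D⁻¹(im G)` into `im G`. The size bounds make the induction descend whenever `G`
is not surjective. -/
theorem exists_restriction (D G : U →ₗ[K] V) : ∃ (m n : ℕ) (D₁ G₁ : Matrix (Fin m) (Fin n) K),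
    m = Module.finrank K (LinearMap.range G) ∧ n ≤ Module.finrank K U ∧ Restriction D G D₁ G₁ := by
  obtain ⟨n, φ, iφ, rφ⟩ := exists_coordinates_range ((LinearMap.range G).comap D)
  obtain ⟨m, ψ, iψ, rψ⟩ := exists_coordinates_range (LinearMap.range G)
  have key : ∀ C : U →ₗ[K] V, (∀ c, C (φ c) ∈ LinearMap.range G) →
      ∃ C₁ : Matrix (Fin m) (Fin n) K, ∀ c, C (φ c) = ψ (C₁ *ᵥ c) := by
    intro C hC
    rw [← rψ] at hC
    refine ⟨LinearMap.toMatrix' ((LinearEquiv.ofInjective ψ iψ).symm.toLinearMap ∘ₗ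
      (C ∘ₗ φ).codRestrict _ hC), fun c => ?_⟩
    rw [← Matrix.toLin'_apply, Matrix.toLin'_toMatrix']
    have := LinearEquiv.apply_symm_apply (LinearEquiv.ofInjective ψ iψ) ⟨C (φ c), hC c⟩
    exact (congrArg Subtype.val this).symm
  obtain ⟨D₁, hD⟩ := key D (fun c => by
    have : φ c ∈ (LinearMap.range G).comap D := rφ ▸ LinearMap.mem_range_self φ c
    exact this)
  obtain ⟨G₁, hG⟩ := key G (fun c => LinearMap.mem_range_self _ _)
  refine ⟨m, n, D₁, G₁, ?_, ?_, φ, ψ, iφ, iψ, rφ, rψ, hD, hG⟩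
  · rw [← rψ, LinearMap.finrank_range_of_inj iψ, Module.finrank_fin_fun]
  · rw [← Module.finrank_fin_fun K (n := n)]
    exact LinearMap.finrank_le_finrank_of_injective iφ

/-- The pencil is recovered from its restriction. The columns of `E` span a complement of the range
of `G₁` in `im G`; lift them through `G` to vectors `χ`, and complete to a basis of `U` by vectors
`ζ` of `ker G`. The vectors `D χ` and `D ζ` are independent modulo `im G`, since the domain of the
restriction is all of `D⁻¹(im G)`; adding them and a complement to `im G` gives the coordinates of
`V`. -/
theorem Restriction.represents {I J T : Type*} [Fintype I] [Fintype J] [Fintype T]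
    [DecidableEq I] [DecidableEq J] [DecidableEq T] {D G : U →ₗ[K] V}
    {D₁ G₁ : Matrix J I K} (h : Restriction D G D₁ G₁)
    {E : Matrix J T K} {X : Matrix I J K} {Y Z : Matrix T J K}
    (hXY : G₁ * X + E * Y = 1) (hZG : Z * G₁ = 0) (hZE : Z * E = 1) :
    ∃ k l : ℕ, Represents D G
      (fromRows (fromBlocks (fromBlocks D₁ 0 0 1) 0 0 1) 0 :
        Matrix (((J ⊕ T) ⊕ Fin k) ⊕ Fin l) ((I ⊕ T) ⊕ Fin k) K)
      (fromRows (fromBlocks (fromBlocks G₁ E 0 0) 0 0 0) 0) := by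
  obtain ⟨φ, ψ, hφ, hψ, rφ, rψ, hD, hG⟩ := h
  obtain ⟨χ, hχ⟩ : ∃ χ : (T → K) →ₗ[K] U, ∀ c, G (χ c) = ψ (E *ᵥ c) := by
    have : ∀ t : T, ∃ x : U, G x = ψ (E *ᵥ Pi.single t 1) := fun t => by
      have : ψ (E *ᵥ Pi.single t 1) ∈ LinearMap.range G := rψ ▸ LinearMap.mem_range_self _ _
      exact this
    choose x hx using this
    refine ⟨Fintype.linearCombination K x, fun c => ?_⟩
    have : G ∘ₗ Fintype.linearCombination K x = ψ ∘ₗ E.mulVecLin := by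
      refine LinearMap.pi_ext' fun t => LinearMap.ext_ring ?_
      simpa [Fintype.linearCombination_apply_single] using hx t
    exact LinearMap.congr_fun this c
  have hφχ : ∀ a b, G (φ a + χ b) = 0 → b = 0 := by
    intro a b h
    rw [map_add, hG, hχ, ← map_add] at h
    have h0 := hψ (h.trans (map_zero ψ).symm)
    -- `Z` reads off the `E`-component, because it kills the range of `G₁` and inverts `E` on the
    -- left.
    have h1 : Z *ᵥ (G₁ *ᵥ a + E *ᵥ b) = 0 := by rw [h0, Matrix.mulVec_zero]
    rw [Matrix.mulVec_add, Matrix.mulVec_mulVec, Matrix.mulVec_mulVec, hZG, hZE,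
      Matrix.zero_mulVec, Matrix.one_mulVec, zero_add] at h1
    exact h1
  have hφχ' : ∀ a b, φ a + χ b = 0 → a = 0 ∧ b = 0 := by
    intro a b h
    have hb : b = 0 := hφχ a b (by rw [h, map_zero])
    subst hb
    rw [map_zero, add_zero] at h
    exact ⟨hφ (h.trans (map_zero φ).symm), rfl⟩
  set W := LinearMap.range φ ⊔ LinearMap.range χ with hW
  have hWN : W ⊔ LinearMap.ker G = ⊤ := by
    rw [eq_top_iff]
    intro y _
    obtain ⟨γ, hγ⟩ : G y ∈ LinearMap.range ψ := rψ ▸ LinearMap.mem_range_self _ _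
    have h1 : G (φ (X *ᵥ γ) + χ (Y *ᵥ γ)) = G y := by
      rw [map_add, hG, hχ, ← map_add, Matrix.mulVec_mulVec, Matrix.mulVec_mulVec,
        ← Matrix.add_mulVec, hXY, Matrix.one_mulVec, hγ]
    have h2 : y = (φ (X *ᵥ γ) + χ (Y *ᵥ γ)) + (y - (φ (X *ᵥ γ) + χ (Y *ᵥ γ))) := by abel
    rw [h2]
    refine Submodule.add_mem_sup (Submodule.add_mem_sup (LinearMap.mem_range_self _ _)
      (LinearMap.mem_range_self _ _)) ?_
    rw [LinearMap.mem_ker, map_sub, h1, sub_self]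
  -- A complement of `W ∩ ker G` inside `ker G`; as `W + ker G` is everything, it is also a
  -- complement of `W` in `U`.
  obtain ⟨N', hN1, hN2⟩ := IsModularLattice.exists_disjoint_and_sup_eq
    (inf_le_right : W ⊓ LinearMap.ker G ≤ LinearMap.ker G)
  have hN'le : N' ≤ LinearMap.ker G := hN2 ▸ le_sup_right
  have hWN' : W ⊔ N' = ⊤ := by
    rw [← hWN, ← hN2, ← sup_assoc, sup_inf_self]
  have hdis : ∀ y ∈ W, y ∈ N' → y = 0 := fun y h1 h2 =>
    (Submodule.disjoint_def.mp hN1) y ⟨h1, hN'le h2⟩ h2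
  obtain ⟨k, ζ, hζ, rζ⟩ := exists_coordinates_range N'
  have hGζ : ∀ c, G (ζ c) = 0 := fun c =>
    hN'le (rζ ▸ LinearMap.mem_range_self ζ c)
  have hall : ∀ a b c, φ a + χ b + ζ c = 0 → a = 0 ∧ b = 0 ∧ c = 0 := by
    intro a b c h
    have hmem : φ a + χ b ∈ W :=
      Submodule.add_mem_sup (LinearMap.mem_range_self _ _) (LinearMap.mem_range_self _ _)
    have hc : ζ c ∈ N' := rζ ▸ LinearMap.mem_range_self ζ c
    have h1 : φ a + χ b = - ζ c := eq_neg_of_add_eq_zero_left h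
    have h2 : φ a + χ b = 0 := hdis _ hmem (h1 ▸ N'.neg_mem hc)
    rw [h2, zero_add] at h
    exact ⟨(hφχ' a b h2).1, (hφχ' a b h2).2, hζ (h.trans (map_zero ζ).symm)⟩
  let Φ₀ : ((I ⊕ T) ⊕ Fin k → K) →ₗ[K] U :=
    φ ∘ₗ LinearMap.funLeft K K (Sum.inl ∘ Sum.inl) + χ ∘ₗ LinearMap.funLeft K K (Sum.inl ∘ Sum.inr)
      + ζ ∘ₗ LinearMap.funLeft K K Sum.inr
  have hΦ₀ : ∀ c, Φ₀ c = φ ((c ∘ Sum.inl) ∘ Sum.inl) + χ ((c ∘ Sum.inl) ∘ Sum.inr)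
      + ζ (c ∘ Sum.inr) := fun c => rfl
  have hΦ : Function.Bijective Φ₀ := by
    constructor
    · rw [injective_iff_map_eq_zero]
      intro c hc
      obtain ⟨h1, h2, h3⟩ := hall _ _ _ ((hΦ₀ c).symm.trans hc)
      ext ((i | i) | i)
      exacts [congrFun h1 i, congrFun h2 i, congrFun h3 i]
    · intro y
      have hy : y ∈ W ⊔ N' := hWN' ▸ Submodule.mem_top
      obtain ⟨w, hw, z, hz, rfl⟩ := Submodule.mem_sup.mp hy
      obtain ⟨_, ⟨a, rfl⟩, _, ⟨b, rfl⟩, rfl⟩ := Submodule.mem_sup.mp hw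
      obtain ⟨c, rfl⟩ : z ∈ LinearMap.range ζ := rζ ▸ hz
      exact ⟨Sum.elim (Sum.elim a b) c, by rw [hΦ₀]; rfl⟩
  -- the target
  let Ψ₁ : ((J ⊕ T) ⊕ Fin k → K) →ₗ[K] V :=
    ψ ∘ₗ LinearMap.funLeft K K (Sum.inl ∘ Sum.inl)
      + (D ∘ₗ χ) ∘ₗ LinearMap.funLeft K K (Sum.inl ∘ Sum.inr)
      + (D ∘ₗ ζ) ∘ₗ LinearMap.funLeft K K Sum.inr
  have hΨ₁ : ∀ c, Ψ₁ c = ψ ((c ∘ Sum.inl) ∘ Sum.inl) + D (χ ((c ∘ Sum.inl) ∘ Sum.inr))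
      + D (ζ (c ∘ Sum.inr)) := fun c => rfl
  have hΨ₁inj : ∀ c, Ψ₁ c = 0 → c = 0 := by
    intro c hc
    rw [hΨ₁, add_assoc, ← map_add] at hc
    set b := (c ∘ Sum.inl) ∘ Sum.inr
    set e := c ∘ Sum.inr
    have h1 : D (χ b + ζ e) = ψ (-((c ∘ Sum.inl) ∘ Sum.inl)) := by
      rw [map_neg]; exact eq_neg_of_add_eq_zero_right hc
    -- Here it is used that the range of `φ` is the full preimage of `im G` under `D`.
    have h2 : χ b + ζ e ∈ LinearMap.range φ := by
      rw [rφ, Submodule.mem_comap, h1, ← rψ]; exact LinearMap.mem_range_self _ _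
    obtain ⟨a, ha⟩ := h2
    have h3 : φ (-a) + χ b + ζ e = 0 := by rw [map_neg, ha]; abel
    obtain ⟨h4, h5, h6⟩ := hall _ _ _ h3
    rw [h5, h6, map_zero, map_zero, add_zero, map_zero, add_zero] at hc
    have h7 := hψ (hc.trans (map_zero ψ).symm)
    ext ((i | i) | i)
    exacts [congrFun h7 i, congrFun h5 i, congrFun h6 i]
  obtain ⟨Y', hY'⟩ := Submodule.exists_isCompl (LinearMap.range Ψ₁)
  obtain ⟨l, θ, hθ, rθ⟩ := exists_coordinates_range Y'
  let Ψ₀ : (((J ⊕ T) ⊕ Fin k) ⊕ Fin l → K) →ₗ[K] V :=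
    Ψ₁ ∘ₗ LinearMap.funLeft K K Sum.inl + θ ∘ₗ LinearMap.funLeft K K Sum.inr
  have hΨ₀ : ∀ c, Ψ₀ c = Ψ₁ (c ∘ Sum.inl) + θ (c ∘ Sum.inr) := fun c => rfl
  have hΨ : Function.Bijective Ψ₀ := by
    constructor
    · rw [injective_iff_map_eq_zero]
      intro c hc
      rw [hΨ₀] at hc
      have h1 : Ψ₁ (c ∘ Sum.inl) ∈ LinearMap.range Ψ₁ := LinearMap.mem_range_self _ _
      have h2 : Ψ₁ (c ∘ Sum.inl) ∈ Y' := by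
        rw [eq_neg_of_add_eq_zero_left hc, ← rθ, ← map_neg]; exact LinearMap.mem_range_self _ _
      have h3 := (Submodule.disjoint_def.mp hY'.disjoint) _ h1 h2
      have h4 := hΨ₁inj _ h3
      rw [h3, zero_add] at hc
      have h5 := hθ (hc.trans (map_zero θ).symm)
      ext (i | i)
      exacts [congrFun h4 i, congrFun h5 i]
    · intro y
      have hy : y ∈ LinearMap.range Ψ₁ ⊔ Y' := hY'.sup_eq_top ▸ Submodule.mem_top
      obtain ⟨_, ⟨a, rfl⟩, z, hz, rfl⟩ := Submodule.mem_sup.mp hy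
      obtain ⟨c, rfl⟩ : z ∈ LinearMap.range θ := rθ ▸ hz
      exact ⟨Sum.elim a c, by rw [hΨ₀]; rfl⟩
  refine ⟨k, l, LinearEquiv.ofBijective Φ₀ hΦ, LinearEquiv.ofBijective Ψ₀ hΨ, fun c => ?_⟩
  simp only [LinearEquiv.ofBijective_apply, hΦ₀, hΨ₀, hΨ₁, fromRows_mulVec, fromBlocks_mulVec,
    Sum.elim_comp_inl, Sum.elim_comp_inr, zero_mulVec, add_zero, zero_add, one_mulVec, map_zero,
    map_add, hD, hG, hχ, hGζ, and_self]

end Reduction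

end Kronecker

namespace Kronecker

open Matrix

/-! ### How single blocks grow when the reduction is undone -/

section Pieces

variable {K : Type*} [Field K]

theorem HasKCF.of_isEmpty {m n : Type*} [Fintype m] [Fintype n] [DecidableEq m] [DecidableEq n]
    [IsEmpty m] [IsEmpty n] (A B : Matrix m n K) : HasKCF A B :=
  ⟨Empty, inferInstance, inferInstance, Empty.elim,
    MEquiv.of_reindex (Equiv.equivOfIsEmpty _ _) (Equiv.equivOfIsEmpty _ _)
      (fun i => i.1.elim) (fun i => i.1.elim)⟩

theorem HasKCF.fromRows_zero {p q l : Type*} [Fintype p] [Fintype q] [Fintype l] [DecidableEq p]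
    [DecidableEq q] [DecidableEq l] {A B : Matrix p q K} (hl : HasKCF (0 : Matrix l (Fin 0) K) 0)
    (h : HasKCF A B) :
    HasKCF (fromRows A 0 : Matrix (p ⊕ l) q K) (fromRows B 0) := by
  refine HasKCF.congr (MEquiv.of_reindex (Equiv.refl (p ⊕ l)) (Equiv.sumEmpty q (Fin 0)) ?_ ?_)
    (h.fromBlocks hl) <;>
  · rintro (i | i) (j | j)
    · rfl
    · exact j.elim0
    · rfl
    · exact j.elim0

/-- A zero row is a vertical block of size `1 × 0`. -/
theorem hasKCF_zero_fin (l : ℕ) : HasKCF (0 : Matrix (Fin l) (Fin 0) K) 0 := by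
  refine ⟨Fin l, inferInstance, inferInstance, fun _ => PBlock.vert 0, MEquiv.of_reindex
    (Equiv.sigmaUnique (Fin l) fun _ => Fin 1) 
    (@Equiv.equivOfIsEmpty (Σ _ : Fin l, Fin 0) (Fin 0) ⟨fun x => x.2.elim0⟩ _) ?_ ?_⟩
  · rintro _ ⟨_, j⟩; exact j.elim0
  · rintro _ ⟨_, j⟩; exact j.elim0

theorem mequiv_smul_one (a b : K) (k : ℕ) :
    MEquiv (a • (1 : Matrix (Fin k) (Fin k) K)) (b • 1)
      (Matrix.blockDiagonal' fun _ : Fin k => a • (1 : Matrix (Fin 1) (Fin 1) K))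
      (Matrix.blockDiagonal' fun _ : Fin k => b • (1 : Matrix (Fin 1) (Fin 1) K)) := by
  refine MEquiv.of_reindex (Equiv.sigmaUnique (Fin k) fun _ => Fin 1)
    (Equiv.sigmaUnique (Fin k) fun _ => Fin 1) ?_ ?_
  all_goals
    rintro ⟨i, x⟩ ⟨j, y⟩
    obtain rfl := Subsingleton.elim x 0
    obtain rfl := Subsingleton.elim y 0
    by_cases h : i = j
    · subst h
      rw [blockDiagonal'_apply_eq]
      simp [Equiv.sigmaUnique]
    · rw [blockDiagonal'_apply_ne _ _ _ h]
      simp [Equiv.sigmaUnique, h]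

theorem hasKCF_smul_one_smul_one {a b : K} (β : PBlock K)
    (h : MEquiv (a • (1 : Matrix (Fin 1) (Fin 1) K)) (b • 1) β.matA β.matB) (k : ℕ) :
    HasKCF (a • 1 : Matrix (Fin k) (Fin k) K) (b • 1) :=
  ⟨Fin k, inferInstance, inferInstance, fun _ => β,
    (mequiv_smul_one a b k).trans (MEquiv.blockDiagonal' fun _ => h)⟩

theorem hasKCF_one_zero (k : ℕ) : HasKCF (1 : Matrix (Fin k) (Fin k) K) 0 := by
  have := hasKCF_smul_one_smul_one (a := (1 : K)) (b := 0) (PBlock.jinf 0)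
    (MEquiv.of_reindex (Equiv.refl (Fin 1)) (Equiv.refl (Fin 1)) ?_ ?_) k
  · rwa [one_smul, zero_smul] at this
  all_goals
    intro (i : Fin 1) (j : Fin 1)
    obtain rfl := Subsingleton.elim i 0
    obtain rfl := Subsingleton.elim j 0
  · change _ = (1 : K); simp
  · change _ = (0 : K); simp

theorem hasKCF_smul_one (c : K) (k : ℕ) : HasKCF (c • 1 : Matrix (Fin k) (Fin k) K) 1 := by
  have := hasKCF_smul_one_smul_one (a := c) (b := 1) (PBlock.jfin c 0)
    (MEquiv.of_reindex (Equiv.refl (Fin 1)) (Equiv.refl (Fin 1)) ?_ ?_) k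
  · rwa [one_smul] at this
  all_goals
    intro (i : Fin 1) (j : Fin 1)
    obtain rfl := Subsingleton.elim i 0
    obtain rfl := Subsingleton.elim j 0
  · change _ = c; simp
  · change _ = (1 : K); simp

theorem mequiv_sumEmpty {p q : Type*} [Fintype p] [Fintype q] [DecidableEq p] [DecidableEq q]
    (A B : Matrix p q K) (A₁ B₁ : Matrix p (Fin 0) K) (A₂ B₂ : Matrix (Fin 0) q K)
    (A₃ B₃ : Matrix (Fin 0) (Fin 0) K) :
    MEquiv (fromBlocks A A₁ A₂ A₃) (fromBlocks B B₁ B₂ B₃) A B :=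
  MEquiv.of_reindex (Equiv.sumEmpty p (Fin 0)).symm (Equiv.sumEmpty q (Fin 0)).symm
    (fun _ _ => rfl) (fun _ _ => rfl)

namespace PBlock

/-- The three identities say that `E` is injective with range complementary to that of `matB`.
Finite Jordan and horizontal blocks have surjective `matB` and do not change. For an infinite Jordan
block or a vertical block the cokernel is one-dimensional, and undoing the reduction lengthens the
block by one. -/
theorem exists_extension_matB (b : PBlock K) :
    ∃ (e : ℕ) (E : Matrix (Fin b.rows) (Fin e) K) (X : Matrix (Fin b.cols) (Fin b.rows) K)
      (Y : Matrix (Fin e) (Fin b.rows) K),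
      b.matB * X + E * Y = 1 ∧ Y * b.matB = 0 ∧ Y * E = 1 ∧
      ∃ b' : PBlock K,
        MEquiv (fromBlocks b.matA 0 0 (1 : Matrix (Fin e) (Fin e) K))
          (fromBlocks b.matB E 0 0) b'.matA b'.matB := by
  cases b with
  | jfin c n =>
    refine ⟨0, 0, matB (jfin c n), 0, ?_, ?_, ?_, jfin c n, mequiv_sumEmpty _ _ _ _ _ _ _ _⟩
    · have : @Eq (Matrix (Fin (n + 1)) (Fin (n + 1)) K) (matB (jfin c n)) 1 := by
        ext i j
        change (if i.val = j.val then (1 : K) else 0) =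
          (1 : Matrix (Fin (n + 1)) (Fin (n + 1)) K) i j
        exact (if_congr Fin.ext_iff.symm rfl rfl).trans (Matrix.one_apply (n := Fin (n + 1))).symm
      have key : ∀ M : Matrix (Fin (n + 1)) (Fin (n + 1)) K, M = 1 →
          M * M + (0 : Matrix (Fin (n + 1)) (Fin 0) K) * (0 : Matrix (Fin 0) (Fin (n + 1)) K) = 1 := by
        rintro _ rfl
        simp
      exact key _ this
    · simp
    · ext i; exact i.elim0
  | hor ε =>
    refine ⟨0, 0, (matB (hor ε))ᵀ, 0, ?_, ?_, ?_, hor ε, mequiv_sumEmpty _ _ _ _ _ _ _ _⟩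
    · rw [Matrix.zero_mul, add_zero]
      ext (i : Fin ε) (j : Fin ε)
      change ∑ k : Fin (ε + 1), (if i.val + 1 = k.val then (1 : K) else 0) *
        (if j.val + 1 = k.val then (1 : K) else 0) = (1 : Matrix (Fin ε) (Fin ε) K) i j
      rw [Fin.sum_univ_eq_sum_range (fun k => (if i.val + 1 = k then (1 : K) else 0) *
        (if j.val + 1 = k then (1 : K) else 0))]
      simp [Matrix.one_apply, Fin.ext_iff, eq_comm]
    · simp
    · ext i; exact i.elim0
  | jinf n =>
    refine ⟨1, Matrix.of fun i _ => if i.val = n then 1 else 0, (matB (jinf n))ᵀ,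
      Matrix.of fun _ i => if i.val = n then 1 else 0, ?_, ?_, ?_, jinf (n + 1), ?_⟩
    · ext (i : Fin (n + 1)) (j : Fin (n + 1))
      change ∑ k : Fin (n + 1), (if i.val + 1 = k.val then (1 : K) else 0) *
        (if j.val + 1 = k.val then (1 : K) else 0) + ∑ k : Fin 1, (if i.val = n then (1 : K) else 0)
        * (if j.val = n then (1 : K) else 0) = (1 : Matrix (Fin (n + 1)) (Fin (n + 1)) K) i j
      rw [Fin.sum_univ_eq_sum_range (fun k => (if i.val + 1 = k then (1 : K) else 0) *
        (if j.val + 1 = k then (1 : K) else 0))]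
      simp [Matrix.one_apply, Fin.ext_iff]
      grind
    · ext _ (j : Fin (n + 1))
      change ∑ k : Fin (n + 1), (if k.val = n then (1 : K) else 0) *
        (if k.val + 1 = j.val then (1 : K) else 0) = 0
      refine Finset.sum_eq_zero fun k _ => ?_
      grind
    · ext i j
      change ∑ k : Fin (n + 1), (if k.val = n then (1 : K) else 0) *
        (if k.val = n then (1 : K) else 0) = (1 : Matrix (Fin 1) (Fin 1) K) i j
      rw [Fin.sum_univ_eq_sum_range (fun k => (if k = n then (1 : K) else 0) *
        (if k = n then (1 : K) else 0))]
      obtain rfl := Subsingleton.elim i j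
      simp
    · refine (MEquiv.of_reindex (finSumFinEquiv (m := n + 1) (n := 1))
        (finSumFinEquiv (m := n + 1) (n := 1)) ?_ ?_).symm
      · rintro (i | i) (j | j)
        · rfl
        · change (if i.val = n + 1 + j.val then (1 : K) else 0) = 0
          grind
        · change (if n + 1 + i.val = j.val then (1 : K) else 0) = 0
          grind
        · change (if n + 1 + i.val = n + 1 + j.val then (1 : K) else 0) =
            (1 : Matrix (Fin 1) (Fin 1) K) i j
          obtain rfl := Subsingleton.elim i j
          simp
      · rintro (i | i) (j | j)
        · rfl
        · change (if i.val + 1 = n + 1 + j.val then (1 : K) else 0) = if i.val = n then 1 else 0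
          grind
        · change (if n + 1 + i.val + 1 = j.val then (1 : K) else 0) = 0
          grind
        · change (if n + 1 + i.val + 1 = n + 1 + j.val then (1 : K) else 0) = 0
          grind
  | vert η =>
    refine ⟨1, Matrix.of fun i _ => if i.val = 0 then 1 else 0, (matB (vert η))ᵀ,
      Matrix.of fun _ i => if i.val = 0 then 1 else 0, ?_, ?_, ?_, vert (η + 1), ?_⟩
    · ext (i : Fin (η + 1)) (j : Fin (η + 1))
      change ∑ k : Fin η, (if i.val = k.val + 1 then (1 : K) else 0) *
        (if j.val = k.val + 1 then (1 : K) else 0) + ∑ k : Fin 1, (if i.val = 0 then (1 : K) else 0)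
        * (if j.val = 0 then (1 : K) else 0) = (1 : Matrix (Fin (η + 1)) (Fin (η + 1)) K) i j
      rw [Fin.sum_univ_eq_sum_range (fun k => (if i.val = k + 1 then (1 : K) else 0) *
        (if j.val = k + 1 then (1 : K) else 0))]
      refine Fin.cases ?_ (fun i => ?_) i
      · simp only [Fin.val_zero, Matrix.one_apply, Fin.ext_iff]
        rw [Finset.sum_eq_zero (fun k _ => by grind), zero_add, Fin.sum_univ_one]
        grind
      · simp only [Fin.val_succ, add_left_inj, ite_mul, one_mul, zero_mul, Finset.sum_ite_eq,
          Matrix.one_apply, Fin.ext_iff]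
        simp
        grind
    · ext _ (j : Fin η)
      change ∑ k : Fin (η + 1), (if k.val = 0 then (1 : K) else 0) *
        (if k.val = j.val + 1 then (1 : K) else 0) = 0
      refine Finset.sum_eq_zero fun k _ => ?_
      grind
    · ext i j
      change ∑ k : Fin (η + 1), (if k.val = 0 then (1 : K) else 0) *
        (if k.val = 0 then (1 : K) else 0) = (1 : Matrix (Fin 1) (Fin 1) K) i j
      rw [Fin.sum_univ_eq_sum_range (fun k => (if k = 0 then (1 : K) else 0) *
        (if k = 0 then (1 : K) else 0))]
      obtain rfl := Subsingleton.elim i j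
      simp
    -- The zero row of `matB` is the first one, so the new row and column have to be placed in
    -- front.
    · refine (MEquiv.of_reindex
        ((Equiv.sumComm _ _).trans ((finSumFinEquiv (m := 1) (n := η + 1)).trans
          (finCongr (Nat.add_comm 1 (η + 1)))))
        ((Equiv.sumComm _ _).trans ((finSumFinEquiv (m := 1) (n := η)).trans
          (finCongr (Nat.add_comm 1 η)))) ?_ ?_).symm
      · rintro (i | i) (j | j)
        · change (if 1 + i.val = 1 + j.val then (1 : K) else 0) = if i.val = j.val then 1 else 0
          grind
        · change (if 1 + i.val = j.val then (1 : K) else 0) = 0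
          grind
        · change (if i.val = 1 + j.val then (1 : K) else 0) = 0
          grind
        · change (if i.val = j.val then (1 : K) else 0) = (1 : Matrix (Fin 1) (Fin 1) K) i j
          obtain rfl := Subsingleton.elim i j
          simp
      · rintro (i | i) (j | j)
        · change (if 1 + i.val = 1 + j.val + 1 then (1 : K) else 0) =
            if i.val = j.val + 1 then 1 else 0
          grind
        · change (if 1 + i.val = j.val + 1 then (1 : K) else 0) = if i.val = 0 then 1 else 0
          grind
        · change (if i.val = 1 + j.val + 1 then (1 : K) else 0) = 0
          grind
        · change (if i.val = j.val + 1 then (1 : K) else 0) = 0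
          grind

/-- The analogue for reduction along `A - c B`: blocks with eigenvalue `c` have a one-dimensional
cokernel and grow by one, while on the other blocks `A - c B` is invertible. -/
theorem exists_extension_jfin (c e : K) (n : ℕ) :
    ∃ (t : ℕ) (E : Matrix (Fin (jfin e n).rows) (Fin t) K)
      (X : Matrix (Fin (jfin e n).cols) (Fin (jfin e n).rows) K)
      (Y : Matrix (Fin t) (Fin (jfin e n).rows) K),
      ((jfin e n).matA - c • (jfin e n).matB) * X + E * Y = 1 ∧
      Y * ((jfin e n).matA - c • (jfin e n).matB) = 0 ∧ Y * E = 1 ∧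
      ∃ b' : PBlock K, MEquiv
        (fromBlocks (jfin e n).matA E 0 (c • (1 : Matrix (Fin t) (Fin t) K)))
        (fromBlocks (jfin e n).matB 0 0 1) b'.matA b'.matB := by
  let G : Matrix (Fin (n + 1)) (Fin (n + 1)) K := Matrix.of fun i j =>
    if i.val = j.val then e - c else if i.val + 1 = j.val then 1 else 0
  have hG : (jfin e n).matA - c • (jfin e n).matB = G := by
    ext (i : Fin (n + 1)) (j : Fin (n + 1))
    change (if i.val = j.val then e else if i.val + 1 = j.val then 1 else 0) -
      c * (if i.val = j.val then 1 else 0) = 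
      if i.val = j.val then e - c else if i.val + 1 = j.val then 1 else 0
    split_ifs <;> simp
  rw [hG]
  by_cases hec : e = c
  · subst hec
    have hG' : ∀ i j, G i j = if i.val + 1 = j.val then 1 else 0 := by
      intro i j
      change (if i.val = j.val then e - e else if i.val + 1 = j.val then 1 else 0) = _
      grind
    refine ⟨1, Matrix.of fun i _ => if i.val = n then 1 else 0, Gᵀ,
      Matrix.of fun _ i => if i.val = n then 1 else 0, ?_, ?_, ?_, jfin e (n + 1), ?_⟩
    · ext (i : Fin (n + 1)) (j : Fin (n + 1))
      change ∑ k : Fin (n + 1), G i k * G j k + ∑ k : Fin 1, (if i.val = n then (1 : K) else 0)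
        * (if j.val = n then (1 : K) else 0) = (1 : Matrix (Fin (n + 1)) (Fin (n + 1)) K) i j
      simp only [hG']
      rw [Fin.sum_univ_eq_sum_range (fun k => (if i.val + 1 = k then (1 : K) else 0) *
        (if j.val + 1 = k then (1 : K) else 0))]
      simp [Matrix.one_apply, Fin.ext_iff]
      grind
    · ext _ (j : Fin (n + 1))
      change ∑ k : Fin (n + 1), (if k.val = n then (1 : K) else 0) * G k j = 0
      refine Finset.sum_eq_zero fun k _ => ?_
      rw [hG']
      grind
    · ext i j
      change ∑ k : Fin (n + 1), (if k.val = n then (1 : K) else 0) *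
        (if k.val = n then (1 : K) else 0) = (1 : Matrix (Fin 1) (Fin 1) K) i j
      rw [Fin.sum_univ_eq_sum_range (fun k => (if k = n then (1 : K) else 0) *
        (if k = n then (1 : K) else 0))]
      obtain rfl := Subsingleton.elim i j
      simp
    · refine (MEquiv.of_reindex (finSumFinEquiv (m := n + 1) (n := 1))
        (finSumFinEquiv (m := n + 1) (n := 1)) ?_ ?_).symm
      · rintro (i | i) (j | j)
        · rfl
        · change (if i.val = n + 1 + j.val then e else if i.val + 1 = n + 1 + j.val then (1 : K)
            else 0) = if i.val = n then 1 else 0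
          grind
        · change (if n + 1 + i.val = j.val then e else if n + 1 + i.val + 1 = j.val then (1 : K)
            else 0) = 0
          grind
        · change (if n + 1 + i.val = n + 1 + j.val then e else
            if n + 1 + i.val + 1 = n + 1 + j.val then (1 : K) else 0) =
            (e • 1 : Matrix (Fin 1) (Fin 1) K) i j
          obtain rfl := Subsingleton.elim i j
          simp
      · rintro (i | i) (j | j)
        · rfl
        · change (if i.val = n + 1 + j.val then (1 : K) else 0) = 0
          grind
        · change (if n + 1 + i.val = j.val then (1 : K) else 0) = 0
          grind
        · change (if n + 1 + i.val = n + 1 + j.val then (1 : K) else 0) =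
            (1 : Matrix (Fin 1) (Fin 1) K) i j
          obtain rfl := Subsingleton.elim i j
          simp
  · have hdet : IsUnit G.det := by
      rw [Matrix.det_of_isUpperTriangular]
      · simp [G, sub_eq_zero, hec]
      · intro i j hij
        change (if i.val = j.val then e - c else if i.val + 1 = j.val then 1 else 0) = 0
        have : j.val < i.val := hij
        grind
    refine ⟨0, 0, (G⁻¹ : Matrix (Fin (n + 1)) (Fin (n + 1)) K), 0, ?_, ?_, ?_, jfin e n, mequiv_sumEmpty _ _ _ _ _ _ _ _⟩
    · rw [Matrix.zero_mul, add_zero]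
      exact Matrix.mul_nonsing_inv G hdet
    · exact Matrix.zero_mul _
    · ext i; exact i.elim0

end PBlock

end Pieces

end Kronecker

namespace Kronecker

open Matrix

/-! ### Existence of the Kronecker canonical form -/

section Existence

variable {K : Type*} [Field K]

/-- When the restricted pencil is block diagonal, its extension can be performed block by block;
this reduces the induction step to single blocks. -/
theorem IsKCF.restriction {U V : Type*} [AddCommGroup U] [Module K U] [AddCommGroup V] [Module K V]
    [FiniteDimensional K U] [FiniteDimensional K V]
    {ι : Type*} [Fintype ι] [DecidableEq ι] {r c : ι → ℕ} {e : ι → ℕ} {D G : U →ₗ[K] V}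
    (D₁ G₁ : ∀ i, Matrix (Fin (r i)) (Fin (c i)) K)
    (E : ∀ i, Matrix (Fin (r i)) (Fin (e i)) K) (X : ∀ i, Matrix (Fin (c i)) (Fin (r i)) K)
    (Y : ∀ i, Matrix (Fin (e i)) (Fin (r i)) K)
    (h : Restriction D G (blockDiagonal' D₁) (blockDiagonal' G₁))
    (h1 : ∀ i, G₁ i * X i + E i * Y i = 1) (h2 : ∀ i, Y i * G₁ i = 0) (h3 : ∀ i, Y i * E i = 1) :
    ∃ k l : ℕ, Represents D G
      (fromRows (fromBlocks (blockDiagonal' fun i =>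
        fromBlocks (D₁ i) 0 0 (1 : Matrix (Fin (e i)) (Fin (e i)) K)) 0 0
          (1 : Matrix (Fin k) (Fin k) K)) (0 : Matrix (Fin l) _ K))
      (fromRows (fromBlocks (blockDiagonal' fun i =>
        fromBlocks (G₁ i) (E i) (0 : Matrix (Fin (e i)) _ K) 0) 0 0 0) 0) := by
  have hXY : blockDiagonal' G₁ * blockDiagonal' X + blockDiagonal' E * blockDiagonal' Y = 1 := by
    rw [← blockDiagonal'_mul, ← blockDiagonal'_mul, ← blockDiagonal'_add, ← blockDiagonal'_one]
    congr 1
    exact funext h1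
  have hZG : blockDiagonal' Y * blockDiagonal' G₁ = 0 := by
    rw [← blockDiagonal'_mul, ← blockDiagonal'_zero]
    congr 1
    exact funext h2
  have hZE : blockDiagonal' Y * blockDiagonal' E = 1 := by
    rw [← blockDiagonal'_mul, ← blockDiagonal'_one]
    congr 1
    exact funext h3
  obtain ⟨k, l, hkl⟩ := h.represents hXY hZG hZE
  refine ⟨k, l, hkl.congr ?_⟩
  have key := mequiv_fromBlocks_blockDiagonal' D₁ G₁ (fun i => (0 : Matrix _ (Fin (e i)) K)) E
    (fun i => (0 : Matrix (Fin (e i)) _ K)) (fun i => (0 : Matrix (Fin (e i)) _ K))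
    (fun i => (1 : Matrix (Fin (e i)) (Fin (e i)) K)) (fun i => 0)
  have z1 : (blockDiagonal' fun i => (0 : Matrix (Fin (r i)) (Fin (e i)) K)) = 0 :=
    blockDiagonal'_zero
  have z2 : (blockDiagonal' fun i => (0 : Matrix (Fin (e i)) (Fin (c i)) K)) = 0 :=
    blockDiagonal'_zero
  have z3 : (blockDiagonal' fun i => (0 : Matrix (Fin (e i)) (Fin (e i)) K)) = 0 :=
    blockDiagonal'_zero
  have z4 : (blockDiagonal' fun i => (1 : Matrix (Fin (e i)) (Fin (e i)) K)) = 1 :=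
    blockDiagonal'_one
  rw [z1, z2, z3, z4] at key
  have key2 := key.fromBlocks (MEquiv.refl (1 : Matrix (Fin k) (Fin k) K) 0)
  have key3 := key2.fromBlocks (MEquiv.refl (0 : Matrix (Fin l) (Fin 0) K) 0)
  have rows : ∀ {p q : Type _} [Fintype p] [Fintype q] [DecidableEq p] [DecidableEq q]
      (A B : Matrix p q K), MEquiv (fromRows A (0 : Matrix (Fin l) q K)) (fromRows B 0)
        (fromBlocks A 0 0 (0 : Matrix (Fin l) (Fin 0) K)) (fromBlocks B 0 0 0) := by
    intro p q _ _ _ _ A B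
    refine MEquiv.of_reindex (Equiv.refl (p ⊕ Fin l)) (Equiv.sumEmpty q (Fin 0)) ?_ ?_ <;>
    · rintro (i | i) (j | j)
      · rfl
      · exact j.elim0
      · rfl
      · exact j.elim0
  exact ((rows _ _).trans key3).trans (rows _ _).symm

theorem represents_toLin' {m n : Type*} [Fintype m] [Fintype n] [DecidableEq m] [DecidableEq n]
    (A B : Matrix m n K) : Represents (toLin' A) (toLin' B) A B :=
  ⟨LinearEquiv.refl K _, LinearEquiv.refl K _, fun _ => ⟨rfl, rfl⟩⟩

/-- Reduction with `D = A`, `G = B`. What lies outside the extended blocks is a multiple of the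
pencil `1 + λ 0`, giving infinite Jordan blocks of size one, and zero rows. -/
theorem hasKCF_of_not_surjective {m n : ℕ}
    (ih : ∀ m' n' : ℕ, m' + n' < m + n → ∀ A B : Matrix (Fin m') (Fin n') K, HasKCF A B)
    (A B : Matrix (Fin m) (Fin n) K) (hB : LinearMap.range (toLin' B) ≠ ⊤) : HasKCF A B := by
  obtain ⟨m', n', D₁, G₁, hm, hn, hR⟩ := exists_restriction (toLin' A) (toLin' B)
  have hlt : m' < m := by
    have := Submodule.finrank_lt hB
    rwa [← hm, Module.finrank_fin_fun] at this
  rw [Module.finrank_fin_fun] at hn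
  obtain ⟨ι, _, _, b, hb⟩ := ih m' n' (by omega) D₁ G₁
  choose e E X Y h1 h2 h3 b' hb' using fun i => (b i).exists_extension_matB
  obtain ⟨k, l, hkl⟩ := IsKCF.restriction _ _ E X Y (hR.congr hb) h1 h2 h3
  refine HasKCF.congr ((represents_toLin' A B).mequiv hkl) ?_
  exact HasKCF.fromRows_zero (hasKCF_zero_fin l)
    (HasKCF.fromBlocks (HasKCF.blockDiagonal' b' hb') (hasKCF_one_zero k))

/-- An invertible linear coefficient has no zero row or column, and every other type of block has
one. -/
theorem exists_eq_jfin {ι : Type*} [Fintype ι] [DecidableEq ι] (b : ι → PBlock K)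
    {L R : Matrix (Σ i, Fin (b i).cols) (Σ i, Fin (b i).rows) K}
    (hL : L * blockDiagonal' (fun i => (b i).matB) = 1)
    (hR : blockDiagonal' (fun i => (b i).matB) * R = 1) (i : ι) :
    ∃ c n, b i = PBlock.jfin c n := by
  have hcol : ∀ y : Fin (b i).cols, (∀ x, (b i).matB x y = 0) → False := by
    intro y hy
    have h1 := congrFun (congrFun hL ⟨i, y⟩) ⟨i, y⟩
    rw [Matrix.one_apply_eq, Matrix.mul_apply, Finset.sum_eq_zero] at h1
    · exact zero_ne_one h1
    · rintro ⟨j, x⟩ _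
      by_cases hij : j = i
      · subst hij; rw [blockDiagonal'_apply_eq, hy, mul_zero]
      · rw [blockDiagonal'_apply_ne _ _ _ hij, mul_zero]
  have hrow : ∀ x : Fin (b i).rows, (∀ y, (b i).matB x y = 0) → False := by
    intro x hx
    have h1 := congrFun (congrFun hR ⟨i, x⟩) ⟨i, x⟩
    rw [Matrix.one_apply_eq, Matrix.mul_apply, Finset.sum_eq_zero] at h1
    · exact zero_ne_one h1
    · rintro ⟨j, y⟩ _
      by_cases hij : i = j
      · subst hij; rw [blockDiagonal'_apply_eq, hx, zero_mul]
      · rw [blockDiagonal'_apply_ne _ _ _ hij, zero_mul]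
  generalize b i = β at hcol hrow
  cases β with
  | jfin c n => exact ⟨c, n, rfl⟩
  | jinf n =>
    exact (hcol (0 : Fin (n + 1)) fun x => by
      change (if x.val + 1 = 0 then (1 : K) else 0) = 0
      simp).elim
  | hor ε =>
    exact (hcol (0 : Fin (ε + 1)) fun x => by
      change (if x.val + 1 = 0 then (1 : K) else 0) = 0
      simp).elim
  | vert η =>
    exact (hrow (0 : Fin (η + 1)) fun y => by
      change (if 0 = y.val + 1 then (1 : K) else 0) = 0
      simp).elim

/-- For `B` invertible, an eigenvalue `c` of `B⁻¹ A` makes `A - c B` singular, so the reduction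
applies with `D = B`, `G = A - c B`. -/
theorem hasKCF_of_bijective [IsAlgClosed K] {m n : ℕ}
    (ih : ∀ m' n' : ℕ, m' + n' < m + n → ∀ A B : Matrix (Fin m') (Fin n') K, HasKCF A B)
    (A B : Matrix (Fin m) (Fin n) K) (hB : Function.Bijective (toLin' B)) : HasKCF A B := by
  have hmn : n = m := by
    have := (LinearEquiv.ofBijective _ hB).finrank_eq
    rwa [Module.finrank_fin_fun, Module.finrank_fin_fun] at this
  subst hmn
  rcases Nat.eq_zero_or_pos n with rfl | hn
  · exact HasKCF.of_isEmpty A B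
  have : Nonempty (Fin n) := ⟨⟨0, hn⟩⟩
  let β := LinearEquiv.ofBijective _ hB
  obtain ⟨c, hc⟩ := Module.End.exists_eigenvalue (β.symm.toLinearMap ∘ₗ toLin' A)
  obtain ⟨v, hv⟩ := hc.exists_hasEigenvector
  have hv0 := hv.2
  have hv1 : (A - c • B) *ᵥ v = 0 := by
    have h1 := hv.apply_eq_smul
    rw [LinearMap.comp_apply, LinearEquiv.coe_coe, LinearEquiv.symm_apply_eq, map_smul] at h1
    have h2 : A *ᵥ v = c • (B *ᵥ v) := h1
    rw [Matrix.sub_mulVec, Matrix.smul_mulVec, h2, sub_self]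
  have hns : LinearMap.range (toLin' (A - c • B)) ≠ ⊤ := by
    intro h
    have h1 := LinearMap.injective_iff_surjective.mpr (LinearMap.range_eq_top.mp h)
    exact hv0 (h1 (hv1.trans (map_zero (toLin' (A - c • B))).symm))
  obtain ⟨m', n', D₁, G₁, hm, hn', hR⟩ := exists_restriction (toLin' B) (toLin' (A - c • B))
  have hlt : m' < n := by
    have := Submodule.finrank_lt hns
    rwa [← hm, Module.finrank_fin_fun] at this
  rw [Module.finrank_fin_fun] at hn'
  -- The restriction of `B` stays bijective because its domain is the full preimage of its target.
  -- Hence only finite Jordan blocks occur in the restricted pencil.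
  have hD₁ : Function.Bijective (toLin' D₁) := by
    obtain ⟨φ, ψ, iφ, iψ, rφ, rψ, hD, hG⟩ := hR
    constructor
    · intro x y hxy
      refine iφ (hB.1 ?_)
      rw [hD, hD]
      exact congrArg ψ hxy
    · intro γ
      obtain ⟨y, hy⟩ := hB.2 (ψ γ)
      have : y ∈ LinearMap.range φ := by
        rw [rφ, Submodule.mem_comap, hy, ← rψ]
        exact LinearMap.mem_range_self _ _
      obtain ⟨x, rfl⟩ := this
      exact ⟨x, iψ ((hD x).symm.trans hy)⟩
  -- Since `A = (A - c B) + c B`, the matrix `G₁ + c D₁` is the restriction of `A`.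
  obtain ⟨ι, _, _, b, hb⟩ := ih m' n' (by omega) (G₁ + c • D₁) D₁
  obtain ⟨L, hL, hL'⟩ : ∃ L : Matrix (Fin n') (Fin m') K, L * D₁ = 1 ∧ D₁ * L = 1 := by
    let δ := LinearEquiv.ofBijective _ hD₁
    have e1 : D₁ = LinearMap.toMatrix' δ.toLinearMap :=
      (LinearMap.toMatrix'_toLin' D₁).symm
    refine ⟨LinearMap.toMatrix' δ.symm.toLinearMap, ?_, ?_⟩
    · conv_lhs => rw [e1]
      rw [← LinearMap.toMatrix'_comp, ← LinearMap.toMatrix'_id]; congr 1; ext; simp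
    · conv_lhs => rw [e1]
      rw [← LinearMap.toMatrix'_comp, ← LinearMap.toMatrix'_id]; congr 1; ext; simp
  have hjfin : ∀ i, ∃ e s, b i = PBlock.jfin e s := by
    obtain ⟨P, P', Q, Q', h1, h2, h3, h4, -, h6⟩ := hb
    refine exists_eq_jfin b (L := Q' * L * P') (R := Q' * L * P') ?_ ?_
    · rw [← h6]
      calc Q' * L * P' * (P * D₁ * Q) = Q' * (L * ((P' * P) * D₁)) * Q := by
            simp only [Matrix.mul_assoc]
        _ = 1 := by rw [h2, Matrix.one_mul, hL, Matrix.mul_one, h4]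
    · rw [← h6]
      calc P * D₁ * Q * (Q' * L * P') = P * (D₁ * ((Q * Q') * L)) * P' := by
            simp only [Matrix.mul_assoc]
        _ = 1 := by rw [h3, Matrix.one_mul, hL', Matrix.mul_one, h1]
  choose e s hes using hjfin
  obtain rfl : b = fun i => PBlock.jfin (e i) (s i) := funext hes
  have hb1 := (MEquiv.add_smul (-c) hb).swap
  have e1 : G₁ + c • D₁ + -c • D₁ = G₁ := by rw [neg_smul]; abel
  have e2 : (blockDiagonal' fun i => (PBlock.jfin (e i) (s i)).matA) +
      -c • (blockDiagonal' fun i => (PBlock.jfin (e i) (s i)).matB) =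
      blockDiagonal' fun i => (PBlock.jfin (e i) (s i)).matA -
        c • (PBlock.jfin (e i) (s i)).matB := by
    rw [neg_smul, ← sub_eq_add_neg, ← blockDiagonal'_smul, ← blockDiagonal'_sub]
    rfl
  rw [e1, e2] at hb1
  choose t E X Y h1 h2 h3 b' hb' using fun i => PBlock.exists_extension_jfin c (e i) (s i)
  obtain ⟨k, l, hkl⟩ := IsKCF.restriction _ _ E X Y (hR.congr hb1) h1 h2 h3
  -- Swapping and shifting by `c` leads from `(B, A - c B)` back to `(A, B)`.
  have h4 := (((represents_toLin' B (A - c • B)).mequiv hkl).swap).add_smul c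
  have e3 : A - c • B + c • B = A := by abel
  rw [e3] at h4
  refine HasKCF.congr h4 ?_
  have e4 : ∀ i, fromBlocks (PBlock.jfin (e i) (s i)).matA (E i) 0 (c • 1) =
      fromBlocks ((PBlock.jfin (e i) (s i)).matA - c • (PBlock.jfin (e i) (s i)).matB) (E i)
        (0 : Matrix (Fin (t i)) _ K) 0 +
      c • fromBlocks (PBlock.jfin (e i) (s i)).matB 0 0 (1 : Matrix (Fin (t i)) (Fin (t i)) K) := by
    intro i
    rw [fromBlocks_smul, fromBlocks_add]
    simp
  have h5 := HasKCF.fromRows_zero (hasKCF_zero_fin l)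
    (HasKCF.fromBlocks (HasKCF.blockDiagonal' b' hb') (hasKCF_smul_one c k))
  convert h5 using 1
  ext (x | x) y
  · simp only [Matrix.add_apply, Matrix.smul_apply, fromRows_apply_inl]
    rw [← Matrix.smul_apply, ← Matrix.add_apply, fromBlocks_smul, fromBlocks_add,
      ← blockDiagonal'_smul, ← blockDiagonal'_add]
    simp only [e4, smul_zero, zero_add, add_zero]
    rfl
  · simp

/-- Kronecker's theorem: every pencil over an algebraically closed field has a canonical form. -/
theorem hasKCF [IsAlgClosed K] (N : ℕ) : ∀ m n : ℕ, m + n = N →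
    ∀ A B : Matrix (Fin m) (Fin n) K, HasKCF A B := by
  induction N using Nat.strong_induction_on with
  | _ N ih =>
    rintro m n rfl A B
    have ih' : ∀ m' n' : ℕ, m' + n' < m + n → ∀ A B : Matrix (Fin m') (Fin n') K, HasKCF A B :=
      fun m' n' h => ih _ h m' n' rfl
    by_cases h1 : LinearMap.range (toLin' B) = ⊤
    · by_cases h2 : LinearMap.range (toLin' Bᵀ) = ⊤
      · refine hasKCF_of_bijective ih' A B ⟨?_, LinearMap.range_eq_top.mp h1⟩
        intro x y hxy
        -- The kernel of `B` is orthogonal to the range of `Bᵀ`, which is the whole space.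
        rw [← sub_eq_zero, ← dotProduct_eq_zero_iff]
        intro w
        obtain ⟨z, rfl⟩ := LinearMap.range_eq_top.mp h2 w
        have h3 : B *ᵥ (x - y) = 0 := by
          rw [Matrix.mulVec_sub, sub_eq_zero]; exact hxy
        rw [toLin'_apply, Matrix.mulVec_transpose, dotProduct_comm, ← dotProduct_mulVec, h3,
          dotProduct_zero]
      · refine HasKCF.of_transpose (hasKCF_of_not_surjective ?_ Aᵀ Bᵀ h2)
        intro m' n' h
        exact ih' m' n' (by omega)
    · exact hasKCF_of_not_surjective ih' A B h1

end Existence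

end Kronecker

namespace Kronecker

open Matrix

/-! ### Additivity of the rank over diagonal blocks -/

section Rank

variable {K : Type*} [Field K]

/-- One-sided inverses of both factors make rank computations multiplicative: factorisations of
blocks assemble into a factorisation of the block diagonal matrix. -/
theorem exists_rank_factorization {p q : Type*} [Fintype p] [Fintype q] [DecidableEq p]
    [DecidableEq q] (M : Matrix p q K) :
    ∃ (P : Matrix p (Fin M.rank) K) (Q : Matrix (Fin M.rank) q K) (X : Matrix (Fin M.rank) p K)
      (Y : Matrix q (Fin M.rank) K), M = P * Q ∧ X * P = 1 ∧ Q * Y = 1 := by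
  let ζ : (Fin M.rank → K) →ₗ[K] (p → K) := (LinearMap.range M.mulVecLin).subtype ∘ₗ
    (Module.finBasis K (LinearMap.range M.mulVecLin)).equivFun.symm.toLinearMap
  let κ : (q → K) →ₗ[K] (Fin M.rank → K) :=
    (Module.finBasis K (LinearMap.range M.mulVecLin)).equivFun.toLinearMap ∘ₗ
      M.mulVecLin.rangeRestrict
  have hζκ : ζ ∘ₗ κ = M.mulVecLin := by
    refine LinearMap.ext fun x => ?_
    change ((Module.finBasis K (LinearMap.range M.mulVecLin)).equivFun.symm
      ((Module.finBasis K (LinearMap.range M.mulVecLin)).equivFun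
        (M.mulVecLin.rangeRestrict x)) : p → K) = _
    rw [LinearEquiv.symm_apply_apply]
    rfl
  obtain ⟨ξ, hξ⟩ := LinearMap.exists_leftInverse_of_injective ζ (LinearMap.ker_eq_bot.mpr
    ((Submodule.injective_subtype _).comp (LinearEquiv.injective _)))
  obtain ⟨υ, hυ⟩ := LinearMap.exists_rightInverse_of_surjective κ (LinearMap.range_eq_top.mpr
    ((LinearEquiv.surjective (Module.finBasis K (LinearMap.range M.mulVecLin)).equivFun).comp
      (LinearMap.surjective_rangeRestrict M.mulVecLin)))
  refine ⟨LinearMap.toMatrix' ζ, LinearMap.toMatrix' κ, LinearMap.toMatrix' ξ,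
    LinearMap.toMatrix' υ, ?_, ?_, ?_⟩
  · rw [← LinearMap.toMatrix'_comp, hζκ, ← Matrix.toLin'_apply', LinearMap.toMatrix'_toLin']
  · rw [← LinearMap.toMatrix'_comp, hξ, LinearMap.toMatrix'_id]
  · rw [← LinearMap.toMatrix'_comp, hυ, LinearMap.toMatrix'_id]

theorem le_rank_of_mul_mul_eq_one {p q s : Type*} [Fintype p] [Fintype q] [Fintype s]
    [DecidableEq s] {M : Matrix p q K} {X : Matrix s p K} {Y : Matrix q s K}
    (h : X * M * Y = 1) : Fintype.card s ≤ M.rank := by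
  rw [← Matrix.rank_one (R := K) (n := s), ← h]
  exact (Matrix.rank_mul_le_left _ _).trans (Matrix.rank_mul_le_right _ _)

theorem rank_mul_le_card {p q s : Type*} [Fintype p] [Fintype q] [Fintype s]
    (P : Matrix p s K) (Q : Matrix s q K) : (P * Q).rank ≤ Fintype.card s :=
  (Matrix.rank_mul_le_left _ _).trans (Matrix.rank_le_card_width _)

theorem rank_blockDiagonal' {ι : Type*} [Fintype ι] [DecidableEq ι] {r c : ι → Type*}
    [∀ i, Fintype (r i)] [∀ i, Fintype (c i)] [∀ i, DecidableEq (r i)] [∀ i, DecidableEq (c i)]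
    (M : ∀ i, Matrix (r i) (c i) K) : (blockDiagonal' M).rank = ∑ i, (M i).rank := by
  choose P Q X Y h1 h2 h3 using fun i => exists_rank_factorization (M i)
  have hcard : Fintype.card (Σ i, Fin (M i).rank) = ∑ i, (M i).rank := by simp
  rw [← hcard]
  apply le_antisymm
  · have : blockDiagonal' M = blockDiagonal' P * blockDiagonal' Q := by
      rw [← blockDiagonal'_mul]; congr 1; exact funext h1
    rw [this]
    exact rank_mul_le_card _ _
  · refine le_rank_of_mul_mul_eq_one (X := blockDiagonal' X) (Y := blockDiagonal' Y) ?_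
    rw [← blockDiagonal'_mul, ← blockDiagonal'_mul, ← blockDiagonal'_one]
    congr 1
    ext1 i
    calc X i * M i * Y i = X i * (P i * Q i) * Y i := by rw [← h1]
      _ = (X i * P i) * (Q i * Y i) := by simp only [Matrix.mul_assoc]
      _ = 1 := by rw [h2, h3, Matrix.one_mul]

theorem rank_eq_card_of_injective {p q : Type*} [Fintype p] [Fintype q]
    {M : Matrix p q K} (h : ∀ u, M *ᵥ u = 0 → u = 0) : M.rank = Fintype.card q := by
  rw [Matrix.rank, LinearMap.finrank_range_of_inj, Module.finrank_fintype_fun_eq_card]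
  exact (injective_iff_map_eq_zero M.mulVecLin).mpr h

theorem rank_eq_card_of_surjective {p q : Type*} [Fintype p] [Fintype q] [DecidableEq p]
    {M : Matrix p q K} (h : ∀ x, Pi.single x 1 ∈ LinearMap.range M.mulVecLin) :
    M.rank = Fintype.card p := by
  have : LinearMap.range M.mulVecLin = ⊤ := by
    rw [eq_top_iff]
    intro y _
    rw [pi_eq_sum_univ' y]
    refine Submodule.sum_mem _ fun i _ => Submodule.smul_mem _ _ ?_
    convert h i using 1
  rw [Matrix.rank, this, finrank_top, Module.finrank_fintype_fun_eq_card]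

end Rank

/-! ### Toeplitz matrices and the total Kronecker indices -/

section Toeplitz

open scoped Kronecker

variable {R : Type*} [CommRing R]
variable {m n m' n' : Type*}

/-- The matrix of `u ↦ (A + λ B) u` from polynomial vectors of degree at most `k` to polynomial
vectors of degree at most `k + 1`. -/
def toeplitz (k : ℕ) (A B : Matrix m n R) : Matrix (m × Fin (k + 2)) (n × Fin (k + 1)) R :=
  A ⊗ₖ (Matrix.of fun i j => if i.val = j.val then 1 else 0) +
    B ⊗ₖ (Matrix.of fun i j => if i.val = j.val + 1 then 1 else 0)

theorem toeplitz_apply (k : ℕ) (A B : Matrix m n R) (x : m × Fin (k + 2)) (y : n × Fin (k + 1)) :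
    toeplitz k A B x y = A x.1 y.1 * (if x.2.val = y.2.val then 1 else 0) +
      B x.1 y.1 * (if x.2.val = y.2.val + 1 then 1 else 0) := rfl

theorem toeplitz_map {S : Type*} [CommRing S] (f : R →+* S) (k : ℕ) (A B : Matrix m n R) :
    (toeplitz k A B).map f = toeplitz k (A.map f) (B.map f) := by
  ext x y
  simp only [map_apply, toeplitz_apply, map_add, map_mul]
  split_ifs <;> simp

variable [Fintype m] [Fintype n] [Fintype m'] [Fintype n']

theorem toeplitz_mul_mul (k : ℕ) (A B : Matrix m n R) (P : Matrix m' m R) (Q : Matrix n n' R) :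
    toeplitz k (P * A * Q) (P * B * Q) =
      (P ⊗ₖ (1 : Matrix (Fin (k + 2)) (Fin (k + 2)) R)) * toeplitz k A B *
        (Q ⊗ₖ (1 : Matrix (Fin (k + 1)) (Fin (k + 1)) R)) := by
  simp only [toeplitz, Matrix.mul_add, Matrix.add_mul, ← Matrix.mul_kronecker_mul, Matrix.one_mul,
    Matrix.mul_one]

variable {K : Type*} [Field K]

theorem rank_toeplitz_mul_mul_le (P : Matrix m' m K) (Q : Matrix n n' K) (A B : Matrix m n K)
    (k : ℕ) : (toeplitz k (P * A * Q) (P * B * Q)).rank ≤ (toeplitz k A B).rank := by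
  rw [toeplitz_mul_mul]
  exact (Matrix.rank_mul_le_left _ _).trans (Matrix.rank_mul_le_right _ _)

theorem MEquiv.rank_toeplitz [DecidableEq m] [DecidableEq n] [DecidableEq m'] [DecidableEq n']
    {A B : Matrix m n K} {A' B' : Matrix m' n' K} (h : MEquiv A B A' B') (k : ℕ) :
    (toeplitz k A B).rank = (toeplitz k A' B').rank := by
  apply le_antisymm
  · obtain ⟨P, P', Q, Q', -, -, -, -, rfl, rfl⟩ := h.symm
    exact rank_toeplitz_mul_mul_le _ _ _ _ _
  · obtain ⟨P, P', Q, Q', -, -, -, -, rfl, rfl⟩ := h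
    exact rank_toeplitz_mul_mul_le _ _ _ _ _

theorem rank_toeplitz_blockDiagonal' {ι : Type*} [Fintype ι] [DecidableEq ι] {r c : ι → Type*}
    [∀ i, Fintype (r i)] [∀ i, Fintype (c i)] [∀ i, DecidableEq (r i)] [∀ i, DecidableEq (c i)]
    (A B : ∀ i, Matrix (r i) (c i) K) (k : ℕ) :
    (toeplitz k (blockDiagonal' A) (blockDiagonal' B)).rank =
      ∑ i, (toeplitz k (A i) (B i)).rank := by
  rw [← rank_blockDiagonal', ← Matrix.rank_submatrix _ (Equiv.sigmaProdDistrib r _)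
    (Equiv.sigmaProdDistrib c _)]
  congr 1
  ext ⟨⟨i, x⟩, x'⟩ ⟨⟨j, y⟩, y'⟩
  by_cases h : i = j
  · subst h
    simp [toeplitz_apply, Equiv.sigmaProdDistrib, blockDiagonal'_apply_eq]
  · simp [toeplitz_apply, Equiv.sigmaProdDistrib, blockDiagonal'_apply_ne _ _ _ h]

/-- The coefficients of a polynomial vector, extended by zero. -/
def coeffs {k : ℕ} (u : n × Fin (k + 1) → R) (j : ℕ) : n → R := fun i =>
  if h : j < k + 1 then u (i, ⟨j, h⟩) else 0

theorem toeplitz_mulVec (k : ℕ) (A B : Matrix m n R) (u : n × Fin (k + 1) → R) (i : m)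
    (j : Fin (k + 2)) : (toeplitz k A B *ᵥ u) (i, j) = (A *ᵥ coeffs u j.val) i +
      if j.val = 0 then 0 else (B *ᵥ coeffs u (j.val - 1)) i := by
  have h1 : ∀ (a : n) (s : ℕ), ∑ l : Fin (k + 1), (if s = l.val then u (a, l) else 0) =
      coeffs u s a := by
    intro a s
    by_cases h : s < k + 1
    · rw [Finset.sum_eq_single ⟨s, h⟩]
      · simp [coeffs, h]
      · intro l _ hl
        rw [if_neg]
        rintro rfl
        exact hl rfl
      · simp
    · rw [Finset.sum_eq_zero]
      · simp [coeffs, h]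
      · intro l _
        rw [if_neg]
        have := l.isLt
        omega
  have h2 : ∀ (a : n) (s : ℕ), ∑ l : Fin (k + 1), (if s = l.val + 1 then u (a, l) else 0) =
      if s = 0 then 0 else coeffs u (s - 1) a := by
    intro a s
    rcases s with _ | s
    · simp
    · simp [h1]
  have h3 : (toeplitz k A B *ᵥ u) (i, j) = ∑ a, ∑ l : Fin (k + 1),
      (A i a * (if j.val = l.val then u (a, l) else 0) +
        B i a * (if j.val = l.val + 1 then u (a, l) else 0)) := by
    rw [Matrix.mulVec, dotProduct, Fintype.sum_prod_type]
    refine Finset.sum_congr rfl fun a _ => Finset.sum_congr rfl fun l _ => ?_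
    rw [toeplitz_apply]
    split_ifs <;> simp <;> ring
  rw [h3]
  simp only [Finset.sum_add_distrib, ← Finset.mul_sum, h1, h2]
  congr 1
  split_ifs
  · simp
  · rfl

/-- The coefficients of a polynomial vector in the kernel vanish one after another, starting from
the lowest degree; in the next lemma, from the highest. -/
theorem toeplitz_injective_of_left {k : ℕ} {A B : Matrix m n R} (hA : ∀ v, A *ᵥ v = 0 → v = 0)
    (u : n × Fin (k + 1) → R) (hu : toeplitz k A B *ᵥ u = 0) : u = 0 := by
  have key : ∀ j, j < k + 1 → coeffs u j = 0 := by
    intro j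
    induction j with
    | zero =>
      intro _
      refine hA _ (funext fun i => ?_)
      have := congrFun hu (i, ⟨0, by omega⟩)
      rw [toeplitz_mulVec] at this
      simpa using this
    | succ j ih =>
      intro hj
      refine hA _ (funext fun i => ?_)
      have := congrFun hu (i, ⟨j + 1, by omega⟩)
      rw [toeplitz_mulVec] at this
      simpa [ih (by omega)] using this
  ext ⟨i, j⟩
  have := congrFun (key j.val j.isLt) i
  simpa [coeffs, j.isLt] using this

theorem toeplitz_injective_of_right {k : ℕ} {A B : Matrix m n R} (hB : ∀ v, B *ᵥ v = 0 → v = 0)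
    (u : n × Fin (k + 1) → R) (hu : toeplitz k A B *ᵥ u = 0) : u = 0 := by
  have key : ∀ d j, j + d = k + 1 → coeffs u j = 0 := by
    intro d
    induction d with
    | zero =>
      intro j hj
      ext i
      simp [coeffs, show ¬ j < k + 1 by omega]
    | succ d ih =>
      intro j hj
      refine hB _ (funext fun i => ?_)
      have := congrFun hu (i, ⟨j + 1, by omega⟩)
      rw [toeplitz_mulVec] at this
      simpa [ih (j + 1) (by omega)] using this
  ext ⟨i, j⟩
  have := congrFun (key (k + 1 - j.val) j.val (by omega)) i
  simpa [coeffs, j.isLt] using this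

end Toeplitz

namespace PBlock

/-- The rank of a block. -/
def rho {R : Type*} : PBlock R → ℕ
  | jfin _ n => n + 1
  | jinf n => n + 1
  | hor ε => ε
  | vert η => η

/-- The number of columns of a horizontal block; other blocks count as `0`. -/
def horCols {R : Type*} : PBlock R → ℕ
  | hor ε => ε + 1
  | _ => 0

/-- The number of rows of a vertical block; other blocks count as `0`. -/
def vertRows {R : Type*} : PBlock R → ℕ
  | vert η => η + 1
  | _ => 0

/-- The size of a Jordan block; other blocks count as `0`. -/
def jordanSize {R : Type*} : PBlock R → ℕ
  | jfin _ n => n + 1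
  | jinf n => n + 1
  | _ => 0

variable {K : Type*} [Field K]

/-- For a horizontal block, column `(i, j)` is `w i j + w (i - 1) (j + 1)`, where terms with row
index outside the block are zero. So each column links two neighbours on an antidiagonal, and every
antidiagonal has an end at which one neighbour is missing. -/
theorem single_mem_range_toeplitz {k ε : ℕ} (hε : ε ≤ k + 1) {A B : Matrix (Fin ε) (Fin (ε + 1)) K}
    (hA : ∀ i j, A i j = if i.val = j.val then 1 else 0)
    (hB : ∀ i j, B i j = if i.val + 1 = j.val then 1 else 0) (x : Fin ε × Fin (k + 2)) :
    Pi.single x 1 ∈ LinearMap.range (toeplitz k A B).mulVecLin := by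
  set T := toeplitz k A B with hT
  let w : ℕ → ℕ → Fin ε × Fin (k + 2) → K := fun i j x =>
    if x.1.val = i ∧ x.2.val = j then 1 else 0
  have hcol : ∀ (i j : ℕ) (hi : i < ε + 1) (hj : j < k + 1),
      (fun x => T x (⟨i, hi⟩, ⟨j, hj⟩)) ∈ LinearMap.range T.mulVecLin := by
    intro i j hi hj
    refine ⟨Pi.single (⟨i, hi⟩, ⟨j, hj⟩) 1, ?_⟩
    rw [mulVecLin_apply, mulVec_single_one]
    rfl
  have hTval : ∀ (i j : ℕ) (hi : i < ε + 1) (hj : j < k + 1) (x : Fin ε × Fin (k + 2)),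
      T x (⟨i, hi⟩, ⟨j, hj⟩) = (if x.1.val = i then 1 else 0) * (if x.2.val = j then 1 else 0) +
        (if x.1.val + 1 = i then 1 else 0) * (if x.2.val = j + 1 then 1 else 0) :=
    fun i j hi hj x => by rw [hT, toeplitz_apply, hA, hB]
  have h0 : ∀ j < k + 1, w 0 j ∈ LinearMap.range T.mulVecLin := by
    intro j hj
    convert hcol 0 j (by omega) hj using 2 with x
    rw [hTval]
    simp only [w, ite_and, ite_mul, one_mul, zero_mul, Nat.succ_ne_zero, if_false, add_zero]
  have hs : ∀ i j, i + 1 < ε + 1 → j < k + 1 →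
      w (i + 1) j + w i (j + 1) ∈ LinearMap.range T.mulVecLin := by
    intro i j hi hj
    convert hcol (i + 1) j hi hj using 2 with x
    rw [hTval]
    simp only [w, Pi.add_apply, add_left_inj, ite_and, ite_mul, one_mul, zero_mul]
  -- Short antidiagonals start from row `0`.
  have c1 : ∀ i j, i + j ≤ k → i ≤ ε → w i j ∈ LinearMap.range T.mulVecLin := by
    intro i
    induction i with
    | zero => intro j hj _; exact h0 j (by omega)
    | succ i ih =>
      intro j hj hi
      have h1 := hs i j (by omega) (by omega)
      have h2 := ih (j + 1) (by omega) (by omega)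
      simpa using Submodule.sub_mem _ h1 h2
  -- The remaining ones start from row `ε`, which lies outside the block, so that `w ε j = 0`; here
  -- `ε ≤ k + 1` keeps the required column index nonnegative.
  have c2 : ∀ d i j, i + d = ε → k < i + j → j ≤ k + 1 → w i j ∈ LinearMap.range T.mulVecLin := by
    intro d
    induction d with
    | zero =>
      intro i j hi _ _
      have h0 : w i j = 0 := by
        ext x
        have := x.1.isLt
        simp only [w, Pi.zero_apply]
        rw [if_neg (by omega)]
      rw [h0]
      exact Submodule.zero_mem _
    | succ d ih =>
      intro i j hi hj hj'
      obtain ⟨j, rfl⟩ : ∃ j', j = j' + 1 := ⟨j - 1, by omega⟩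
      have h1 := hs i j (by omega) (by omega)
      have h2 := ih (i + 1) j (by omega) (by omega) (by omega)
      simpa using Submodule.sub_mem _ h1 h2
  have hw : Pi.single x 1 = w x.1.val x.2.val := by
    ext y
    simp [w, Pi.single_apply, Prod.ext_iff, Fin.ext_iff]
  rw [hw]
  by_cases h : x.1.val + x.2.val ≤ k
  · exact c1 _ _ h (by omega)
  · exact c2 (ε - x.1.val) _ _ (by omega) (by omega) (by omega)

/-- The Toeplitz matrix of a Jordan or vertical block is injective and that of a horizontal block is
surjective. The term `b.cols` on the left makes the formula uniform, so that summation over the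
blocks isolates the horizontal index. -/
theorem rank_toeplitz (b : PBlock K) (k : ℕ) (hk : b.cols ≤ k + 2) :
    (toeplitz k b.matA b.matB).rank + b.cols = (k + 2) * b.rho + b.horCols := by
  have inj : ∀ c r : ℕ, ∀ A B : Matrix (Fin r) (Fin c) K,
      (∀ u, toeplitz k A B *ᵥ u = 0 → u = 0) → (toeplitz k A B).rank + c = (k + 2) * c + 0 := by
    intro c r A B h
    rw [rank_eq_card_of_injective h]
    simp
    ring
  have sub : ∀ (c r : ℕ) (M : Matrix (Fin r) (Fin c) K) (f : Fin c → Fin r),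
      (∀ i j, M (f i) j = if i = j then 1 else 0) → ∀ v, M *ᵥ v = 0 → v = 0 := by
    intro c r M f hM v hv
    ext i
    have := congrFun hv (f i)
    simpa [Matrix.mulVec, dotProduct, hM] using this
  cases b with
  | jfin c n =>
    refine inj (n + 1) (n + 1) _ _ (toeplitz_injective_of_right (sub (n + 1) (n + 1) _ id ?_))
    intro i j
    exact if_congr Fin.ext_iff.symm rfl rfl
  | jinf n =>
    refine inj (n + 1) (n + 1) _ _ (toeplitz_injective_of_left (sub (n + 1) (n + 1) _ id ?_))
    intro i j
    exact if_congr Fin.ext_iff.symm rfl rfl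
  | vert η =>
    refine inj η (η + 1) _ _ (toeplitz_injective_of_left (sub η (η + 1) _ Fin.castSucc ?_))
    intro i j
    exact if_congr (Fin.ext_iff (a := i) (b := j)).symm rfl rfl
  | hor ε =>
    have hε : ε + 1 ≤ k + 2 := hk
    have key : ∀ A B : Matrix (Fin ε) (Fin (ε + 1)) K,
        (∀ x, Pi.single x 1 ∈ LinearMap.range (toeplitz k A B).mulVecLin) →
        (toeplitz k A B).rank + (ε + 1) = (k + 2) * ε + (ε + 1) := by
      intro A B h
      rw [rank_eq_card_of_surjective h]
      simp
      ring
    exact key _ _ (single_mem_range_toeplitz (by omega) (fun _ _ => rfl) (fun _ _ => rfl))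

end PBlock

section

variable {K : Type*} [Field K]
variable {m n m' n' : Type*} [Fintype m] [Fintype n] [Fintype m'] [Fintype n']
  [DecidableEq m] [DecidableEq n] [DecidableEq m'] [DecidableEq n']

theorem MEquiv.card_eq {A B : Matrix m n K} {A' B' : Matrix m' n' K} (h : MEquiv A B A' B') :
    Fintype.card m = Fintype.card m' ∧ Fintype.card n = Fintype.card n' := by
  obtain ⟨P, P', Q, Q', h1, h2, h3, h4, -, -⟩ := h
  have e1 := (Matrix.toLin'OfInv h1 h2).finrank_eq
  have e2 := (Matrix.toLin'OfInv h3 h4).finrank_eq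
  simp only [Module.finrank_fintype_fun_eq_card] at e1 e2
  exact ⟨e1.symm, e2⟩

variable {ι : Type*} [Fintype ι] [DecidableEq ι]

theorem IsKCF.card_eq {b : ι → PBlock K} {A B : Matrix m n K} (h : IsKCF b A B) :
    Fintype.card m = ∑ i, (b i).rows ∧ Fintype.card n = ∑ i, (b i).cols := by
  have := MEquiv.card_eq h
  simpa using this

theorem IsKCF.rank_toeplitz {b : ι → PBlock K} {A B : Matrix m n K} (h : IsKCF b A B) (k : ℕ)
    (hk : Fintype.card n ≤ k + 2) :
    (toeplitz k A B).rank + Fintype.card n =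
      (k + 2) * ∑ i, (b i).rho + ∑ i, (b i).horCols := by
  rw [MEquiv.rank_toeplitz h, rank_toeplitz_blockDiagonal', h.card_eq.2, ← Finset.sum_add_distrib,
    Finset.mul_sum, ← Finset.sum_add_distrib]
  refine Finset.sum_congr rfl fun i _ => (b i).rank_toeplitz k ?_
  refine le_trans ?_ (h.card_eq.2 ▸ hk)
  exact Finset.single_le_sum (f := fun i => (b i).cols) (fun _ _ => Nat.zero_le _)
    (Finset.mem_univ i)

theorem IsKCF.rank_toeplitz_transpose {b : ι → PBlock K} {A B : Matrix m n K} (h : IsKCF b A B)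
    (k : ℕ) (hk : Fintype.card m ≤ k + 2) :
    (toeplitz k Aᵀ Bᵀ).rank + Fintype.card m =
      (k + 2) * ∑ i, (b i).rho + ∑ i, (b i).vertRows := by
  rw [h.transpose.rank_toeplitz k hk]
  have h1 : ∀ β : PBlock K, β.tr.rho = β.rho := fun β => by cases β <;> rfl
  have h2 : ∀ β : PBlock K, β.tr.horCols = β.vertRows := fun β => by cases β <;> rfl
  simp only [h1, h2]

/-- The conservation law behind the theorem: at fixed rank, the Jordan part and the two Kronecker
indices can only be traded against each other. -/
theorem IsKCF.sum_sizes {b : ι → PBlock K} {A B : Matrix m n K} (h : IsKCF b A B) :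
    ∑ i, (b i).jordanSize + ∑ i, (b i).horCols + ∑ i, (b i).vertRows + ∑ i, (b i).rho =
      Fintype.card m + Fintype.card n := by
  rw [h.card_eq.1, h.card_eq.2]
  simp only [← Finset.sum_add_distrib]
  refine Finset.sum_congr rfl fun i _ => ?_
  cases b i <;> simp only [PBlock.jordanSize, PBlock.horCols, PBlock.vertRows, PBlock.rho,
    PBlock.rows, PBlock.cols] <;> omega

end

end Kronecker

namespace Kronecker

open Matrix

/-! ### Determinants and divisibility of minors -/

section Minors

variable {R : Type*} [CommRing R]
variable {m n : Type*} [Fintype m] [Fintype n] [DecidableEq m] [DecidableEq n]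

theorem det_blockDiagonal' {ι : Type*} [Fintype ι] [DecidableEq ι] {s : ι → Type*}
    [∀ i, Fintype (s i)] [∀ i, DecidableEq (s i)] (M : ∀ i, Matrix (s i) (s i) R) :
    (blockDiagonal' M).det = ∏ i, (M i).det := by
  -- An arbitrary order, needed only to view the matrix as block triangular.
  letI : LinearOrder ι := LinearOrder.lift' (Fintype.equivFin ι) (Fintype.equivFin ι).injective
  rw [(blockTriangular_blockDiagonal' M).det_fintype]
  refine Finset.prod_congr rfl fun k _ => ?_
  rw [← Matrix.det_submatrix_equiv_self (Equiv.sigmaSubtype (β := s) k).symm]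
  congr 1
  ext x y
  exact blockDiagonal'_apply_eq M k x y

theorem det_dvd_det_submatrix {s : Type*} [Fintype s] [DecidableEq s] {r : ℕ} (e : Fin r ≃ s)
    (P : Matrix m s R) (N : Matrix s s R) (Q : Matrix s n R) (f : Fin r → m) (g : Fin r → n) :
    N.det ∣ ((P * N * Q).submatrix f g).det := by
  rw [← Matrix.submatrix_mul_equiv (P * N) Q f e g, ← Matrix.submatrix_mul_equiv P N f e e,
    Matrix.det_mul, Matrix.det_mul, Matrix.det_submatrix_equiv_self]
  exact (Dvd.intro_left _ rfl).mul_right _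

/-- A weak form of the Cauchy–Binet formula: by multilinearity in the rows, `det (X W)` is a
combination of determinants of `r` rows of `W`, and those with a repeated row vanish. -/
theorem dvd_det_mul {r : ℕ} {q : R} (X : Matrix (Fin r) m R) (W : Matrix m (Fin r) R)
    (h : ∀ f : Fin r ↪ m, q ∣ (W.submatrix f id).det) : q ∣ (X * W).det := by
  have h1 : (X * W).det = detRowAlternating (fun i => ∑ k, X i k • W k) := by
    change Matrix.det _ = Matrix.det _
    congr 1
    ext i j
    simp [Matrix.mul_apply]
  rw [h1]
  have h2 := (detRowAlternating (R := R) (n := Fin r)).toMultilinearMap.map_sum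
    (fun i k => X i k • W k)
  rw [AlternatingMap.coe_multilinearMap] at h2
  rw [h2]
  refine Finset.dvd_sum fun f _ => ?_
  have h3 := (detRowAlternating (R := R) (n := Fin r)).toMultilinearMap.map_smul_univ
    (fun i => X i (f i)) (fun i => W (f i))
  rw [AlternatingMap.coe_multilinearMap] at h3
  rw [h3, smul_eq_mul]
  refine Dvd.dvd.mul_left ?_ _
  change q ∣ (W.submatrix f id).det
  by_cases hf : Function.Injective f
  · exact h ⟨f, hf⟩
  · rw [Function.not_injective_iff] at hf
    obtain ⟨i, j, hij, hne⟩ := hf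
    rw [Matrix.det_zero_of_row_eq hne (by ext k; simp [hij])]
    exact dvd_zero q

theorem dvd_det_mul_mul {r : ℕ} {q : R} (M : Matrix m n R) (X : Matrix (Fin r) m R)
    (Y : Matrix n (Fin r) R)
    (h : ∀ (f : Fin r ↪ m) (g : Fin r ↪ n), q ∣ (M.submatrix f g).det) :
    q ∣ (X * M * Y).det := by
  rw [Matrix.mul_assoc]
  refine dvd_det_mul X (M * Y) fun f => ?_
  have h1 : (M * Y).submatrix f id = M.submatrix f id * Y := by
    ext i j; simp [Matrix.mul_apply]
  rw [h1, ← Matrix.det_transpose, Matrix.transpose_mul]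
  refine dvd_det_mul _ _ fun g => ?_
  rw [← Matrix.det_transpose]
  exact h f g

theorem det_bidiagonal {N : ℕ} (d e : R) (M : Matrix (Fin N) (Fin N) R)
    (h : ∀ i j, M i j = if i.val = j.val then d else if i.val + 1 = j.val then e else 0) :
    M.det = d ^ N := by
  rw [Matrix.det_of_isUpperTriangular]
  · simp [h]
  · intro i j hij
    have : j.val < i.val := hij
    rw [h, if_neg (by omega), if_neg (by omega)]

end Minors

/-! ### Maximal minors of a pencil and the Jordan determinants -/

section PencilPoly

open MvPolynomial

variable {K : Type*} [Field K]
variable {m n m' n' : Type*}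

/-- The matrix `μ A + λ B` with `λ = X 0` and `μ = X 1`. -/
noncomputable def pencilPoly (A B : Matrix m n K) : Matrix m n (MvPolynomial (Fin 2) K) :=
  Matrix.of fun i j => X 1 * C (A i j) + X 0 * C (B i j)

theorem pencilPoly_apply (A B : Matrix m n K) (i : m) (j : n) :
    pencilPoly A B i j = X 1 * C (A i j) + X 0 * C (B i j) := rfl

/-- A matrix of constant polynomials. -/
noncomputable def constMatrix (P : Matrix m n K) : Matrix m n (MvPolynomial (Fin 2) K) :=
  P.map C

theorem pencilPoly_mul_mul [Fintype m] [Fintype n] (A B : Matrix m n K) (P : Matrix m' m K)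
    (Q : Matrix n n' K) :
    pencilPoly (P * A * Q) (P * B * Q) = constMatrix P * pencilPoly A B * constMatrix Q := by
  have h : pencilPoly A B = (X 1 : MvPolynomial (Fin 2) K) • constMatrix A +
      (X 0 : MvPolynomial (Fin 2) K) • constMatrix B := rfl
  have h' : pencilPoly (P * A * Q) (P * B * Q) = (X 1 : MvPolynomial (Fin 2) K) •
      constMatrix (P * A * Q) + (X 0 : MvPolynomial (Fin 2) K) • constMatrix (P * B * Q) := rfl
  rw [h', h]
  simp only [constMatrix, Matrix.map_mul, Matrix.mul_add, Matrix.add_mul, Matrix.mul_smul,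
    Matrix.smul_mul]

theorem pencilPoly_blockDiagonal' {ι : Type*} [DecidableEq ι] {r c : ι → Type*}
    (A B : ∀ i, Matrix (r i) (c i) K) :
    pencilPoly (blockDiagonal' A) (blockDiagonal' B) =
      blockDiagonal' fun i => pencilPoly (A i) (B i) := by
  ext1 ⟨i, x⟩ ⟨j, y⟩
  by_cases h : i = j
  · subst h
    simp only [pencilPoly_apply, blockDiagonal'_apply_eq]
  · simp only [pencilPoly_apply, blockDiagonal'_apply_ne _ _ _ h, map_zero, mul_zero, add_zero]

namespace PBlock

/-- The determinant of the homogenised pencil of a Jordan block; `1` for other blocks. -/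
noncomputable def lin : PBlock K → MvPolynomial (Fin 2) K
  | jfin c n => (X 1 * C c + X 0) ^ (n + 1)
  | jinf n => X 1 ^ (n + 1)
  | _ => 1

theorem jfin_pencilPoly (c : K) (n : ℕ) (i j : Fin (n + 1)) :
    pencilPoly (jfin c n).matA (jfin c n).matB i j =
      if i.val = j.val then X 1 * C c + X 0 else if i.val + 1 = j.val then X 1 else 0 := by
  change X 1 * (C (if i.val = j.val then c else if i.val + 1 = j.val then (1 : K) else 0) : MvPolynomial (Fin 2) K) +
    X 0 * (C (if i.val = j.val then (1 : K) else 0) : MvPolynomial (Fin 2) K) = _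
  split_ifs <;> simp

theorem jinf_pencilPoly (n : ℕ) (i j : Fin (n + 1)) :
    pencilPoly (jinf n : PBlock K).matA (jinf n).matB i j =
      if i.val = j.val then X 1 else if i.val + 1 = j.val then X 0 else 0 := by
  change X 1 * (C (if i.val = j.val then (1 : K) else 0) : MvPolynomial (Fin 2) K) +
    X 0 * (C (if i.val + 1 = j.val then (1 : K) else 0) : MvPolynomial (Fin 2) K) = _
  split_ifs <;> first | omega | simp

theorem hor_pencilPoly (ε : ℕ) (i : Fin ε) (j : Fin (ε + 1)) :
    pencilPoly (hor ε : PBlock K).matA (hor ε).matB i j =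
      if i.val = j.val then X 1 else if i.val + 1 = j.val then X 0 else 0 := by
  change X 1 * (C (if i.val = j.val then (1 : K) else 0) : MvPolynomial (Fin 2) K) +
    X 0 * (C (if i.val + 1 = j.val then (1 : K) else 0) : MvPolynomial (Fin 2) K) = _
  split_ifs <;> first | omega | simp

theorem vert_pencilPoly (η : ℕ) (i : Fin (η + 1)) (j : Fin η) :
    pencilPoly (vert η : PBlock K).matA (vert η).matB i j =
      if i.val = j.val then X 1 else if i.val = j.val + 1 then X 0 else 0 := by
  change X 1 * (C (if i.val = j.val then (1 : K) else 0) : MvPolynomial (Fin 2) K) +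
    X 0 * (C (if i.val = j.val + 1 then (1 : K) else 0) : MvPolynomial (Fin 2) K) = _
  split_ifs <;> first | omega | simp

/-- Factoring through a square matrix whose size is the rank makes `det N` a factor of every maximal
minor. For a Kronecker block `N` is the identity. -/
theorem exists_factorization (b : PBlock K) :
    ∃ (P : Matrix (Fin b.rows) (Fin b.rho) (MvPolynomial (Fin 2) K)) (N : Matrix (Fin b.rho)
      (Fin b.rho) (MvPolynomial (Fin 2) K)) (Q : Matrix (Fin b.rho) (Fin b.cols) _),
      pencilPoly b.matA b.matB = P * N * Q ∧ N.det = b.lin := by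
  cases b with
  | jfin c n =>
    let M : Matrix (Fin (n + 1)) (Fin (n + 1)) (MvPolynomial (Fin 2) K) :=
      pencilPoly (jfin c n).matA (jfin c n).matB
    have h1 : M = 1 * M * 1 := by simp
    exact ⟨(1 : Matrix (Fin (n + 1)) (Fin (n + 1)) _), M,
      (1 : Matrix (Fin (n + 1)) (Fin (n + 1)) _), h1,
      det_bidiagonal _ (X 1) M (jfin_pencilPoly c n)⟩
  | jinf n =>
    let M : Matrix (Fin (n + 1)) (Fin (n + 1)) (MvPolynomial (Fin 2) K) :=
      pencilPoly (jinf n).matA (jinf n).matB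
    have h1 : M = 1 * M * 1 := by simp
    exact ⟨(1 : Matrix (Fin (n + 1)) (Fin (n + 1)) _), M,
      (1 : Matrix (Fin (n + 1)) (Fin (n + 1)) _), h1,
      det_bidiagonal _ (X 0) M (jinf_pencilPoly n)⟩
  | hor ε =>
    let M : Matrix (Fin ε) (Fin (ε + 1)) (MvPolynomial (Fin 2) K) :=
      pencilPoly (hor ε).matA (hor ε).matB
    let I : Matrix (Fin ε) (Fin ε) (MvPolynomial (Fin 2) K) := 1
    have h1 : M = I * I * M := by rw [Matrix.one_mul, Matrix.one_mul]
    exact ⟨I, I, M, h1, Matrix.det_one⟩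
  | vert η =>
    let M : Matrix (Fin (η + 1)) (Fin η) (MvPolynomial (Fin 2) K) :=
      pencilPoly (vert η).matA (vert η).matB
    let I : Matrix (Fin η) (Fin η) (MvPolynomial (Fin 2) K) := 1
    have h1 : M = M * I * I := by rw [Matrix.mul_one, Matrix.mul_one]
    exact ⟨M, I, I, h1, Matrix.det_one⟩

/-- Deleting the first or the last column of a horizontal block (row of a vertical one) leaves a
triangular matrix with `X 0`, respectively `X 1`, on the diagonal. Having both choices shows that
Kronecker blocks contribute nothing to the gcd. -/
theorem exists_minor (v : Fin 2) (b : PBlock K) :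
    ∃ (f : Fin b.rho → Fin b.rows) (g : Fin b.rho → Fin b.cols) (e : ℕ),
      ((pencilPoly b.matA b.matB).submatrix f g).det = X v ^ e * b.lin := by
  cases b with
  | jfin c n =>
    refine ⟨id, id, 0, ?_⟩
    rw [pow_zero, one_mul]
    exact det_bidiagonal _ (X 1) _ (jfin_pencilPoly c n)
  | jinf n =>
    refine ⟨id, id, 0, ?_⟩
    rw [pow_zero, one_mul]
    exact det_bidiagonal _ (X 0) _ (jinf_pencilPoly n)
  | hor ε =>
    have hl : (hor ε : PBlock K).lin = 1 := rfl
    rw [hl]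
    fin_cases v
    · refine ⟨id, Fin.succ, ε, ?_⟩
      rw [mul_one, ← Matrix.det_transpose]
      refine det_bidiagonal _ (X 1) _ fun (i : Fin ε) (j : Fin ε) => ?_
      refine (hor_pencilPoly ε j i.succ).trans ?_
      rw [Fin.val_succ]
      split_ifs <;> first | omega | rfl
    · refine ⟨id, Fin.castSucc, ε, ?_⟩
      rw [mul_one]
      exact det_bidiagonal _ (X 0) _ fun (i : Fin ε) (j : Fin ε) => hor_pencilPoly ε i j.castSucc
  | vert η =>
    have hl : (vert η : PBlock K).lin = 1 := rfl
    rw [hl]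
    fin_cases v
    · refine ⟨Fin.succ, id, η, ?_⟩
      rw [mul_one]
      refine det_bidiagonal _ (X 1) _ fun (i : Fin η) (j : Fin η) => ?_
      refine (vert_pencilPoly η i.succ j).trans ?_
      rw [Fin.val_succ]
      split_ifs <;> first | omega | rfl
    · refine ⟨Fin.castSucc, id, η, ?_⟩
      rw [mul_one, ← Matrix.det_transpose]
      refine det_bidiagonal _ (X 0) _ fun (i : Fin η) (j : Fin η) => ?_
      refine (vert_pencilPoly η j.castSucc i).trans ?_
      rw [Fin.val_castSucc]
      split_ifs <;> first | omega | rfl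

theorem lin_isHomogeneous (b : PBlock K) : b.lin.IsHomogeneous b.jordanSize := by
  have h1 : ∀ c : K, (X 1 * C c + X 0 : MvPolynomial (Fin 2) K).IsHomogeneous 1 := fun c =>
    ((isHomogeneous_X K 1).mul (isHomogeneous_C (Fin 2) c)).add (isHomogeneous_X K 0)
  cases b with
  | jfin c n => simpa using! (h1 c).pow (n + 1)
  | jinf n => simpa using! (isHomogeneous_X K (1 : Fin 2)).pow (n + 1)
  | hor ε => exact isHomogeneous_one (Fin 2) K
  | vert η => exact isHomogeneous_one (Fin 2) K

/-- The points of the affine line at which the rank of a block drops. -/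
def roots : PBlock K → Set K
  | jfin c _ => {-c}
  | _ => ∅

theorem eval_lin_ne_zero (b : PBlock K) {t : K} (ht : t ∉ b.roots) :
    MvPolynomial.eval ![t, 1] b.lin ≠ 0 := by
  cases b with
  | jfin c n =>
    have h1 : c + t ≠ 0 := fun h => ht (eq_neg_of_add_eq_zero_right h)
    simpa [lin] using h1
  | jinf n => simp [lin]
  | hor ε => simp [lin]
  | vert η => simp [lin]

theorem finite_roots (b : PBlock K) : b.roots.Finite := by
  cases b <;> simp [roots]

theorem lin_ne_zero [Infinite K] (b : PBlock K) : b.lin ≠ 0 := by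
  obtain ⟨t, ht⟩ := b.finite_roots.exists_notMem
  intro h
  exact b.eval_lin_ne_zero ht (by rw [h, map_zero])

theorem rank_le (b : PBlock K) (M : Matrix (Fin b.rows) (Fin b.cols) K) : M.rank ≤ b.rho := by
  cases b with
  | jfin c n => simpa using! Matrix.rank_le_card_width M
  | jinf n => simpa using! Matrix.rank_le_card_width M
  | hor ε => simpa using! Matrix.rank_le_card_height M
  | vert η => simpa using! Matrix.rank_le_card_width M

end PBlock

theorem le_rank_of_det_ne_zero [Fintype m] [Fintype n] {r : ℕ} (M : Matrix m n K) (f : Fin r → m)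
    (g : Fin r → n) (h : (M.submatrix f g).det ≠ 0) : r ≤ M.rank := by
  have h1 := Matrix.rank_of_det_ne_zero h
  have h2 := Matrix.rank_submatrix_le M f g
  rw [h1, Fintype.card_fin] at h2
  exact h2

theorem pencilPoly_eval (A B : Matrix m n K) (s t : K) :
    (pencilPoly A B).map (MvPolynomial.eval ![t, s]) = s • A + t • B := by
  ext i j
  simp [pencilPoly_apply]

theorem PBlock.rank_eq (b : PBlock K) {t : K} (ht : t ∉ b.roots) :
    (b.matA + t • b.matB).rank = b.rho := by
  refine le_antisymm (b.rank_le _) ?_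
  obtain ⟨f, g, e, h⟩ := b.exists_minor 1
  refine le_rank_of_det_ne_zero _ f g ?_
  have h1 := congrArg (MvPolynomial.eval ![t, 1]) h
  rw [RingHom.map_det, RingHom.mapMatrix_apply, ← Matrix.submatrix_map, pencilPoly_eval,
    one_smul] at h1
  rw [h1]
  simpa using b.eval_lin_ne_zero ht

section

variable [Fintype m] [Fintype n] [DecidableEq m] [DecidableEq n]
variable {ι : Type*} [Fintype ι] [DecidableEq ι] {b : ι → PBlock K} {A B : Matrix m n K}

theorem IsKCF.rank_eq_sum (h : IsKCF b A B) (s t : K) :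
    (s • A + t • B).rank = ∑ i, (s • (b i).matA + t • (b i).matB).rank := by
  obtain ⟨P, P', Q, Q', h1, h2, h3, h4, h5, h6⟩ := h
  have h7 : P * (s • A + t • B) * Q = blockDiagonal' fun i => s • (b i).matA + t • (b i).matB := by
    rw [Matrix.mul_add, Matrix.add_mul, Matrix.mul_smul, Matrix.mul_smul, Matrix.smul_mul,
      Matrix.smul_mul, h5, h6, ← blockDiagonal'_smul, ← blockDiagonal'_smul, ← blockDiagonal'_add]
    rfl
  rw [← rank_blockDiagonal', ← h7]
  apply le_antisymm
  · have h8 : s • A + t • B = P' * (P * (s • A + t • B) * Q) * Q' := by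
      calc s • A + t • B = (P' * P) * (s • A + t • B) * (Q * Q') := by rw [h2, h3]; simp
        _ = _ := by simp only [Matrix.mul_assoc]
    conv_lhs => rw [h8]
    exact (Matrix.rank_mul_le_left _ _).trans (Matrix.rank_mul_le_right _ _)
  · exact (Matrix.rank_mul_le_left _ _).trans (Matrix.rank_mul_le_right _ _)

theorem IsKCF.rank_le (h : IsKCF b A B) (s t : K) : (s • A + t • B).rank ≤ ∑ i, (b i).rho := by
  rw [h.rank_eq_sum]
  exact Finset.sum_le_sum fun i _ => (b i).rank_le _

theorem IsKCF.exists_rank_eq [Infinite K] (h : IsKCF b A B) :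
    ∃ t : K, (A + t • B).rank = ∑ i, (b i).rho := by
  have hfin : (⋃ i, (b i).roots).Finite := Set.finite_iUnion fun i => (b i).finite_roots
  obtain ⟨t, ht⟩ := hfin.exists_notMem
  rw [Set.mem_iUnion, not_exists] at ht
  refine ⟨t, ?_⟩
  have h1 := h.rank_eq_sum 1 t
  simp only [one_smul] at h1
  rw [h1]
  exact Finset.sum_congr rfl fun i _ => (b i).rank_eq (ht i)

/-- The product of the determinants of the Jordan blocks divides all minors of maximal size. -/
theorem IsKCF.prod_lin_dvd (h : IsKCF b A B) {r : ℕ} (hr : ∑ i, (b i).rho = r) (f : Fin r → m)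
    (g : Fin r → n) : ∏ i, (b i).lin ∣ ((pencilPoly A B).submatrix f g).det := by
  obtain ⟨P, P', Q, Q', -, -, -, -, h5, h6⟩ := MEquiv.symm h
  choose S N T h7 h8 using fun i => (b i).exists_factorization
  have h9 : pencilPoly A B = (constMatrix P * blockDiagonal' S) * blockDiagonal' N *
      (blockDiagonal' T * constMatrix Q) := by
    have h10 : (blockDiagonal' fun i => pencilPoly (b i).matA (b i).matB) =
        blockDiagonal' S * blockDiagonal' N * blockDiagonal' T := by
      rw [← blockDiagonal'_mul, ← blockDiagonal'_mul]
      exact congrArg blockDiagonal' (funext h7)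
    rw [← h5, ← h6, pencilPoly_mul_mul, pencilPoly_blockDiagonal', h10]
    simp only [Matrix.mul_assoc]
  have e : Fin r ≃ Σ i, Fin (b i).rho := (Fintype.equivFinOfCardEq (by simpa using hr)).symm
  have h10 := det_dvd_det_submatrix e (constMatrix P * blockDiagonal' S) (blockDiagonal' N)
    (blockDiagonal' T * constMatrix Q) f g
  rw [det_blockDiagonal', Finset.prod_congr rfl fun i _ => h8 i, ← h9] at h10
  exact h10

/-- A maximal minor of the canonical form is a combination of the maximal minors of the original
pencil, hence also divisible by `q`; choose the one assembled from the block minors attached to `v`.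
-/
theorem IsKCF.dvd_X_pow_mul (h : IsKCF b A B) {r : ℕ} (hr : ∑ i, (b i).rho = r)
    {q : MvPolynomial (Fin 2) K}
    (hq : ∀ (f : Fin r ↪ m) (g : Fin r ↪ n), q ∣ ((pencilPoly A B).submatrix f g).det)
    (v : Fin 2) : ∃ e : ℕ, q ∣ X v ^ e * ∏ i, (b i).lin := by
  obtain ⟨P, P', Q, Q', -, -, -, -, h5, h6⟩ := h
  choose f g e hfg using fun i => (b i).exists_minor v
  have η : Fin r ≃ Σ i, Fin (b i).rho := (Fintype.equivFinOfCardEq (by simpa using hr)).symm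
  let M := blockDiagonal' fun i => pencilPoly (b i).matA (b i).matB
  have hM : M = constMatrix P * pencilPoly A B * constMatrix Q := by
    rw [← pencilPoly_mul_mul, h5, h6, pencilPoly_blockDiagonal']
  have h1 : (M.submatrix (Sigma.map id f) (Sigma.map id g)).det =
      X v ^ (∑ i, e i) * ∏ i, (b i).lin := by
    have h2 : M.submatrix (Sigma.map id f) (Sigma.map id g) = blockDiagonal' fun i =>
        (pencilPoly (b i).matA (b i).matB).submatrix (f i) (g i) := by
      ext1 ⟨i, x⟩ ⟨j, y⟩
      by_cases hij : i = j
      · subst hij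
        simp only [M, Matrix.submatrix_apply, Sigma.map, id, blockDiagonal'_apply_eq]
      · simp only [M, Matrix.submatrix_apply, Sigma.map, id, blockDiagonal'_apply_ne _ _ _ hij]
    rw [h2, det_blockDiagonal', Finset.prod_congr rfl fun i _ => hfg i, Finset.prod_mul_distrib,
      Finset.prod_pow_eq_pow_sum]
  refine ⟨∑ i, e i, ?_⟩
  rw [← h1, ← Matrix.det_submatrix_equiv_self η, Matrix.submatrix_submatrix, hM]
  have h3 : (constMatrix P * pencilPoly A B * constMatrix Q).submatrix (Sigma.map id f ∘ η)
      (Sigma.map id g ∘ η) = (constMatrix P).submatrix (Sigma.map id f ∘ η) id * pencilPoly A B *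
        (constMatrix Q).submatrix id (Sigma.map id g ∘ η) := by
    ext i j
    simp [Matrix.mul_apply]
  rw [h3]
  exact dvd_det_mul_mul _ _ _ hq

theorem isRelPrime_X_X : IsRelPrime (X 0 : MvPolynomial (Fin 2) K) (X 1) := by
  have h : Prime (X 0 : MvPolynomial (Fin 2) K) := MvPolynomial.X_prime
  rw [h.irreducible.isRelPrime_iff_not_dvd]
  rintro ⟨q, hq⟩
  have := congrArg (MvPolynomial.eval ![0, 1]) hq
  simp at this

theorem dvd_of_dvd_mul_of_isRelPrime {α : Type*} [CommRing α] [IsDomain α]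
    [UniqueFactorizationMonoid α] {q a b d : α} (hab : IsRelPrime a b) (h1 : q ∣ a * d)
    (h2 : q ∣ b * d) : q ∣ d := by
  classical
  letI := UniqueFactorizationMonoid.toGCDMonoid α
  have h3 : IsUnit (gcd a b) := hab (gcd_dvd_left a b) (gcd_dvd_right a b)
  have h4 : q ∣ gcd a b * d := (dvd_gcd h1 h2).trans (gcd_mul_right' d a b).dvd
  exact h3.dvd_mul_left.mp h4

/-- A common divisor of all minors of maximal size divides the product of the determinants of the
Jordan blocks. -/
theorem IsKCF.dvd_prod_lin (h : IsKCF b A B) {r : ℕ} (hr : ∑ i, (b i).rho = r)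
    {q : MvPolynomial (Fin 2) K}
    (hq : ∀ (f : Fin r ↪ m) (g : Fin r ↪ n), q ∣ ((pencilPoly A B).submatrix f g).det) :
    q ∣ ∏ i, (b i).lin := by
  obtain ⟨e₀, h0⟩ := h.dvd_X_pow_mul hr hq 0
  obtain ⟨e₁, h1⟩ := h.dvd_X_pow_mul hr hq 1
  -- The powers of `X 0` and `X 1` are coprime, so both can be dropped.
  exact dvd_of_dvd_mul_of_isRelPrime isRelPrime_X_X.pow h0 h1

theorem totalDegree_prod_lin [Infinite K] (b : ι → PBlock K) :
    (∏ i, (b i).lin).totalDegree = ∑ i, (b i).jordanSize :=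
  (IsHomogeneous.prod _ _ _ fun i _ => (b i).lin_isHomogeneous).totalDegree
    (Finset.prod_ne_zero_iff.mpr fun i _ => (b i).lin_ne_zero)

end

end PencilPoly

end Kronecker

/-! ### Comparison with the definitions over `ℂ` and uniqueness of the totals -/

namespace Kronecker

open Matrix

theorem mequiv_blocks_reindex {R : Type*} [CommRing R] {ι κ : Type*} [Fintype ι] [DecidableEq ι]
    [Fintype κ] [DecidableEq κ] (e : ι ≃ κ) (c : κ → PBlock R) :
    MEquiv (blockDiagonal' fun k => (c k).matA) (blockDiagonal' fun k => (c k).matB)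
      (blockDiagonal' fun i => (c (e i)).matA) (blockDiagonal' fun i => (c (e i)).matB) := by
  have key : ∀ M : ∀ k, Matrix (Fin (c k).rows) (Fin (c k).cols) R,
      (blockDiagonal' M).submatrix (Equiv.sigmaCongrLeft (β := fun k => Fin (c k).rows) e)
        (Equiv.sigmaCongrLeft (β := fun k => Fin (c k).cols) e) =
        blockDiagonal' fun i => M (e i) := by
    intro M
    ext1 ⟨i, x⟩ ⟨j, y⟩
    change blockDiagonal' M ⟨e i, x⟩ ⟨e j, y⟩ = _
    by_cases hij : i = j
    · subst hij
      rw [blockDiagonal'_apply_eq, blockDiagonal'_apply_eq]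
    · rw [blockDiagonal'_apply_ne _ _ _ hij, blockDiagonal'_apply_ne _ _ _ (e.injective.ne hij)]
  exact MEquiv.of_reindex (Equiv.sigmaCongrLeft (β := fun k => Fin (c k).rows) e)
    (Equiv.sigmaCongrLeft (β := fun k => Fin (c k).cols) e)
    (fun i j => congrFun (congrFun (key fun k => (c k).matA) i) j)
    fun i j => congrFun (congrFun (key fun k => (c k).matB) i) j

theorem IsKCF.reindex {R : Type*} [CommRing R] {m n : Type*} [Fintype m] [Fintype n]
    [DecidableEq m] [DecidableEq n] {ι κ : Type*} [Fintype ι] [DecidableEq ι]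
    [Fintype κ] [DecidableEq κ] (e : ι ≃ κ) {b : ι → PBlock R} {c : κ → PBlock R}
    (hbc : ∀ i, b i = c (e i)) {A B : Matrix m n R} : IsKCF b A B ↔ IsKCF c A B := by
  obtain rfl : b = fun i => c (e i) := funext hbc
  exact ⟨fun h => h.trans (mequiv_blocks_reindex e c).symm,
    fun h => h.trans (mequiv_blocks_reindex e c)⟩

/-- The block over `ℂ` corresponding to a block of the Kronecker canonical form. -/
noncomputable def ofBlock : JK.Block → PBlock ℂ
  | .jordan (OnePoint.some c) n => .jfin c n
  | .jordan ∞ n => .jinf n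
  | .hor ε => .hor ε
  | .vert η => .vert η

/-- The block of the Kronecker canonical form corresponding to a block over `ℂ`. -/
def toBlock : PBlock ℂ → JK.Block
  | .jfin c n => .jordan (OnePoint.some c) n
  | .jinf n => .jordan ∞ n
  | .hor ε => .hor ε
  | .vert η => .vert η

theorem ofBlock_toBlock (b : PBlock ℂ) : ofBlock (toBlock b) = b := by
  cases b <;> rfl

theorem ofBlock_horCols (b : JK.Block) : (ofBlock b).horCols = b.horCols := by
  rcases b with ⟨_ | c, n⟩ | ε | η <;> rfl

theorem ofBlock_vertRows (b : JK.Block) : (ofBlock b).vertRows = b.vertRows := by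
  rcases b with ⟨_ | c, n⟩ | ε | η <;> rfl

theorem mequiv_ofBlock (b : JK.Block) :
    MEquiv b.matA b.matB (ofBlock b).matA (ofBlock b).matB := by
  rcases b with ⟨_ | c, n⟩ | ε | η <;> exact MEquiv.refl _ _

section Canonical

variable {U V : Type*} [AddCommGroup U] [Module ℂ U] [AddCommGroup V] [Module ℂ V]

theorem isCanonicalForm_iff_represents (A B : U →ₗ[ℂ] V) (S : List JK.Block) :
    JK.IsCanonicalForm A B S ↔
      Represents A B (blockDiagonal' fun i : Fin S.length => (S.get i).matA)
        (blockDiagonal' fun i : Fin S.length => (S.get i).matB) := by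
  constructor
  · rintro ⟨u, v, hA, hB⟩
    rw [← hA, ← hB]
    exact Represents.of_bases u v A B
  · rintro ⟨Φ, Ψ, h⟩
    have key : ∀ (C : U →ₗ[ℂ] V) (M : Matrix (Σ i : Fin S.length, Fin (S.get i).rows)
        (Σ i : Fin S.length, Fin (S.get i).cols) ℂ), (∀ c, C (Φ c) = Ψ (M *ᵥ c)) →
        LinearMap.toMatrix (Module.Basis.ofEquivFun Φ.symm) (Module.Basis.ofEquivFun Ψ.symm) C =
          M := by
      intro C M hC
      ext i j
      rw [LinearMap.toMatrix_apply, Module.Basis.coe_ofEquivFun, LinearEquiv.symm_symm, hC,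
        Module.Basis.ofEquivFun_repr_apply, LinearEquiv.symm_apply_apply, Matrix.mulVec_single_one]
      rfl
    exact ⟨_, _, key A _ fun c => (h c).1, key B _ fun c => (h c).2⟩

variable [FiniteDimensional ℂ U] [FiniteDimensional ℂ V]

theorem isCanonicalForm_iff_isKCF (A B : U →ₗ[ℂ] V) (S : List JK.Block) :
    JK.IsCanonicalForm A B S ↔
      IsKCF (fun i : Fin S.length => ofBlock (S.get i)) (JK.mat A) (JK.mat B) := by
  rw [isCanonicalForm_iff_represents]
  have h1 : Represents A B (JK.mat A) (JK.mat B) := Represents.of_bases _ _ A B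
  have h2 := MEquiv.blockDiagonal' fun i : Fin S.length => mequiv_ofBlock (S.get i)
  exact ⟨fun h => (h1.mequiv h).trans h2, fun h => h1.congr (h.trans h2.symm)⟩

theorem IsKCF.exists_isCanonicalForm {A B : U →ₗ[ℂ] V} {ι : Type*} [Fintype ι] [DecidableEq ι]
    {b : ι → PBlock ℂ} (h : IsKCF b (JK.mat A) (JK.mat B)) :
    JK.IsCanonicalForm A B (Finset.univ.toList.map fun i => toBlock (b i)) := by
  rw [isCanonicalForm_iff_isKCF]
  have hnd : (Finset.univ : Finset ι).toList.Nodup := Finset.nodup_toList _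
  have hlen : ((Finset.univ : Finset ι).toList.map fun i => toBlock (b i)).length =
      (Finset.univ : Finset ι).toList.length := List.length_map _
  let e : Fin ((Finset.univ : Finset ι).toList.map fun i => toBlock (b i)).length ≃ ι :=
    (finCongr hlen).trans (List.Nodup.getEquivOfForallMemList _ hnd fun i => by simp)
  refine (IsKCF.reindex e fun i => ?_).mpr h
  rw [List.get_eq_getElem, List.getElem_map, ofBlock_toBlock]
  rfl

theorem sum_map_toList {ι M : Type*} [Fintype ι] [AddCommMonoid M] (f : JK.Block → M)
    (b : ι → PBlock ℂ) : ((Finset.univ.toList.map fun i => toBlock (b i)).map f).sum =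
      ∑ i, f (toBlock (b i)) := by
  rw [List.map_map]
  exact Finset.sum_map_toList _ _

theorem sum_map_eq_sum_get {α M : Type*} [AddCommMonoid M] (f : α → M) (S : List α) :
    (S.map f).sum = ∑ i : Fin S.length, f (S.get i) := by
  simp [← List.sum_ofFn]

end Canonical

section Unique

variable {K : Type*} [Field K] [Infinite K] {m n ι κ : Type*} [Fintype m] [Fintype n]
  [DecidableEq m] [DecidableEq n] [Fintype ι] [DecidableEq ι] [Fintype κ] [DecidableEq κ]
  {b : ι → PBlock K} {c : κ → PBlock K} {A B : Matrix m n K}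

/-- Both sums are the maximal rank of `A + t B` over all `t`. -/
theorem IsKCF.sum_rho_eq (h : IsKCF b A B) (h' : IsKCF c A B) :
    ∑ i, (b i).rho = ∑ k, (c k).rho := by
  obtain ⟨t, ht⟩ := h.exists_rank_eq
  obtain ⟨s, hs⟩ := h'.exists_rank_eq
  have h1 := h'.rank_le 1 t
  have h2 := h.rank_le 1 s
  rw [one_smul] at h1 h2
  omega

/-- The horizontal total is determined by the generic rank and one Toeplitz rank, neither of which
depends on the chosen form. -/
theorem IsKCF.sum_horCols_eq (h : IsKCF b A B) (h' : IsKCF c A B) :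
    ∑ i, (b i).horCols = ∑ k, (c k).horCols := by
  have h1 := h.rank_toeplitz (Fintype.card n) (by omega)
  have h2 := h'.rank_toeplitz (Fintype.card n) (by omega)
  rw [h.sum_rho_eq h'] at h1
  omega

theorem IsKCF.sum_vertRows_eq (h : IsKCF b A B) (h' : IsKCF c A B) :
    ∑ i, (b i).vertRows = ∑ k, (c k).vertRows := by
  have h1 := h.rank_toeplitz_transpose (Fintype.card m) (by omega)
  have h2 := h'.rank_toeplitz_transpose (Fintype.card m) (by omega)
  rw [h.sum_rho_eq h'] at h1
  omega

end Unique

section Indices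

variable {U V : Type*} [AddCommGroup U] [Module ℂ U] [AddCommGroup V] [Module ℂ V]
  [FiniteDimensional ℂ U] [FiniteDimensional ℂ V] {A B : U →ₗ[ℂ] V}
  {ι : Type*} [Fintype ι] [DecidableEq ι] {b : ι → PBlock ℂ}

theorem horCols_toBlock (b : PBlock ℂ) : (toBlock b).horCols = b.horCols := by
  cases b <;> rfl

theorem vertRows_toBlock (b : PBlock ℂ) : (toBlock b).vertRows = b.vertRows := by
  cases b <;> rfl

theorem IsKCF.kHor_eq (h : IsKCF b (JK.mat A) (JK.mat B)) :
    JK.kHor A B = ∑ i, (b i).horCols := by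
  have h1 : {k | ∃ S, JK.IsCanonicalForm A B S ∧ (S.map JK.Block.horCols).sum = k} =
      {∑ i, (b i).horCols} := by
    ext k
    rw [Set.mem_singleton_iff]
    constructor
    · rintro ⟨S, hS, rfl⟩
      rw [sum_map_eq_sum_get, ((isCanonicalForm_iff_isKCF A B S).mp hS).sum_horCols_eq h |>.symm]
      exact Finset.sum_congr rfl fun i _ => (ofBlock_horCols _).symm
    · rintro rfl
      refine ⟨_, h.exists_isCanonicalForm, ?_⟩
      rw [sum_map_toList]
      exact Finset.sum_congr rfl fun i _ => horCols_toBlock _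
  rw [JK.kHor, h1, csInf_singleton]

theorem IsKCF.kVert_eq (h : IsKCF b (JK.mat A) (JK.mat B)) :
    JK.kVert A B = ∑ i, (b i).vertRows := by
  have h1 : {k | ∃ S, JK.IsCanonicalForm A B S ∧ (S.map JK.Block.vertRows).sum = k} =
      {∑ i, (b i).vertRows} := by
    ext k
    rw [Set.mem_singleton_iff]
    constructor
    · rintro ⟨S, hS, rfl⟩
      rw [sum_map_eq_sum_get, ((isCanonicalForm_iff_isKCF A B S).mp hS).sum_vertRows_eq h |>.symm]
      exact Finset.sum_congr rfl fun i _ => (ofBlock_vertRows _).symm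
    · rintro rfl
      refine ⟨_, h.exists_isCanonicalForm, ?_⟩
      rw [sum_map_toList]
      exact Finset.sum_congr rfl fun i _ => vertRows_toBlock _
  rw [JK.kVert, h1, csInf_singleton]

theorem finrank_range_eq_rank_mat (A : U →ₗ[ℂ] V) :
    Module.finrank ℂ (LinearMap.range A) = (JK.mat A).rank := by
  rw [JK.mat, Matrix.rank_eq_finrank_range_toLin _ (Module.finBasis ℂ V) (Module.finBasis ℂ U),
    Matrix.toLin_toMatrix]

theorem IsKCF.pencilRank_eq (h : IsKCF b (JK.mat A) (JK.mat B)) :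
    JK.pencilRank A B = ∑ i, (b i).rho := by
  have h1 : ∀ t : ℂ, Module.finrank ℂ (LinearMap.range (A + t • B)) =
      (JK.mat A + t • JK.mat B).rank := by
    intro t
    rw [finrank_range_eq_rank_mat, JK.mat, map_add, map_smul]
    rfl
  have h2 : ∀ t : ℂ, (JK.mat A + t • JK.mat B).rank ≤ ∑ i, (b i).rho := by
    intro t
    simpa only [one_smul] using h.rank_le 1 t
  obtain ⟨t, ht⟩ := h.exists_rank_eq
  simp only [JK.pencilRank, h1]
  exact le_antisymm (ciSup_le h2) (ht ▸ le_ciSup ⟨_, Set.forall_mem_range.mpr h2⟩ t)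

theorem exists_isKCF_mat (A B : U →ₗ[ℂ] V) : HasKCF (JK.mat A) (JK.mat B) :=
  hasKCF _ _ _ rfl _ _

end Indices

section SameType

theorem SameType.sum_eq {S T : List JK.Block} (h : JK.SameType S T) {f : JK.Block → ℕ}
    (hf : ∀ σ b, f (JK.Block.renameEigenvalue σ b) = f b) : (S.map f).sum = (T.map f).sum := by
  obtain ⟨σ, h⟩ := h
  rw [← (h.map f).sum_eq, List.map_map]
  congr 2
  funext b
  exact (hf σ b).symm

/-- Injectivity keeps the pattern of coincidences between eigenvalues, so some permutation of the
Riemann sphere matches them. -/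
theorem sameType_map {ι κ : Type*} [Fintype ι] [Finite κ] (β : ι → PBlock κ) {c d : κ → ℂ}
    (hc : Function.Injective c) (hd : Function.Injective d) :
    JK.SameType (Finset.univ.toList.map fun i => toBlock ((β i).map c))
      (Finset.univ.toList.map fun i => toBlock ((β i).map d)) := by
  have hx : ∀ {c : κ → ℂ}, Function.Injective c →
      Function.Injective (Option.map c : Option κ → OnePoint ℂ) := fun h => Option.map_injective h
  -- `Option.map` sends `none`, which is `∞`, to itself, so the infinite blocks are matched by the
  -- same permutation.
  obtain ⟨σ, hσ⟩ := Equiv.Perm.exists_extending_pair _ _ (hx hc) (hx hd)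
  refine ⟨σ, ?_⟩
  rw [List.map_map]
  refine List.Perm.of_eq (List.map_congr_left fun i _ => ?_)
  change JK.Block.renameEigenvalue σ (toBlock ((β i).map c)) = _
  cases β i with
  | jfin k n => exact congrArg (JK.Block.jordan · n) (hσ (some k))
  | jinf n => exact congrArg (JK.Block.jordan · n) (hσ none)
  | hor ε => rfl
  | vert η => rfl

end SameType

end Kronecker

namespace Kronecker

open Matrix

/-! ### Specialisation of algebraic elements -/

section Specialization

/-- Lying over: a prime `Q` of `S` above `ker φ` has an integral quotient over the image `k` of `φ`;
as `k` is algebraically closed, the quotient is `k` itself. -/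
theorem exists_extension_of_isIntegral {R S k : Type*} [CommRing R] [CommRing S] [Algebra R S]
    [Algebra.IsIntegral R S] [FaithfulSMul R S] [Field k] [IsAlgClosed k] [Algebra k R]
    (φ : R →ₐ[k] k) : ∃ ψ : S →+* k, ∀ r, ψ (algebraMap R S r) = φ r := by
  have hP : (RingHom.ker φ).IsPrime := RingHom.ker_isPrime _
  obtain ⟨Q, -, hQ, hQP⟩ := Ideal.exists_ideal_over_prime_of_isIntegral (S := S) (RingHom.ker φ) ⊥
    (by simp [← RingHom.ker_eq_comap_bot])
  let q : R →+* S ⧸ Q := (Ideal.Quotient.mk Q).comp (algebraMap R S)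
  let ε : k →+* S ⧸ Q := q.comp (algebraMap k R)
  have hε : ε.comp (φ : R →+* k) = q := by
    ext r
    have h1 : algebraMap k R (φ r) - r ∈ RingHom.ker φ := by
      rw [RingHom.mem_ker, map_sub, AlgHom.commutes]
      simp
    rw [← hQP, Ideal.mem_comap, map_sub] at h1
    exact Ideal.Quotient.eq.mpr h1
  have hq : q.IsIntegral := (algebraMap_isIntegral_iff.mpr inferInstance).trans _ _
    (RingHom.isIntegral_of_surjective _ Ideal.Quotient.mk_surjective)
  have hbij := IsAlgClosed.ringHom_bijective_of_isIntegral ε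
    (RingHom.IsIntegral.tower_top (φ : R →+* k) ε (hε ▸ hq))
  let θ : k ≃+* S ⧸ Q := RingEquiv.ofBijective ε hbij
  refine ⟨(θ.symm : S ⧸ Q →+* k).comp (Ideal.Quotient.mk Q), fun r => ?_⟩
  exact θ.symm_apply_eq.mpr (RingHom.congr_fun hε r).symm

/-- Finitely many elements of an algebraic extension of the fraction field of `R` can be
specialised at all points outside a hypersurface. -/
theorem exists_specialization {R K k : Type*} [CommRing R] [IsDomain R] [Field K] [Algebra R K]
    [FaithfulSMul R K] [Algebra.IsAlgebraic R K] [Field k] [IsAlgClosed k] [Algebra k R]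
    (F : Finset K) : ∃ g : R, g ≠ 0 ∧ ∀ φ : R →ₐ[k] k, φ g ≠ 0 →
      ∃ (L : Type (max u_2 0)) (_ : CommRing L) (j : R →+* L) (i : L →+* K) (ψ : L →+* k),
        Function.Injective i ∧ (∀ r, i (j r) = algebraMap R K r) ∧ (∀ r, ψ (j r) = φ r) ∧
        ∀ z ∈ F, ∃ y, i y = z := by
  obtain ⟨g, hg, hgF⟩ := Algebra.IsAlgebraic.exists_integral_multiples R F
  refine ⟨g, hg, fun φ hφ => ?_⟩
  -- `L` is the integral closure with `g` inverted. Each `z ∈ F` equals `(g z) / g` with `g z`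
  -- integral, and the extension of `φ` passes to `L` because `φ g ≠ 0`.
  let O := integralClosure R K
  obtain ⟨ψ, hψ⟩ := exists_extension_of_isIntegral (S := O) φ
  let γ : O := algebraMap R O g
  have hγ : algebraMap O K γ = algebraMap R K g := rfl
  have hgK : algebraMap R K g ≠ 0 := by
    rwa [Ne, FaithfulSMul.algebraMap_eq_zero_iff]
  have hu : IsUnit (algebraMap O K γ) := (hγ ▸ hgK).isUnit
  have hv : IsUnit (ψ γ) := (show ψ γ ≠ 0 by rw [hψ]; exact hφ).isUnit
  let i : Localization.Away γ →+* K := IsLocalization.Away.lift γ hu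
  have hi : ∀ y : O, i (algebraMap O _ y) = algebraMap O K y := IsLocalization.Away.lift_eq γ hu
  refine ⟨Localization.Away γ, inferInstance, (algebraMap O _).comp (algebraMap R O), i,
    IsLocalization.Away.lift γ hv, ?_, fun r => ?_, fun r => ?_, fun z hz => ?_⟩
  · have hinj : Function.Injective (algebraMap O (Localization.Away γ)) := by
      intro y y' h
      have := congrArg i h
      rw [hi, hi] at this
      exact Subtype.ext this
    refine (IsLocalization.lift_injective_iff _).mpr fun y y' => ?_
    exact ⟨fun h => congrArg _ (hinj h), fun h => congrArg _ (Subtype.ext h)⟩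
  · exact hi _
  · exact (IsLocalization.Away.lift_eq γ hv _).trans (hψ r)
  · refine ⟨IsLocalization.mk' _ (⟨g • z, hgF z hz⟩ : O) (⟨γ, Submonoid.mem_powers γ⟩ :
      Submonoid.powers γ), ?_⟩
    have h1 := congrArg i (IsLocalization.mk'_spec (Localization.Away γ)
      (⟨g • z, hgF z hz⟩ : O) (⟨γ, Submonoid.mem_powers γ⟩ : Submonoid.powers γ))
    rw [map_mul, hi, hi] at h1
    refine mul_right_cancel₀ hgK (h1.trans ?_)
    change g • z = z * algebraMap R K g
    rw [Algebra.smul_def, mul_comm]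

end Specialization

/-! ### Generic canonical forms with symbolic eigenvalues -/

section Generic

/-- The constant coefficient of a block with symbolic eigenvalues. -/
def PBlock.matA' {κ R : Type*} [CommRing R] (c : κ → R) (b : PBlock κ) :
    Matrix (Fin b.rows) (Fin b.cols) R :=
  Matrix.of fun i j => (b.map c).entA i.val j.val

/-- The linear coefficient of a block with symbolic eigenvalues. -/
def PBlock.matB' {κ R : Type*} [CommRing R] (c : κ → R) (b : PBlock κ) :
    Matrix (Fin b.rows) (Fin b.cols) R :=
  Matrix.of fun i j => (b.map c).entB i.val j.val

theorem PBlock.map_map {κ R S : Type*} (c : κ → R) (f : R → S) (b : PBlock κ) :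
    (b.map c).map f = b.map (f ∘ c) := by
  cases b <;> rfl

theorem PBlock.matA'_map {κ R S : Type*} [CommRing R] [CommRing S] (c : κ → R) (f : R →+* S)
    (b : PBlock κ) : (b.matA' c).map f = b.matA' (f ∘ c) := by
  ext i j
  exact (PBlock.entA_map f (b.map c) i.val j.val).symm.trans
    (congrArg (fun b' : PBlock S => b'.entA i.val j.val) (b.map_map c f))

theorem PBlock.matB'_map {κ R S : Type*} [CommRing R] [CommRing S] (c : κ → R) (f : R →+* S)
    (b : PBlock κ) : (b.matB' c).map f = b.matB' (f ∘ c) := by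
  ext i j
  exact (PBlock.entB_map f (b.map c) i.val j.val).symm.trans
    (congrArg (fun b' : PBlock S => b'.entB i.val j.val) (b.map_map c f))

variable {R : Type*} [CommRing R] {m n : Type*} [Fintype m] [Fintype n]
  [DecidableEq m] [DecidableEq n] {ι κ : Type*} [Fintype ι] [DecidableEq ι]

theorem isKCF_map_iff (β : ι → PBlock κ) (c : κ → R) (A B : Matrix m n R) :
    IsKCF (fun i => (β i).map c) A B ↔
      MEquiv A B (blockDiagonal' fun i => (β i).matA' c) (blockDiagonal' fun i => (β i).matB' c) := by
  have h : MEquiv (blockDiagonal' fun i => (β i).matA' c) (blockDiagonal' fun i => (β i).matB' c)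
      (blockDiagonal' fun i => ((β i).map c).matA) (blockDiagonal' fun i => ((β i).map c).matB) :=
    MEquiv.blockDiagonal' fun i => MEquiv.of_reindex (finCongr ((β i).rows_map c))
      (finCongr ((β i).cols_map c)) (fun _ _ => rfl) fun _ _ => rfl
  exact ⟨fun h' => h'.trans h.symm, fun h' => h'.trans h⟩

/-- Labelling the eigenvalues separates the pattern of coincidences, which survives specialisation,
from their values, which vary. -/
theorem exists_symbolic_blocks {K : Type} [Zero K] (b : ι → PBlock K) :
    ∃ (κ : Type) (_ : Finite κ) (c : κ → K) (β : ι → PBlock κ), Function.Injective c ∧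
      b = fun i => (β i).map c := by
  -- The value `0` for blocks without a finite eigenvalue is a dummy; at worst it adds an unused
  -- label.
  let eig : ι → K := fun i => match b i with
    | .jfin c _ => c
    | _ => 0
  refine ⟨Set.range eig, inferInstance, Subtype.val,
    fun i => (b i).map fun _ => ⟨eig i, i, rfl⟩, Subtype.val_injective, ?_⟩
  funext i
  rw [PBlock.map_map]
  change b i = (b i).map fun _ => eig i
  cases h : b i with
  | jfin c n => simp only [PBlock.map, eig, h]
  | _ => rfl

theorem exists_matrix_map_eq {L K p q : Type*} {i : L → K} (M : Matrix p q K)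
    (h : ∀ x y, ∃ z, i z = M x y) : ∃ N : Matrix p q L, N.map i = M := by
  choose N hN using h
  exact ⟨Matrix.of N, by ext x y; exact hN x y⟩

/-- The specialisations of a pencil over a domain at all points outside a hypersurface have
Kronecker canonical forms of the same type. -/
theorem exists_generic_isKCF {k : Type} [Field k] [IsAlgClosed k] {R : Type} [CommRing R]
    [IsDomain R] [Algebra k R] {m n : ℕ} (A B : Matrix (Fin m) (Fin n) R) :
    ∃ (g : R) (ι κ : Type) (_ : Fintype ι) (_ : DecidableEq ι) (_ : Finite κ) (β : ι → PBlock κ),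
      g ≠ 0 ∧ ∀ φ : R →ₐ[k] k, φ g ≠ 0 → ∃ c : κ → k, Function.Injective c ∧
        IsKCF (fun i => (β i).map c) (A.map φ) (B.map φ) := by
  classical
  let K := AlgebraicClosure (FractionRing R)
  have hinj : FaithfulSMul R K := FaithfulSMul.trans R (FractionRing R) K
  have halg : Algebra.IsAlgebraic R K :=
    (IsFractionRing.comap_isAlgebraic_iff (K := FractionRing R)).mpr inferInstance
  obtain ⟨ι, _, _, b, hb⟩ := hasKCF (K := K) _ m n rfl (A.map (algebraMap R K))
    (B.map (algebraMap R K))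
  obtain ⟨κ, _, c, β, hc, rfl⟩ := exists_symbolic_blocks b
  have := Fintype.ofFinite κ
  rw [isKCF_map_iff] at hb
  obtain ⟨P, P', Q, Q', h1, h2, h3, h4, h5, h6⟩ := hb
  -- The inverses of the eigenvalue differences are included so that distinct eigenvalues stay
  -- distinct after specialisation.
  let F : Finset K := Finset.univ.image (fun x : _ × _ => P x.1 x.2) ∪
    Finset.univ.image (fun x : _ × _ => P' x.1 x.2) ∪
    Finset.univ.image (fun x : _ × _ => Q x.1 x.2) ∪
    Finset.univ.image (fun x : _ × _ => Q' x.1 x.2) ∪ Finset.univ.image c ∪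
    Finset.univ.image (fun x : κ × κ => (c x.1 - c x.2)⁻¹)
  obtain ⟨g, hg, hspec⟩ := exists_specialization (R := R) (K := K) (k := k) F
  refine ⟨g, ι, κ, inferInstance, inferInstance, inferInstance, β, hg, fun φ hφ => ?_⟩
  obtain ⟨L, _, j, i, ψ, hi, hij, hψ, hF⟩ := hspec φ hφ
  obtain ⟨P₁, rfl⟩ := exists_matrix_map_eq P fun x y => hF _ (by
    simp only [F, Finset.mem_union, Finset.mem_image]
    exact Or.inl (Or.inl (Or.inl (Or.inl (Or.inl ⟨(x, y), Finset.mem_univ _, rfl⟩)))))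
  obtain ⟨P₂, rfl⟩ := exists_matrix_map_eq P' fun x y => hF _ (by
    simp only [F, Finset.mem_union, Finset.mem_image]
    exact Or.inl (Or.inl (Or.inl (Or.inl (Or.inr ⟨(x, y), Finset.mem_univ _, rfl⟩)))))
  obtain ⟨Q₁, rfl⟩ := exists_matrix_map_eq Q fun x y => hF _ (by
    simp only [F, Finset.mem_union, Finset.mem_image]
    exact Or.inl (Or.inl (Or.inl (Or.inr ⟨(x, y), Finset.mem_univ _, rfl⟩))))
  obtain ⟨Q₂, rfl⟩ := exists_matrix_map_eq Q' fun x y => hF _ (by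
    simp only [F, Finset.mem_union, Finset.mem_image]
    exact Or.inl (Or.inl (Or.inr ⟨(x, y), Finset.mem_univ _, rfl⟩)))
  have hc₁ : ∀ x, ∃ y, i y = c x := fun x => hF _ (by
    simp only [F, Finset.mem_union, Finset.mem_image]
    exact Or.inl (Or.inr ⟨x, Finset.mem_univ _, rfl⟩))
  have hd₁ : ∀ x y, ∃ z, i z = (c x - c y)⁻¹ := fun x y => hF _ (by
    simp only [F, Finset.mem_union, Finset.mem_image]
    exact Or.inr ⟨(x, y), Finset.mem_univ _, rfl⟩)
  choose c₁ hc₁ using hc₁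
  obtain rfl : i ∘ c₁ = c := funext hc₁
  have hA : ∀ M : Matrix (Fin m) (Fin n) R, (M.map j).map i = M.map (algebraMap R K) := by
    intro M
    ext x y
    exact hij _
  have hA' : ∀ M : Matrix (Fin m) (Fin n) R, (M.map j).map ψ = M.map φ := by
    intro M
    ext x y
    exact hψ _
  -- The identities of the strict equivalence hold in `L` because they hold after the injection `i`;
  -- they can then be pushed forward along `ψ`.
  have key : MEquiv (A.map j) (B.map j) (blockDiagonal' fun x => (β x).matA' c₁)
      (blockDiagonal' fun x => (β x).matB' c₁) := by
    refine ⟨P₁, P₂, Q₁, Q₂, ?_, ?_, ?_, ?_, ?_, ?_⟩ <;>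
      (apply Matrix.map_injective hi; beta_reduce)
    · rw [Matrix.map_mul, h1, Matrix.map_one i (map_zero i) (map_one i)]
    · rw [Matrix.map_mul, h2, Matrix.map_one i (map_zero i) (map_one i)]
    · rw [Matrix.map_mul, h3, Matrix.map_one i (map_zero i) (map_one i)]
    · rw [Matrix.map_mul, h4, Matrix.map_one i (map_zero i) (map_one i)]
    · rw [Matrix.map_mul, Matrix.map_mul, hA, h5, Matrix.blockDiagonal'_map _ _ (map_zero i)]
      simp only [PBlock.matA'_map]
    · rw [Matrix.map_mul, Matrix.map_mul, hA, h6, Matrix.blockDiagonal'_map _ _ (map_zero i)]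
      simp only [PBlock.matB'_map]
  have key' := key.map ψ
  rw [hA', hA', Matrix.blockDiagonal'_map _ _ (map_zero ψ),
    Matrix.blockDiagonal'_map _ _ (map_zero ψ)] at key'
  simp only [PBlock.matA'_map, PBlock.matB'_map] at key'
  refine ⟨ψ ∘ c₁, fun x y hxy => ?_, (isKCF_map_iff _ _ _ _).mpr key'⟩
  -- The difference of two labelled eigenvalues is a unit of `L`, so its image under `ψ` is nonzero.
  by_contra hne
  obtain ⟨z, hz⟩ := hd₁ x y
  have h7 : i ((c₁ x - c₁ y) * z) = 1 := by
    rw [map_mul, hz, map_sub]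
    exact mul_inv_cancel₀ (sub_ne_zero.mpr (hc.ne hne))
  have h8 : (c₁ x - c₁ y) * z = 1 := hi (h7.trans (map_one i).symm)
  have h9 := congrArg ψ h8
  rw [map_mul, map_sub, show ψ (c₁ x) = ψ (c₁ y) from hxy, sub_self, zero_mul, map_one] at h9
  exact zero_ne_one h9

end Generic

end Kronecker

namespace Kronecker

open Matrix MvPolynomial

/-! ### Semicontinuity of rank and nonvanishing of minors -/

section RankLemmas

variable {K : Type*} [Field K]

theorem exists_mul_mul_eq_one {p q : Type*} [Fintype p] [Fintype q] [DecidableEq p]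
    [DecidableEq q] (M : Matrix p q K) :
    ∃ (X : Matrix (Fin M.rank) p K) (Y : Matrix q (Fin M.rank) K), X * M * Y = 1 := by
  obtain ⟨P, Q, X, Y, h1, h2, h3⟩ := exists_rank_factorization M
  refine ⟨X, Y, ?_⟩
  calc X * M * Y = X * (P * Q) * Y := by rw [← h1]
    _ = (X * P) * (Q * Y) := by simp only [Matrix.mul_assoc]
    _ = 1 := by rw [h2, h3, Matrix.one_mul]

theorem exists_minor_ne_zero {p q : Type*} [Fintype p] [Fintype q] [DecidableEq p]
    [DecidableEq q] {r : ℕ} (M : Matrix p q K) (hr : M.rank = r) :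
    ∃ (f : Fin r ↪ p) (g : Fin r ↪ q), (M.submatrix f g).det ≠ 0 := by
  subst hr
  obtain ⟨X, Y, h⟩ := exists_mul_mul_eq_one M
  by_contra! hcon
  -- If all minors vanished, `0` would divide `det (X M Y) = 1`.
  have h1 := dvd_det_mul_mul M X Y (q := 0) fun f g => (hcon f g).symm ▸ dvd_rfl
  rw [h, Matrix.det_one, zero_dvd_iff] at h1
  exact one_ne_zero h1

/-- The rank of a matrix of polynomials is lower semicontinuous. -/
theorem exists_rank_le_rank {σ p q : Type*} [Fintype p] [Fintype q] [DecidableEq p]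
    [DecidableEq q] (M : Matrix p q (MvPolynomial σ K)) (e₀ : σ → K) :
    ∃ f : MvPolynomial σ K, eval e₀ f ≠ 0 ∧
      ∀ e, eval e f ≠ 0 → (M.map (eval e₀)).rank ≤ (M.map (eval e)).rank := by
  obtain ⟨X, Y, h⟩ := exists_mul_mul_eq_one (M.map (eval e₀))
  let X' : Matrix _ _ (MvPolynomial σ K) := X.map (C : K →+* MvPolynomial σ K)
  let Y' : Matrix _ _ (MvPolynomial σ K) := Y.map (C : K →+* MvPolynomial σ K)
  have hX : ∀ e : σ → K, X'.map (eval e) = X := fun e => by ext i j; simp [X']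
  have hY : ∀ e : σ → K, Y'.map (eval e) = Y := fun e => by ext i j; simp [Y']
  have key : ∀ e, eval e (X' * M * Y').det = (X * M.map (eval e) * Y).det := by
    intro e
    rw [RingHom.map_det, RingHom.mapMatrix_apply, Matrix.map_mul, Matrix.map_mul, hX, hY]
  refine ⟨(X' * M * Y').det, ?_, fun e he => ?_⟩
  · rw [key, h, Matrix.det_one]
    exact one_ne_zero
  · rw [key] at he
    have h1 := Matrix.rank_of_det_ne_zero he
    rw [Fintype.card_fin] at h1
    rw [← h1]
    exact (Matrix.rank_mul_le_left _ _).trans (Matrix.rank_mul_le_right _ _)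

theorem exists_eval_ne_zero [Infinite K] {σ : Type*} {f : MvPolynomial σ K} (hf : f ≠ 0) :
    ∃ e, eval e f ≠ 0 := by
  by_contra! h
  exact hf (MvPolynomial.funext fun e => by rw [h, map_zero])

end RankLemmas

/-! ### Zeros of factors of linear forms and degrees under substitution -/

section LinearRoots

variable {K : Type*} [Field K]

/-- A nonunit factor of a nonzero polynomial of degree at most one has a constant cofactor. -/
theorem eval_eq_zero_of_dvd {σ : Type*} {π l : MvPolynomial σ K} {e : σ → K} (hπ : ¬ IsUnit π)
    (hl : l ≠ 0) (hdeg : l.totalDegree ≤ 1) (h : π ∣ l) (he : eval e l = 0) : eval e π = 0 := by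
  obtain ⟨u, rfl⟩ := h
  have hπ0 : π ≠ 0 := left_ne_zero_of_mul hl
  have hu0 : u ≠ 0 := right_ne_zero_of_mul hl
  rw [totalDegree_mul_of_isDomain hπ0 hu0] at hdeg
  have h1 : π.totalDegree ≠ 0 := by
    intro h1
    rw [totalDegree_eq_zero_iff_eq_C] at h1
    refine hπ (h1 ▸ ((Ne.isUnit fun h2 => hπ0 ?_).map C))
    rw [h1, h2, map_zero]
  have h2 : u.totalDegree = 0 := by omega
  rw [totalDegree_eq_zero_iff_eq_C] at h2
  rw [map_mul] at he
  refine (mul_eq_zero.mp he).resolve_right fun h3 => hu0 ?_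
  rw [h2, eval_C] at h3
  rw [h2, h3, map_zero]

/-- Finite eigenvalues give zeros at points `(t, 1)` of the affine line, and the eigenvalue `∞` a
zero at the point at infinity `(1, 0)`. -/
theorem exists_eval_eq_zero_of_dvd_lin [Infinite K] {π : MvPolynomial (Fin 2) K} (hπ : Prime π)
    {b : PBlock K} (h : π ∣ b.lin) : (∃ t, eval ![t, 1] π = 0) ∨ eval ![1, 0] π = 0 := by
  cases b with
  | jfin c n =>
    left
    have h1 : π ∣ X 1 * C c + X 0 := hπ.dvd_of_dvd_pow (n := n + 1) h
    have h2 : (X 1 * C c + X 0 : MvPolynomial (Fin 2) K).IsHomogeneous 1 :=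
      ((isHomogeneous_X K 1).mul (isHomogeneous_C (Fin 2) c)).add (isHomogeneous_X K 0)
    refine ⟨-c, eval_eq_zero_of_dvd hπ.not_isUnit (fun h3 => ?_) h2.totalDegree_le h1 (by simp)⟩
    have := congrArg (eval ![1, 0]) h3
    simp at this
  | jinf n =>
    right
    have h1 : π ∣ X 1 := hπ.dvd_of_dvd_pow (n := n + 1) h
    exact eval_eq_zero_of_dvd hπ.not_isUnit (X_ne_zero _)
      (isHomogeneous_X K (1 : Fin 2)).totalDegree_le h1 (by simp)
  | hor ε => exact absurd (isUnit_of_dvd_one h) hπ.not_isUnit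
  | vert η => exact absurd (isUnit_of_dvd_one h) hπ.not_isUnit

theorem det_isHomogeneous {σ : Type*} {r : ℕ} (M : Matrix (Fin r) (Fin r) (MvPolynomial σ K))
    (h : ∀ i j, (M i j).IsHomogeneous 1) : M.det.IsHomogeneous r := by
  rw [Matrix.det_apply]
  refine IsHomogeneous.sum _ _ _ fun τ _ => ?_
  have h1 : (∏ i, M (τ i) i).IsHomogeneous (∑ _i : Fin r, 1) :=
    IsHomogeneous.prod _ _ _ fun i _ => h _ _
  rw [Finset.sum_const, Finset.card_univ, Fintype.card_fin, smul_eq_mul, mul_one] at h1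
  rcases Int.units_eq_one_or (Equiv.Perm.sign τ) with h2 | h2 <;> rw [h2]
  · simpa using h1
  · simpa using h1.neg

theorem totalDegree_aeval_le {σ τ : Type*} (g : σ → MvPolynomial τ K)
    (hg : ∀ i, (g i).totalDegree ≤ 1) (f : MvPolynomial σ K) :
    (aeval g f).totalDegree ≤ f.totalDegree := by
  rw [aeval_def, eval₂_eq]
  refine totalDegree_finsetSum_le fun d hd => ?_
  refine (totalDegree_mul _ _).trans ?_
  rw [algebraMap_eq, totalDegree_C, zero_add]
  refine (totalDegree_finsetProd _ _).trans (le_trans ?_ (le_totalDegree hd))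
  refine Finset.sum_le_sum fun i _ => (totalDegree_pow _ _).trans ?_
  exact (Nat.mul_le_mul_left _ (hg i)).trans (mul_one _).le

end LinearRoots

section MinorGcd

theorem minorGcd_dvd {σ : Type*} {m n : ℕ} (M : Matrix (Fin m) (Fin n) (MvPolynomial σ ℂ)) (r : ℕ)
    (s : (Fin r ↪ Fin m) × (Fin r ↪ Fin n)) : JK.minorGcd M r ∣ JK.minor M r s :=
  letI : NormalizedGCDMonoid (MvPolynomial σ ℂ) := Classical.arbitrary _
  Finset.gcd_dvd (Finset.mem_univ s)

theorem dvd_minorGcd {σ : Type*} {m n : ℕ} {M : Matrix (Fin m) (Fin n) (MvPolynomial σ ℂ)} {r : ℕ}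
    {q : MvPolynomial σ ℂ} (h : ∀ s, q ∣ JK.minor M r s) : q ∣ JK.minorGcd M r :=
  letI : NormalizedGCDMonoid (MvPolynomial σ ℂ) := Classical.arbitrary _
  Finset.dvd_gcd fun s _ => h s

end MinorGcd

/-! ### Linear families of maps and restriction to a line -/

section LinMatrix

variable {U V E : Type*} [AddCommGroup U] [Module ℂ U] [FiniteDimensional ℂ U]
  [AddCommGroup V] [Module ℂ V] [FiniteDimensional ℂ V]
  [AddCommGroup E] [Module ℂ E] [FiniteDimensional ℂ E]

/-- The matrix of linear forms of a linear family of linear maps. -/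
noncomputable def linMatrix (T : E →ₗ[ℂ] U →ₗ[ℂ] V) :
    Matrix (Fin (Module.finrank ℂ V)) (Fin (Module.finrank ℂ U))
      (MvPolynomial (Fin (Module.finrank ℂ E)) ℂ) :=
  Matrix.of fun i j => ∑ k, C (JK.mat (T (Module.finBasis ℂ E k)) i j) * X k

theorem linMatrix_isHomogeneous (T : E →ₗ[ℂ] U →ₗ[ℂ] V) (i j) :
    (linMatrix T i j).IsHomogeneous 1 := by
  rw [linMatrix, Matrix.of_apply]
  exact IsHomogeneous.sum _ _ _ fun k _ => isHomogeneous_C_mul_X _ _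

theorem sum_coord_mul_mat (T : E →ₗ[ℂ] U →ₗ[ℂ] V) (x : E) (i j) :
    ∑ k, JK.mat (T (Module.finBasis ℂ E k)) i j * (Module.finBasis ℂ E).equivFun x k =
      JK.mat (T x) i j := by
  conv_rhs => rw [← (Module.finBasis ℂ E).sum_equivFun x]
  simp only [JK.mat, map_sum, map_smul, Matrix.sum_apply, Matrix.smul_apply, smul_eq_mul]
  exact Finset.sum_congr rfl fun k _ => mul_comm _ _

theorem linMatrix_map_eval (T : E →ₗ[ℂ] U →ₗ[ℂ] V) (x : E) :
    (linMatrix T).map (eval ((Module.finBasis ℂ E).equivFun x)) = JK.mat (T x) := by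
  ext i j
  rw [← sum_coord_mul_mat]
  simp [linMatrix]

/-- The restriction of polynomials to the homogenised line through `x` in direction `a`. -/
noncomputable def lineMap (x a : E) :
    MvPolynomial (Fin (Module.finrank ℂ E)) ℂ →ₐ[ℂ] MvPolynomial (Fin 2) ℂ :=
  aeval fun k => X 1 * C ((Module.finBasis ℂ E).equivFun x k) +
    X 0 * C ((Module.finBasis ℂ E).equivFun a k)

theorem lineMap_isHomogeneous (x a : E) (k) :
    (X 1 * C ((Module.finBasis ℂ E).equivFun x k) +
      X 0 * C ((Module.finBasis ℂ E).equivFun a k) : MvPolynomial (Fin 2) ℂ).IsHomogeneous 1 :=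
  ((isHomogeneous_X ℂ 1).mul (isHomogeneous_C (Fin 2) _)).add
    ((isHomogeneous_X ℂ 0).mul (isHomogeneous_C (Fin 2) _))

theorem eval_lineMap (x a : E) (t s : ℂ) (f : MvPolynomial (Fin (Module.finrank ℂ E)) ℂ) :
    eval ![t, s] (lineMap x a f) =
      eval ((Module.finBasis ℂ E).equivFun (s • x + t • a)) f := by
  have h : (eval ![t, s]).comp (lineMap x a : _ →+* MvPolynomial (Fin 2) ℂ) =
      eval ((Module.finBasis ℂ E).equivFun (s • x + t • a)) := by
    refine MvPolynomial.ringHom_ext (fun c => ?_) fun k => ?_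
    · simp [lineMap]
    · simp [lineMap]
  exact RingHom.congr_fun h f

theorem linMatrix_map_lineMap (T : E →ₗ[ℂ] U →ₗ[ℂ] V) (x a : E) :
    (linMatrix T).map (lineMap x a) = pencilPoly (JK.mat (T x)) (JK.mat (T a)) := by
  ext1 i j
  rw [pencilPoly_apply, ← sum_coord_mul_mat T x, ← sum_coord_mul_mat T a, map_sum, map_sum,
    Finset.mul_sum, Finset.mul_sum, ← Finset.sum_add_distrib]
  simp only [linMatrix, Matrix.map_apply, Matrix.of_apply, map_sum, map_mul, lineMap, aeval_X,
    algHom_C, algebraMap_eq]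
  exact Finset.sum_congr rfl fun k _ => by ring

theorem minor_map_lineMap (T : E →ₗ[ℂ] U →ₗ[ℂ] V) (x a : E) (r : ℕ)
    (s : (Fin r ↪ Fin (Module.finrank ℂ V)) × (Fin r ↪ Fin (Module.finrank ℂ U))) :
    lineMap x a (JK.minor (linMatrix T) r s) =
      ((pencilPoly (JK.mat (T x)) (JK.mat (T a))).submatrix s.1 s.2).det := by
  rw [JK.minor, AlgHom.map_det, AlgHom.mapMatrix_apply, ← Matrix.submatrix_map,
    linMatrix_map_lineMap]

end LinMatrix

end Kronecker

namespace Kronecker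

open Matrix MvPolynomial

/-! ### Jordan part and Kronecker indices in a linear family -/

section Families

variable {U V E : Type*} [AddCommGroup U] [Module ℂ U] [FiniteDimensional ℂ U]
  [AddCommGroup V] [Module ℂ V] [FiniteDimensional ℂ V]
  [AddCommGroup E] [Module ℂ E] [FiniteDimensional ℂ E]
  {T : E →ₗ[ℂ] U →ₗ[ℂ] V} {r : ℕ} {x a : E}
  {ι : Type*} [Fintype ι] [DecidableEq ι] {b : ι → PBlock ℂ}

theorem mat_add_smul (T : E →ₗ[ℂ] U →ₗ[ℂ] V) (x a : E) (s t : ℂ) :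
    s • JK.mat (T x) + t • JK.mat (T a) = JK.mat (T (s • x + t • a)) := by
  simp only [JK.mat, map_add, map_smul]

/-- The maximal rank `r` of the family is already attained by the direction `T a`, which belongs to
the homogenised pencil. -/
theorem IsKCF.sum_rho_eq_of_rank (hr : ∀ y, (JK.mat (T y)).rank ≤ r)
    (ha : (JK.mat (T a)).rank = r) (h : IsKCF b (JK.mat (T x)) (JK.mat (T a))) :
    ∑ i, (b i).rho = r := by
  obtain ⟨t, ht⟩ := h.exists_rank_eq
  have h1 := h.rank_le 0 1
  have h2 := mat_add_smul T x a 1 t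
  rw [one_smul] at h2
  rw [zero_smul, zero_add, one_smul, ha] at h1
  rw [h2] at ht
  exact le_antisymm (ht ▸ hr _) h1

theorem IsKCF.lineMap_minorGcd_dvd (hρ : ∑ i, (b i).rho = r)
    (h : IsKCF b (JK.mat (T x)) (JK.mat (T a))) :
    lineMap x a (JK.minorGcd (linMatrix T) r) ∣ ∏ i, (b i).lin := by
  refine h.dvd_prod_lin hρ fun f g => ?_
  rw [← minor_map_lineMap T x a r (f, g)]
  exact map_dvd (lineMap x a) (minorGcd_dvd (linMatrix T) r (f, g))

theorem exists_eval_minor_ne_zero (ha : (JK.mat (T a)).rank = r) :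
    ∃ s, eval ((Module.finBasis ℂ E).equivFun a) (JK.minor (linMatrix T) r s) ≠ 0 := by
  obtain ⟨f, g, hfg⟩ := exists_minor_ne_zero _ ha
  refine ⟨(f, g), ?_⟩
  rwa [JK.minor, RingHom.map_det, RingHom.mapMatrix_apply, ← Matrix.submatrix_map,
    linMatrix_map_eval]

theorem lineMap_ne_zero {f : MvPolynomial (Fin (Module.finrank ℂ E)) ℂ}
    (h : eval ((Module.finBasis ℂ E).equivFun a) f ≠ 0) : lineMap x a f ≠ 0 := by
  intro h1
  have h2 := eval_lineMap x a 1 0 f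
  rw [h1, map_zero, zero_smul, zero_add, one_smul] at h2
  exact h h2.symm

/-- Some minor does not vanish at `a`, so it and its restriction are nonzero homogeneous polynomials
of the same degree `r`. Substituting linear forms raises the degree of neither the gcd nor its
cofactor, and the degrees add up to `r` on both sides. -/
theorem totalDegree_lineMap_minorGcd (x : E) (ha : (JK.mat (T a)).rank = r) :
    (lineMap x a (JK.minorGcd (linMatrix T) r)).totalDegree =
      (JK.minorGcd (linMatrix T) r).totalDegree := by
  obtain ⟨s, hs⟩ := exists_eval_minor_ne_zero ha
  have h1 : lineMap x a (JK.minor (linMatrix T) r s) ≠ 0 := lineMap_ne_zero hs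
  have h2 : JK.minor (linMatrix T) r s ≠ 0 := fun h => hs (by rw [h, map_zero])
  have h3 : (JK.minor (linMatrix T) r s).IsHomogeneous r :=
    det_isHomogeneous _ fun i j => linMatrix_isHomogeneous T _ _
  have h4 : (lineMap x a (JK.minor (linMatrix T) r s)).IsHomogeneous (1 * r) :=
    h3.aeval _ (lineMap_isHomogeneous x a)
  have hle : ∀ f, (lineMap x a f).totalDegree ≤ f.totalDegree :=
    totalDegree_aeval_le _ fun k => (lineMap_isHomogeneous x a k).totalDegree_le
  obtain ⟨q, hq⟩ := minorGcd_dvd (linMatrix T) r s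
  have h5 := h4.totalDegree h1
  have h6 := h3.totalDegree h2
  rw [hq] at h1 h2 h5 h6
  rw [map_mul] at h1 h5
  rw [totalDegree_mul_of_isDomain (left_ne_zero_of_mul h1) (right_ne_zero_of_mul h1)] at h5
  rw [totalDegree_mul_of_isDomain (left_ne_zero_of_mul h2) (right_ne_zero_of_mul h2)] at h6
  have h7 := hle (JK.minorGcd (linMatrix T) r)
  have h8 := hle q
  omega

theorem prod_lin_ne_zero (b : ι → PBlock ℂ) : ∏ i, (b i).lin ≠ 0 :=
  Finset.prod_ne_zero_iff.mpr fun i _ => (b i).lin_ne_zero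

/-- For regular directions, the degree of the Jordan part is at least the degree of the greatest
common divisor of the minors of the family. -/
theorem IsKCF.totalDegree_le_sum_jordanSize (hρ : ∑ i, (b i).rho = r)
    (ha : (JK.mat (T a)).rank = r) (h : IsKCF b (JK.mat (T x)) (JK.mat (T a))) :
    (JK.minorGcd (linMatrix T) r).totalDegree ≤ ∑ i, (b i).jordanSize := by
  rw [← totalDegree_prod_lin, ← totalDegree_lineMap_minorGcd x ha]
  exact totalDegree_le_of_dvd_of_isDomain (h.lineMap_minorGcd_dvd hρ) (prod_lin_ne_zero b)

/-- The quotient `q` of the Jordan determinant by the restricted gcd divides the restriction of each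
cofactor `h` of a minor. A nonunit `q` would thus give these cofactors a common zero on the line or
at infinity. -/
theorem IsKCF.sum_jordanSize_eq (hρ : ∑ i, (b i).rho = r) (ha : (JK.mat (T a)).rank = r)
    (hline : ∀ t : ℂ, ∃ s h, JK.minor (linMatrix T) r s ≠ 0 ∧
      JK.minor (linMatrix T) r s = JK.minorGcd (linMatrix T) r * h ∧
      eval ((Module.finBasis ℂ E).equivFun (x + t • a)) h ≠ 0)
    (h : IsKCF b (JK.mat (T x)) (JK.mat (T a))) :
    ∑ i, (b i).jordanSize = (JK.minorGcd (linMatrix T) r).totalDegree := by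
  obtain ⟨q, hq⟩ := h.lineMap_minorGcd_dvd hρ
  have hd := prod_lin_ne_zero b
  rw [hq] at hd
  have hp0 := left_ne_zero_of_mul hd
  have hdvd : ∀ s f, JK.minor (linMatrix T) r s = JK.minorGcd (linMatrix T) r * f →
      q ∣ lineMap x a f := by
    intro s f hf
    have h1 := h.prod_lin_dvd hρ s.1 s.2
    rw [← minor_map_lineMap, hf, map_mul, hq] at h1
    exact (mul_dvd_mul_iff_left hp0).mp h1
  have hunit : IsUnit q := by
    by_contra hu
    obtain ⟨π, hπ, hπq⟩ := WfDvdMonoid.exists_irreducible_factor hu (right_ne_zero_of_mul hd)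
    have hπd : π ∣ ∏ i, (b i).lin := hq ▸ hπq.mul_left _
    obtain ⟨i, -, hi⟩ := (hπ.prime.dvd_finsetProd_iff _).mp hπd
    -- A zero at `(t, 1)` contradicts `hline` at `x + t • a`; a zero at `(1, 0)` contradicts the
    -- existence of a minor nonzero at `a`.
    rcases exists_eval_eq_zero_of_dvd_lin hπ.prime hi with ⟨t, ht⟩ | h0
    · obtain ⟨s, f, -, hf, hne⟩ := hline t
      obtain ⟨u, hu⟩ := hπq.trans (hdvd s f hf)
      have h1 := eval_lineMap x a t 1 f
      rw [hu, map_mul, ht, zero_mul, one_smul] at h1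
      exact hne h1.symm
    · obtain ⟨s, hs⟩ := exists_eval_minor_ne_zero ha
      obtain ⟨f, hf⟩ := minorGcd_dvd (linMatrix T) r s
      obtain ⟨u, hu⟩ := hπq.trans (hdvd s f hf)
      have h1 := eval_lineMap x a 1 0 f
      rw [hu, map_mul, h0, zero_mul, zero_smul, zero_add, one_smul] at h1
      rw [hf, map_mul, ← h1, mul_zero] at hs
      exact hs rfl
  refine le_antisymm ?_ (h.totalDegree_le_sum_jordanSize hρ ha)
  rw [← totalDegree_prod_lin, ← totalDegree_lineMap_minorGcd x ha, hq]
  exact totalDegree_le_of_dvd_of_isDomain (hunit.mul_right_dvd.mpr dvd_rfl) hp0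

/-- The gcd of the maximal minors and the product of the Jordan determinants divide each other. -/
theorem IsKCF.totalDegree_charPoly {A B : U →ₗ[ℂ] V} (h : IsKCF b (JK.mat A) (JK.mat B)) :
    (JK.charPoly A B).totalDegree = ∑ i, (b i).jordanSize := by
  rw [← totalDegree_prod_lin, JK.charPoly, h.pencilRank_eq]
  have h1 : ∏ i, (b i).lin ∣ JK.minorGcd (JK.pencilMatrix A B) (∑ i, (b i).rho) :=
    dvd_minorGcd fun s => h.prod_lin_dvd rfl s.1 s.2
  have h2 : JK.minorGcd (JK.pencilMatrix A B) (∑ i, (b i).rho) ∣ ∏ i, (b i).lin :=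
    h.dvd_prod_lin rfl fun f g => minorGcd_dvd (JK.pencilMatrix A B) _ (f, g)
  have h3 := prod_lin_ne_zero b
  exact le_antisymm (totalDegree_le_of_dvd_of_isDomain h2 h3)
    (totalDegree_le_of_dvd_of_isDomain h1 (ne_zero_of_dvd_ne_zero h3 h2))

/-- The algebraic type of the pencils of a linear family is constant on a non-empty Zariski open
set of pairs of parameters. -/
theorem exists_generic_pair (T : E →ₗ[ℂ] U →ₗ[ℂ] V) :
    ∃ (W : Set (E × E)) (p : E × E) (S₀ : List JK.Block), JK.IsZariskiOpen W ∧ p ∈ W ∧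
      ∀ q ∈ W, ∃ S, JK.IsCanonicalForm (T q.1) (T q.2) S ∧ JK.SameType S S₀ := by
  obtain ⟨g, ι, κ, _, _, _, β, hg, hβ⟩ := exists_generic_isKCF (k := ℂ)
    (linMatrix (T ∘ₗ LinearMap.fst ℂ E E)) (linMatrix (T ∘ₗ LinearMap.snd ℂ E E))
  have key : ∀ q : E × E, eval ((Module.finBasis ℂ (E × E)).equivFun q) g ≠ 0 →
      ∃ c : κ → ℂ, Function.Injective c ∧
        IsKCF (fun i => (β i).map c) (JK.mat (T q.1)) (JK.mat (T q.2)) := by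
    intro q hq
    obtain ⟨c, hc, h⟩ := hβ (aeval ((Module.finBasis ℂ (E × E)).equivFun q)) hq
    refine ⟨c, hc, ?_⟩
    have h1 := linMatrix_map_eval (T ∘ₗ LinearMap.fst ℂ E E) q
    have h2 := linMatrix_map_eval (T ∘ₗ LinearMap.snd ℂ E E) q
    rw [LinearMap.comp_apply, LinearMap.fst_apply] at h1
    rw [LinearMap.comp_apply, LinearMap.snd_apply] at h2
    rw [← h1, ← h2]
    exact h
  obtain ⟨e, he⟩ := exists_eval_ne_zero hg
  obtain ⟨p, rfl⟩ := (Module.finBasis ℂ (E × E)).equivFun.surjective e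
  obtain ⟨c₀, hc₀, h₀⟩ := key p he
  refine ⟨{q | eval ((Module.finBasis ℂ (E × E)).equivFun q) g ≠ 0}, p,
    Finset.univ.toList.map fun i => toBlock ((β i).map c₀), ⟨{g}, by simp⟩, he, fun q hq => ?_⟩
  obtain ⟨c, hc, h⟩ := key q hq
  exact ⟨_, h.exists_isCanonicalForm, sameType_map β hc hc₀⟩

/-- An arbitrary point of `W` might have a non-regular second component, so the comparison point
must also avoid the hypersurfaces where the relevant ranks could fall below their values at `(x,
a)`. -/
theorem exists_regular_pair (T : E →ₗ[ℂ] U →ₗ[ℂ] V) (x a : E) {W : Set (E × E)}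
    (hW : JK.IsZariskiOpen W) {p : E × E} (hp : p ∈ W) (k l : ℕ) :
    ∃ q ∈ W, (JK.mat (T a)).rank ≤ (JK.mat (T q.2)).rank ∧
      (toeplitz k (JK.mat (T x)) (JK.mat (T a))).rank ≤
        (toeplitz k (JK.mat (T q.1)) (JK.mat (T q.2))).rank ∧
      (toeplitz l (JK.mat (T x))ᵀ (JK.mat (T a))ᵀ).rank ≤
        (toeplitz l (JK.mat (T q.1))ᵀ (JK.mat (T q.2))ᵀ).rank := by
  obtain ⟨P, rfl⟩ := hW
  obtain ⟨f, hfP, hf⟩ := hp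
  let A := linMatrix (T ∘ₗ LinearMap.fst ℂ E E)
  let B := linMatrix (T ∘ₗ LinearMap.snd ℂ E E)
  have hA : ∀ q, A.map (eval ((Module.finBasis ℂ (E × E)).equivFun q)) = JK.mat (T q.1) :=
    linMatrix_map_eval (T ∘ₗ LinearMap.fst ℂ E E)
  have hB : ∀ q, B.map (eval ((Module.finBasis ℂ (E × E)).equivFun q)) = JK.mat (T q.2) :=
    linMatrix_map_eval (T ∘ₗ LinearMap.snd ℂ E E)
  let e₀ := (Module.finBasis ℂ (E × E)).equivFun (x, a)
  obtain ⟨f₁, h₁, h₁'⟩ := exists_rank_le_rank B e₀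
  obtain ⟨f₂, h₂, h₂'⟩ := exists_rank_le_rank (toeplitz k A B) e₀
  obtain ⟨f₃, h₃, h₃'⟩ := exists_rank_le_rank (toeplitz l Aᵀ Bᵀ) e₀
  have hne : ∀ {e : Fin (Module.finrank ℂ (E × E)) → ℂ}
      {g : MvPolynomial (Fin (Module.finrank ℂ (E × E))) ℂ}, eval e g ≠ 0 → g ≠ 0 := by
    rintro e g hg rfl
    exact hg (map_zero _)
  -- A product of nonzero polynomials is nonzero, so all the open conditions can be met at once.
  obtain ⟨e, he⟩ := exists_eval_ne_zero
    (mul_ne_zero (mul_ne_zero (hne hf) (hne h₁)) (mul_ne_zero (hne h₂) (hne h₃)))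
  obtain ⟨q, rfl⟩ := (Module.finBasis ℂ (E × E)).equivFun.surjective e
  simp only [map_mul, mul_ne_zero_iff] at he
  have h₁'' := h₁' _ he.1.2
  have h₂'' := h₂' _ he.2.1
  have h₃'' := h₃' _ he.2.2
  rw [hB, hB] at h₁''
  rw [toeplitz_map, toeplitz_map, hA, hB, hA, hB] at h₂''
  rw [toeplitz_map, toeplitz_map, Matrix.transpose_map, Matrix.transpose_map,
    Matrix.transpose_map, Matrix.transpose_map, hA, hB, hA, hB] at h₃''
  exact ⟨q, ⟨f, hfP, he.1.1⟩, h₁'', h₂'', h₃''⟩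

theorem kHor_eq_of_sameType {A B A' B' : U →ₗ[ℂ] V} {S S' S₀ : List JK.Block}
    (h : JK.IsCanonicalForm A B S) (h' : JK.IsCanonicalForm A' B' S') (hS : JK.SameType S S₀)
    (hS' : JK.SameType S' S₀) :
    JK.kHor A B = JK.kHor A' B' ∧ JK.kVert A B = JK.kVert A' B' := by
  rw [isCanonicalForm_iff_isKCF] at h h'
  rw [h.kHor_eq, h'.kHor_eq, h.kVert_eq, h'.kVert_eq]
  simp only [ofBlock_horCols, ofBlock_vertRows]
  rw [← sum_map_eq_sum_get, ← sum_map_eq_sum_get, ← sum_map_eq_sum_get, ← sum_map_eq_sum_get]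
  have h1 : ∀ σ b, (JK.Block.renameEigenvalue σ b).horCols = b.horCols := fun σ b => by
    cases b <;> rfl
  have h2 : ∀ σ b, (JK.Block.renameEigenvalue σ b).vertRows = b.vertRows := fun σ b => by
    cases b <;> rfl
  exact ⟨(SameType.sum_eq hS h1).trans (SameType.sum_eq hS' h1).symm,
    (SameType.sum_eq hS h2).trans (SameType.sum_eq hS' h2).symm⟩

/-- The Kronecker indices at a pair whose line avoids the singular set are the generic ones. -/
theorem indices_eq_of_generic (hr : ∀ y, (JK.mat (T y)).rank ≤ r) (ha : (JK.mat (T a)).rank = r)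
    (hline : ∀ t : ℂ, ∃ s h, JK.minor (linMatrix T) r s ≠ 0 ∧
      JK.minor (linMatrix T) r s = JK.minorGcd (linMatrix T) r * h ∧
      eval ((Module.finBasis ℂ E).equivFun (x + t • a)) h ≠ 0)
    {W : Set (E × E)} (hW : JK.IsZariskiOpen W) {p : E × E} (hp : p ∈ W) {S₀ : List JK.Block}
    (hS : ∀ q ∈ W, ∃ S, JK.IsCanonicalForm (T q.1) (T q.2) S ∧ JK.SameType S S₀) :
    JK.kHor (T x) (T a) = JK.kHor (T p.1) (T p.2) ∧
      JK.kVert (T x) (T a) = JK.kVert (T p.1) (T p.2) := by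
  -- The comparison is made with a regular `q ∈ W` instead of `p`; the constancy of the type on `W`
  -- transfers the result to `p`.
  obtain ⟨q, hq, h1, h2, h3⟩ := exists_regular_pair T x a hW hp (Module.finrank ℂ U)
    (Module.finrank ℂ V)
  obtain ⟨ι, _, _, b, hb⟩ := exists_isKCF_mat (T x) (T a)
  obtain ⟨κ, _, _, c, hc⟩ := exists_isKCF_mat (T q.1) (T q.2)
  have hqa : (JK.mat (T q.2)).rank = r := le_antisymm (hr _) (ha ▸ h1)
  have hbρ := hb.sum_rho_eq_of_rank hr ha
  have hcρ := hc.sum_rho_eq_of_rank hr hqa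
  have hbJ := hb.sum_jordanSize_eq hbρ ha hline
  have hcJ := hc.totalDegree_le_sum_jordanSize hcρ hqa
  have hb1 := hb.rank_toeplitz (Module.finrank ℂ U) (by simp)
  have hc1 := hc.rank_toeplitz (Module.finrank ℂ U) (by simp)
  have hb2 := hb.rank_toeplitz_transpose (Module.finrank ℂ V) (by simp)
  have hc2 := hc.rank_toeplitz_transpose (Module.finrank ℂ V) (by simp)
  have hb3 := hb.sum_sizes
  have hc3 := hc.sum_sizes
  rw [hbρ] at hb1 hb2 hb3
  rw [hcρ] at hc1 hc2 hc3
  obtain ⟨S, hS1, hS2⟩ := hS p hp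
  obtain ⟨S', hS1', hS2'⟩ := hS q hq
  obtain ⟨h4, h5⟩ := kHor_eq_of_sameType hS1 hS1' hS2 hS2'
  rw [h4, h5, hb.kHor_eq, hb.kVert_eq, hc.kHor_eq, hc.kVert_eq]
  -- The Toeplitz ranks bound both indices at `(x, a)` by those at `q`, and the Jordan size at `(x,
  -- a)` is at most that at `q`. The three quantities have the same total at both pairs, so all
  -- inequalities are equalities.
  omega

end Families

/-! ### The family of operators of a representation -/

section Representation

variable {𝔤 V : Type*} [LieRing 𝔤] [LieAlgebra ℂ 𝔤] [FiniteDimensional ℂ 𝔤]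
  [AddCommGroup V] [Module ℂ V] [FiniteDimensional ℂ V] [LieRingModule 𝔤 V] [LieModule ℂ 𝔤 V]

variable (𝔤 V) in
/-- The operators `R_x` as a linear family. -/
noncomputable def RFamily : V →ₗ[ℂ] 𝔤 →ₗ[ℂ] V where
  toFun := JK.R 𝔤
  map_add' x y := LinearMap.ext fun ξ => lie_add ξ x y
  map_smul' c x := LinearMap.ext fun ξ => lie_smul c ξ x

theorem RFamily_apply (x : V) : RFamily 𝔤 V x = JK.R 𝔤 x := rfl

theorem linMatrix_RFamily : linMatrix (RFamily 𝔤 V) = JK.genericMatrix 𝔤 V := rfl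

theorem bddAbove_rank : BddAbove (Set.range fun x : V =>
    Module.finrank ℂ (LinearMap.range (JK.R 𝔤 x))) :=
  ⟨Module.finrank ℂ V, Set.forall_mem_range.mpr fun _ => Submodule.finrank_le _⟩

theorem rank_mat_le (x : V) : (JK.mat (JK.R 𝔤 x)).rank ≤ JK.dimOrbReg 𝔤 V := by
  rw [← finrank_range_eq_rank_mat]
  exact le_ciSup bddAbove_rank x

theorem rank_mat_eq_of_isRegular {a : V} (ha : JK.IsRegular 𝔤 a) :
    (JK.mat (JK.R 𝔤 a)).rank = JK.dimOrbReg 𝔤 V := by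
  refine le_antisymm (rank_mat_le a) (ciSup_le fun x => ?_)
  rw [← finrank_range_eq_rank_mat]
  have h1 := LinearMap.finrank_range_add_finrank_ker (JK.R 𝔤 a)
  have h2 := LinearMap.finrank_range_add_finrank_ker (JK.R 𝔤 x)
  have h3 := ha x
  omega

end Representation

end Kronecker

theorem mainTheorem4 {𝔤 V : Type*} [LieRing 𝔤] [LieAlgebra ℂ 𝔤] [FiniteDimensional ℂ 𝔤]
    [AddCommGroup V] [Module ℂ V] [FiniteDimensional ℂ V]
    [LieRingModule 𝔤 V] [LieModule ℂ 𝔤 V]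
    (x a : V) (ha : JK.IsRegular 𝔤 a) (hline : ∀ t : ℂ, x + t • a ∉ JK.Sing₁ 𝔤 V) :
    JK.kHor (JK.R 𝔤 x) (JK.R 𝔤 a) = JK.kHorRep 𝔤 V ∧
    JK.kVert (JK.R 𝔤 x) (JK.R 𝔤 a) = JK.kVertRep 𝔤 V ∧
    (JK.charPoly (JK.R 𝔤 x) (JK.R 𝔤 a)).totalDegree =
      (JK.fundSemiInvariant 𝔤 V).totalDegree := by
  have hr : ∀ y, (JK.mat (Kronecker.RFamily 𝔤 V y)).rank ≤ JK.dimOrbReg 𝔤 V := by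
    intro y
    rw [Kronecker.RFamily_apply]
    exact Kronecker.rank_mat_le y
  have har : (JK.mat (Kronecker.RFamily 𝔤 V a)).rank = JK.dimOrbReg 𝔤 V := by
    rw [Kronecker.RFamily_apply]
    exact Kronecker.rank_mat_eq_of_isRegular ha
  have hline' : ∀ t : ℂ, ∃ s h,
      JK.minor (Kronecker.linMatrix (Kronecker.RFamily 𝔤 V)) (JK.dimOrbReg 𝔤 V) s ≠ 0 ∧
      JK.minor (Kronecker.linMatrix (Kronecker.RFamily 𝔤 V)) (JK.dimOrbReg 𝔤 V) s =
        JK.minorGcd (Kronecker.linMatrix (Kronecker.RFamily 𝔤 V)) (JK.dimOrbReg 𝔤 V) * h ∧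
      MvPolynomial.eval ((Module.finBasis ℂ V).equivFun (x + t • a)) h ≠ 0 := by
    intro t
    have h1 := hline t
    simp only [JK.Sing₁, Set.mem_ofPred_eq, not_forall] at h1
    obtain ⟨s, hs, h, hh, hne⟩ := h1
    rw [Kronecker.linMatrix_RFamily]
    exact ⟨s, h, hs, hh, hne⟩
  -- The comparison holds with every generic pair, for any open set witnessing genericity; thus the
  -- sets defining the generic indices have at most one element.
  have hgen : ∀ y c : V, JK.IsGenericPair 𝔤 y c →
      JK.kHor (JK.R 𝔤 x) (JK.R 𝔤 a) = JK.kHor (JK.R 𝔤 y) (JK.R 𝔤 c) ∧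
        JK.kVert (JK.R 𝔤 x) (JK.R 𝔤 a) = JK.kVert (JK.R 𝔤 y) (JK.R 𝔤 c) := by
    rintro y c ⟨W, hW, hp, S₀, hS⟩
    have hS' : ∀ q ∈ W, ∃ S, JK.IsCanonicalForm (Kronecker.RFamily 𝔤 V q.1)
        (Kronecker.RFamily 𝔤 V q.2) S ∧ JK.SameType S S₀ := by
      intro q hq
      rw [Kronecker.RFamily_apply, Kronecker.RFamily_apply]
      exact hS q hq
    have h := Kronecker.indices_eq_of_generic hr har hline' hW hp hS'
    rw [Kronecker.RFamily_apply, Kronecker.RFamily_apply, Kronecker.RFamily_apply,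
      Kronecker.RFamily_apply] at h
    exact h
  -- A generic pair is needed because the infimum of an empty set of naturals would be the default
  -- value `0`.
  obtain ⟨W, p, S₀, hW, hp, hS⟩ := Kronecker.exists_generic_pair (Kronecker.RFamily 𝔤 V)
  simp only [Kronecker.RFamily_apply] at hS
  have hpgen : JK.IsGenericPair 𝔤 p.1 p.2 := ⟨W, hW, hp, S₀, hS⟩
  refine ⟨?_, ?_, ?_⟩
  · have h1 : {k | ∃ y c : V, JK.IsGenericPair 𝔤 y c ∧ JK.kHor (JK.R 𝔤 y) (JK.R 𝔤 c) = k} =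
        {JK.kHor (JK.R 𝔤 x) (JK.R 𝔤 a)} := by
      ext k
      refine ⟨?_, fun hk => ⟨p.1, p.2, hpgen, (hgen _ _ hpgen).1.symm.trans hk.symm⟩⟩
      rintro ⟨y, c, hyc, rfl⟩
      exact (hgen y c hyc).1.symm
    rw [JK.kHorRep, h1, csInf_singleton]
  · have h1 : {k | ∃ y c : V, JK.IsGenericPair 𝔤 y c ∧ JK.kVert (JK.R 𝔤 y) (JK.R 𝔤 c) = k} =
        {JK.kVert (JK.R 𝔤 x) (JK.R 𝔤 a)} := by
      ext k
      refine ⟨?_, fun hk => ⟨p.1, p.2, hpgen, (hgen _ _ hpgen).2.symm.trans hk.symm⟩⟩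
      rintro ⟨y, c, hyc, rfl⟩
      exact (hgen y c hyc).2.symm
    rw [JK.kVertRep, h1, csInf_singleton]
  · obtain ⟨ι, _, _, b, hb⟩ := Kronecker.exists_isKCF_mat (JK.R 𝔤 x) (JK.R 𝔤 a)
    rw [hb.totalDegree_charPoly, JK.fundSemiInvariant, ← Kronecker.linMatrix_RFamily]
    rw [← Kronecker.RFamily_apply, ← Kronecker.RFamily_apply] at hb
    exact hb.sum_jordanSize_eq (hb.sum_rho_eq_of_rank hr har) har hline'
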